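/- Let $U$ be a topological space whose one-point compactification $U^*$ is Hausdorff and is equipped with the structure of a finite CW complex for which the added point $*$ is the only $0$-cell, and put $\pi_U=\pi_1(U^*,*)$. For a finite set $N$ of size $n$ let $D_N(U)\subset (U^*)^N$ be the set of maps $N\to U^*$ that take the value $*$ or are not injective (the complement of the configuration space $\mathrm{Conf}_N(U)$), and put $\mathcal H_N(U)=H_n((U^*)^N,D_N(U);\mathbb Z)$ (relative singular homology). If $N=N_1\sqcup\dots\sqcup N_r$, there is a Künneth product $\mathcal H_{N_1}(U)\otimes\dots\otimes\mathcal H_{N_r}(U)\to\mathcal H_N(U)$. If $\mathbf N$ is $N$ with a total order $i_1<\dots<i_n$, then for $\gamma\in\pi_U$ let $\triangle^{\mathbf N}(\gamma)\in\mathcal H_N(U)$ be the image of the fundamental class of the simplex $\{0\le s_{1}\le\dots\le s_{n}\le 1\}$ relative to its boundary under the map to $(U^*)^N$ which sends $(s_1,\dots,s_n)$ to $i_k\mapsto\gamma(s_k)$, and extend $\triangle^{\mathbf N}$ linearly to $\mathbb Z\pi_U$. Let $\mathcal I_U\subset\mathbb Z\pi_U$ be the augmentation ideal and $\mathcal I_U|_k=\mathcal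 I_U/\mathcal I_U^{k+1}$. For each $1$-cell $c$ of $U^*$ choose an orientation and let $\gamma_c\in\pi_U$ be the class of the resulting loop. Let $\mathrm{Htp}(U^*,*)$ be the group of pointed homotopy classes of pointed self-homotopy equivalences of $(U^*,*)$. Assume $n=|N|>0$. Then: (0) for every totally ordered finite set $\mathbf S$ the map $\triangle^{\mathbf S}$ vanishes on $\mathcal I_U^{|S|+1}$, so that it induces a map $\triangle^{\mathbf S}_U:\mathcal I_U|_{|S|}\to\mathcal H_S(U)$. Hence for every partition $N=N_1\sqcup\dots\sqcup N_r$ into nonempty subsets, with a total order on each $N_i$ and with $n_i=|N_i|$, there is the map $$\triangle_U^{(\mathbf N_1,\dots,\mathbf N_r)}:\ \mathcal I_U|_{n_1}\otimes\dots\otimes\mathcal I_U|_{n_r}\longrightarrow\mathcal H_{N_1}(U)\otimes\dots\otimes\mathcal H_{N_r}(U)\longrightarrow\mathcal H_N(U),$$ the tensor product of the $\triangle_U^{\mathbf N_i}$ followed by the Künneth product; (1) the images of the maps $\triangle_U^{(\mathbf N_1,\dots,\mathbf N_r)}$, for all such ordered partitions of $N$ (all $r$, with all total orders on the parts), together generate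 the abelian group $\mathcal H_N(U)$; (2) for every choice of orientations of the $1$-cells, $\mathcal H_N(U)$ is already generated by the values of these maps on the tensors $(\gamma_{c_1}-1)|_{n_1}\otimes\dots\otimes(\gamma_{c_r}-1)|_{n_r}$ with $c_1,\dots,c_r$ $1$-cells of $U^*$; (3) the group $\mathrm{Htp}(U^*,*)$ acts on $\mathcal H_N(U)$ through its action on $\mathcal I_U|_n$: the homomorphism $\mathrm{Htp}(U^*,*)\to\mathrm{Aut}(\mathcal H_N(U))$ factors through the image of $\mathrm{Htp}(U^*,*)\to\mathrm{Aut}(\mathcal I_U|_n)$. -/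

import Mathlib

universe u v w

noncomputable section

namespace ConfSpace

/-! Formal singular chains -/

/-- Integral chains on tuples of `n + 1` elements of a vertex set `V`. -/
abbrev TupleChain (n : ℕ) (V : Type*) := (Fin (n + 1) → V) →₀ ℤ

/-- The map of tuple chains induced by a map of vertex sets. -/
def TupleChain.map {V W : Type*} (n : ℕ) (f : V → W) : TupleChain n V →ₗ[ℤ] TupleChain n W :=
  Finsupp.lmapDomain ℤ ℤ fun φ => f ∘ φ

/-- The alternating sum of the faces of a tuple. -/
def TupleChain.boundary {V : Type*} (n : ℕ) : TupleChain (n + 1) V →ₗ[ℤ] TupleChain n V :=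
  Finsupp.linearCombination ℤ fun φ =>
    ∑ i : Fin (n + 2), (-1 : ℤ) ^ (i : ℕ) • Finsupp.single (φ ∘ i.succAbove) (1 : ℤ)

/-- The cone `(v₀, …, vₙ) ↦ (v, v₀, …, vₙ)`. -/
def TupleChain.cone {V : Type*} (n : ℕ) (v : V) : TupleChain n V →ₗ[ℤ] TupleChain (n + 1) V :=
  Finsupp.lmapDomain ℤ ℤ fun φ => Fin.cons v φ

lemma TupleChain.map_single {V W : Type*} (n : ℕ) (f : V → W) (φ : Fin (n + 1) → V) (a : ℤ) :
    TupleChain.map n f (Finsupp.single φ a) = Finsupp.single (f ∘ φ) a := by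
  simp [TupleChain.map]

lemma TupleChain.cone_single {V : Type*} (n : ℕ) (v : V) (φ : Fin (n + 1) → V) (a : ℤ) :
    TupleChain.cone n v (Finsupp.single φ a) = Finsupp.single (Fin.cons v φ : Fin (n + 2) → V) a := by
  simp [TupleChain.cone]

lemma TupleChain.boundary_single {V : Type*} (n : ℕ) (φ : Fin (n + 2) → V) :
    TupleChain.boundary n (Finsupp.single φ (1 : ℤ)) =
      ∑ i : Fin (n + 2), (-1 : ℤ) ^ (i : ℕ) • Finsupp.single (φ ∘ i.succAbove) (1 : ℤ) := by
  simp [TupleChain.boundary]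

lemma TupleChain.map_map {V W Z : Type*} (n : ℕ) (f : V → W) (g : W → Z) (c : TupleChain n V) :
    TupleChain.map n g (TupleChain.map n f c) = TupleChain.map n (g ∘ f) c := by
  simp only [TupleChain.map, Finsupp.lmapDomain_apply, ← Finsupp.mapDomain_comp]
  rfl

lemma TupleChain.map_cone {V W : Type*} (n : ℕ) (f : V → W) (v : V) (c : TupleChain n V) :
    TupleChain.map (n + 1) f (TupleChain.cone n v c) =
      TupleChain.cone n (f v) (TupleChain.map n f c) := by
  simp only [TupleChain.map, TupleChain.cone, Finsupp.lmapDomain_apply, ← Finsupp.mapDomain_comp]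
  congr 1
  funext φ
  simp [Function.comp_def]
  funext i
  refine Fin.cases ?_ (fun j => ?_) i <;> simp

lemma TupleChain.boundary_map {V W : Type*} (n : ℕ) (f : V → W) (c : TupleChain (n + 1) V) :
    TupleChain.boundary n (TupleChain.map (n + 1) f c) =
      TupleChain.map n f (TupleChain.boundary n c) := by
  suffices h : TupleChain.boundary n ∘ₗ TupleChain.map (n + 1) f =
      TupleChain.map n f ∘ₗ TupleChain.boundary n from LinearMap.congr_fun h c
  ext φ : 2
  simp [TupleChain.map_single, TupleChain.boundary_single, Function.comp_assoc]

lemma TupleChain.boundary_cone {V : Type*} (n : ℕ) (v : V) (c : TupleChain (n + 1) V) :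
    TupleChain.boundary (n + 1) (TupleChain.cone (n + 1) v c) =
      c - TupleChain.cone n v (TupleChain.boundary n c) := by
  suffices h : TupleChain.boundary (n + 1) ∘ₗ TupleChain.cone (n + 1) v =
      LinearMap.id - TupleChain.cone n v ∘ₗ TupleChain.boundary n from LinearMap.congr_fun h c
  ext φ : 2
  simp only [LinearMap.comp_apply, Finsupp.lsingle_apply, TupleChain.cone_single,
    TupleChain.boundary_single, LinearMap.sub_apply, LinearMap.id_apply, map_sum, map_smul]
  rw [Fin.sum_univ_succ, sub_eq_add_neg, ← Finset.sum_neg_distrib]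
  have h0 : (Fin.cons v φ : Fin (n + 3) → V) ∘ Fin.succAbove 0 = φ := by
    funext i; simp
  rw [h0]
  congr 1
  · simp
  · refine Finset.sum_congr rfl fun i _ => ?_
    rw [Fin.cons_comp_succ_succAbove]
    have : i.removeNth φ = φ ∘ i.succAbove := rfl
    rw [this, Fin.val_succ, pow_succ]
    simp

/-- The Eilenberg–Zilber shuffle chain of `Δᵖ × Δ^q` in degree `n`: the signed sum over all lattice
paths `(0, 0) = v₀, v₁, …, vₙ = (p, q)` whose steps increase exactly one coordinate by one. The sign
of a path is `(-1)` to the number of pairs (step in the second coordinate, later step in the first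
coordinate); the recursion splits off the first step, and a first step in the second coordinate
contributes `(-1)^p`. For `n ≠ p + q` there is no such path and the chain is `0`. -/
def shuffleChain : (n p q : ℕ) → TupleChain n (Fin (p + 1) × Fin (q + 1))
  | 0, p, q => if p = 0 ∧ q = 0 then Finsupp.single (fun _ => (0, 0)) 1 else 0
  | n + 1, p, q => TupleChain.cone n (0, 0)
      ((match p with
        | 0 => 0
        | p + 1 => TupleChain.map n (Prod.map Fin.succ id) (shuffleChain n p q)) +
      (-1 : ℤ) ^ p • (match q with
        | 0 => 0
        | q + 1 => TupleChain.map n (Prod.map id Fin.succ) (shuffleChain n p q)))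

lemma shuffleChain_eq_zero (n p q : ℕ) (h : n ≠ p + q) : shuffleChain n p q = 0 := by
  induction n generalizing p q with
  | zero => rw [shuffleChain, if_neg (by omega)]
  | succ n ih =>
    rcases p with _ | p <;> rcases q with _ | q
    · simp [shuffleChain]
    · simp [shuffleChain, ih 0 q (by omega)]
    · simp [shuffleChain, ih p 0 (by omega)]
    · simp [shuffleChain, ih p (q + 1) (by omega), ih (p + 1) q (by omega)]

/-- The alternating sum of the faces in the first factor. -/
def shuffleFstFaces (n : ℕ) : (p q : ℕ) → TupleChain n (Fin (p + 1) × Fin (q + 1))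
  | 0, _ => 0
  | p + 1, q => ∑ i : Fin (p + 2), (-1 : ℤ) ^ (i : ℕ) •
      TupleChain.map n (Prod.map i.succAbove id) (shuffleChain n p q)

/-- The alternating sum of the faces in the second factor. -/
def shuffleSndFaces (n : ℕ) : (p q : ℕ) → TupleChain n (Fin (p + 1) × Fin (q + 1))
  | _, 0 => 0
  | p, q + 1 => ∑ i : Fin (q + 2), (-1 : ℤ) ^ (i : ℕ) •
      TupleChain.map n (Prod.map id i.succAbove) (shuffleChain n p q)

/-- The paths starting in the first coordinate, without their first vertex. -/
def shuffleFstTail (n : ℕ) : (p q : ℕ) → TupleChain n (Fin (p + 1) × Fin (q + 1))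
  | 0, _ => 0
  | p + 1, q => TupleChain.map n (Prod.map Fin.succ id) (shuffleChain n p q)

/-- The paths starting in the second coordinate, without their first vertex. -/
def shuffleSndTail (n : ℕ) : (p q : ℕ) → TupleChain n (Fin (p + 1) × Fin (q + 1))
  | _, 0 => 0
  | p, q + 1 => TupleChain.map n (Prod.map id Fin.succ) (shuffleChain n p q)

lemma shuffleChain_succ (n p q : ℕ) :
    shuffleChain (n + 1) p q = TupleChain.cone n (0, 0)
      (shuffleFstTail n p q + (-1 : ℤ) ^ p • shuffleSndTail n p q) := by
  rcases p with _ | p <;> rcases q with _ | q <;>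
    simp [shuffleChain, shuffleFstTail, shuffleSndTail]

lemma succ_succAbove_comp_succ {n : ℕ} (j : Fin (n + 1)) :
    (j.succ.succAbove : Fin (n + 1) → Fin (n + 2)) ∘ Fin.succ = Fin.succ ∘ j.succAbove := by
  funext k
  simp [Fin.succ_succAbove_succ]

lemma zero_succAbove_eq_succ {n : ℕ} :
    ((0 : Fin (n + 1)).succAbove : Fin n → Fin (n + 1)) = Fin.succ := by
  funext k
  simp

lemma sum_map_fstTail_fst (n p q : ℕ) :
    ∑ j : Fin (p + 1), (-1 : ℤ) ^ (j : ℕ) •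
      TupleChain.map n (Prod.map j.succ.succAbove id) (shuffleFstTail n p q) =
    TupleChain.map n (Prod.map Fin.succ id) (shuffleFstFaces n p q) := by
  rcases p with _ | p
  · simp [shuffleFstTail, shuffleFstFaces]
  · simp only [shuffleFstTail, shuffleFstFaces, map_sum, map_smul, TupleChain.map_map,
      Prod.map_comp_map, succ_succAbove_comp_succ]

lemma sum_map_sndTail_snd (n p q : ℕ) :
    ∑ j : Fin (q + 1), (-1 : ℤ) ^ (j : ℕ) •
      TupleChain.map n (Prod.map id j.succ.succAbove) (shuffleSndTail n p q) =
    TupleChain.map n (Prod.map id Fin.succ) (shuffleSndFaces n p q) := by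
  rcases q with _ | q
  · simp [shuffleSndTail, shuffleSndFaces]
  · simp only [shuffleSndTail, shuffleSndFaces, map_sum, map_smul, TupleChain.map_map,
      Prod.map_comp_map, succ_succAbove_comp_succ]

lemma shuffleFstFaces_succ (n p q : ℕ) :
    shuffleFstFaces n (p + 1) q = TupleChain.map n (Prod.map Fin.succ id) (shuffleChain n p q) -
      ∑ j : Fin (p + 1), (-1 : ℤ) ^ (j : ℕ) •
        TupleChain.map n (Prod.map j.succ.succAbove id) (shuffleChain n p q) := by
  rw [shuffleFstFaces, Fin.sum_univ_succ, zero_succAbove_eq_succ, sub_eq_add_neg,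
    ← Finset.sum_neg_distrib]
  simp [pow_succ]

lemma shuffleSndFaces_succ (n p q : ℕ) :
    shuffleSndFaces n p (q + 1) = TupleChain.map n (Prod.map id Fin.succ) (shuffleChain n p q) -
      ∑ j : Fin (q + 1), (-1 : ℤ) ^ (j : ℕ) •
        TupleChain.map n (Prod.map id j.succ.succAbove) (shuffleChain n p q) := by
  rw [shuffleSndFaces, Fin.sum_univ_succ, zero_succAbove_eq_succ, sub_eq_add_neg,
    ← Finset.sum_neg_distrib]
  simp [pow_succ]

lemma sum_map_sndTail_fst (n p q : ℕ) :
    ∑ j : Fin (p + 1), (-1 : ℤ) ^ (j : ℕ) •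
      TupleChain.map n (Prod.map j.succ.succAbove id) (shuffleSndTail n p (q + 1)) =
    TupleChain.map n (Prod.map Fin.succ Fin.succ) (shuffleChain n p q) -
      TupleChain.map n (Prod.map id Fin.succ) (shuffleFstFaces n (p + 1) q) := by
  simp only [shuffleSndTail, shuffleFstFaces_succ, map_sum, map_smul, map_sub, TupleChain.map_map,
      Prod.map_comp_map, Function.id_comp, Function.comp_id, sub_sub_cancel]

lemma sum_map_fstTail_snd (n p q : ℕ) :
    ∑ j : Fin (q + 1), (-1 : ℤ) ^ (j : ℕ) •
      TupleChain.map n (Prod.map id j.succ.succAbove) (shuffleFstTail n (p + 1) q) =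
    TupleChain.map n (Prod.map Fin.succ Fin.succ) (shuffleChain n p q) -
      TupleChain.map n (Prod.map Fin.succ id) (shuffleSndFaces n p (q + 1)) := by
  simp only [shuffleFstTail, shuffleSndFaces_succ, map_sum, map_smul, map_sub, TupleChain.map_map,
      Prod.map_comp_map, Function.id_comp, Function.comp_id, sub_sub_cancel]

/-- The faces of the next shuffle chain in the first factor. -/
lemma shuffleFstFaces_succ_succ (n p q : ℕ) :
    shuffleFstFaces (n + 1) (p + 1) q = shuffleFstTail (n + 1) (p + 1) q -
      TupleChain.cone n (0, 0)
        (TupleChain.map n (Prod.map Fin.succ id) (shuffleFstFaces n p q) +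
          (-1 : ℤ) ^ p • ∑ j : Fin (p + 1), (-1 : ℤ) ^ (j : ℕ) •
            TupleChain.map n (Prod.map j.succ.succAbove id) (shuffleSndTail n p q)) := by
  rw [shuffleFstFaces_succ, shuffleFstTail, ← sum_map_fstTail_fst]
  congr 1
  simp only [shuffleChain_succ, TupleChain.map_cone, map_add, map_smul, map_sum, smul_add,
    Finset.sum_add_distrib, Finset.smul_sum, smul_comm ((-1 : ℤ) ^ p)]
  rfl

lemma shuffleSndFaces_succ_succ (n p q : ℕ) :
    shuffleSndFaces (n + 1) p (q + 1) = shuffleSndTail (n + 1) p (q + 1) -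
      TupleChain.cone n (0, 0)
        ((∑ j : Fin (q + 1), (-1 : ℤ) ^ (j : ℕ) •
            TupleChain.map n (Prod.map id j.succ.succAbove) (shuffleFstTail n p q)) +
          (-1 : ℤ) ^ p •
            TupleChain.map n (Prod.map id Fin.succ) (shuffleSndFaces n p q)) := by
  rw [shuffleSndFaces_succ, shuffleSndTail, ← sum_map_sndTail_snd]
  congr 1
  simp only [shuffleChain_succ, TupleChain.map_cone, map_add, map_smul, map_sum, smul_add,
    Finset.sum_add_distrib, Finset.smul_sum, smul_comm ((-1 : ℤ) ^ p)]
  rfl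

lemma boundary_shuffleChain (n p q : ℕ) :
    TupleChain.boundary n (shuffleChain (n + 1) p q) =
      shuffleFstFaces n p q + (-1 : ℤ) ^ p • shuffleSndFaces n p q := by
  induction n generalizing p q with
  | zero =>
    rw [shuffleChain_succ]
    rcases p with _ | _ | p <;> rcases q with _ | _ | q <;>
      simp [shuffleFstTail, shuffleSndTail, shuffleFstFaces, shuffleSndFaces, shuffleChain,
        Fin.sum_univ_succ, TupleChain.map_single, TupleChain.cone_single,
        TupleChain.boundary_single]
    all_goals
      congr 1
      funext i
      rw [show i = 0 from Fin.fin_one_eq_zero i]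
      simp
  | succ n ih =>
    rw [shuffleChain_succ, TupleChain.boundary_cone]
    rcases p with _ | p <;> rcases q with _ | q
    · simp [shuffleFstTail, shuffleSndTail, shuffleFstFaces, shuffleSndFaces]
    · rw [shuffleSndFaces_succ_succ]
      simp [shuffleFstTail, shuffleSndTail, shuffleFstFaces, TupleChain.boundary_map, ih]
    · rw [shuffleFstFaces_succ_succ]
      simp [shuffleFstTail, shuffleSndTail, shuffleSndFaces, TupleChain.boundary_map, ih]
    · rw [shuffleFstFaces_succ_succ, shuffleSndFaces_succ_succ, sum_map_sndTail_fst,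
        sum_map_fstTail_snd]
      simp only [shuffleFstTail, shuffleSndTail, map_add, map_smul, TupleChain.boundary_map, ih,
        map_sub]
      rcases neg_one_pow_eq_or ℤ p with h | h <;> simp only [pow_succ, h] <;>
        simp <;> abel

/-! Singular chains and relative singular homology -/

section Singular

variable {X : Type u} {Y : Type v} {Z : Type w} [TopologicalSpace X] [TopologicalSpace Y]
  [TopologicalSpace Z]

/-- Singular `n`-simplices of `X`. -/
abbrev Sing (n : ℕ) (X : Type u) [TopologicalSpace X] := C(stdSimplex ℝ (Fin (n + 1)), X)

/-- Integral singular `n`-chains of `X`. -/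
abbrev SingChain (n : ℕ) (X : Type u) [TopologicalSpace X] := Sing n X →₀ ℤ

/-- The affine map of standard simplices induced by a map of vertices. -/
def simplexMap {m n : ℕ} (φ : Fin (m + 1) → Fin (n + 1)) :
    C(stdSimplex ℝ (Fin (m + 1)), stdSimplex ℝ (Fin (n + 1))) :=
  ⟨stdSimplex.map φ, stdSimplex.continuous_map φ⟩

lemma simplexMap_comp {l m n : ℕ} (φ : Fin (m + 1) → Fin (n + 1)) (ψ : Fin (l + 1) → Fin (m + 1)) :
    (simplexMap φ).comp (simplexMap ψ) = simplexMap (φ ∘ ψ) := by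
  ext1 x
  exact stdSimplex.map_comp_apply ψ φ x

lemma simplexMap_id {n : ℕ} : simplexMap (id : Fin (n + 1) → Fin (n + 1)) = ContinuousMap.id _ := by
  ext1 x
  exact stdSimplex.map_id_apply x

/-- The `i`-th face of a singular simplex. -/
def face {n : ℕ} (i : Fin (n + 2)) (σ : Sing (n + 1) X) : Sing n X :=
  σ.comp (simplexMap i.succAbove)

/-- The boundary `C_{n+1}(X) → C_n(X)` of the singular chain complex. -/
def faceSum (n : ℕ) : SingChain (n + 1) X →ₗ[ℤ] SingChain n X :=
  Finsupp.linearCombination ℤ fun σ : Sing (n + 1) X =>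
    ∑ i : Fin (n + 2), (-1 : ℤ) ^ (i : ℕ) • Finsupp.single (face i σ) (1 : ℤ)

/-- The boundary `C_n(X) → C_{n-1}(X)` of the singular chain complex (`0` on `C_0(X)`). -/
def boundary : (n : ℕ) → SingChain n X →ₗ[ℤ] SingChain (n - 1) X
  | 0 => 0
  | n + 1 => faceSum n

/-- The chain map induced by a continuous map. -/
def chainMap (n : ℕ) (f : C(X, Y)) : SingChain n X →ₗ[ℤ] SingChain n Y :=
  Finsupp.lmapDomain ℤ ℤ fun σ => f.comp σ

/-- The chains of `X` supported in a subspace `A`. -/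
def chainsIn (A : Set X) (n : ℕ) : Submodule ℤ (SingChain n X) :=
  Finsupp.supported ℤ ℤ {σ : Sing n X | ∀ x, σ x ∈ A}

lemma faceSum_single (n : ℕ) (σ : Sing (n + 1) X) :
    faceSum n (Finsupp.single σ (1 : ℤ)) =
      ∑ i : Fin (n + 2), (-1 : ℤ) ^ (i : ℕ) • Finsupp.single (face i σ) (1 : ℤ) := by
  simp [faceSum]

lemma chainMap_single (n : ℕ) (f : C(X, Y)) (σ : Sing n X) (a : ℤ) :
    chainMap n f (Finsupp.single σ a) = Finsupp.single (f.comp σ) a := by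
  simp [chainMap]

lemma chainMap_id (n : ℕ) (c : SingChain n X) : chainMap n (ContinuousMap.id X) c = c := by
  simp only [chainMap, Finsupp.lmapDomain_apply, ContinuousMap.id_comp]
  exact Finsupp.mapDomain_id

lemma chainMap_comp (n : ℕ) (g : C(Y, Z)) (f : C(X, Y)) (c : SingChain n X) :
    chainMap n (g.comp f) c = chainMap n g (chainMap n f c) := by
  simp only [chainMap, Finsupp.lmapDomain_apply, ← Finsupp.mapDomain_comp]
  rfl

lemma faceSum_chainMap (n : ℕ) (f : C(X, Y)) (c : SingChain (n + 1) X) :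
    faceSum n (chainMap (n + 1) f c) = chainMap n f (faceSum n c) := by
  suffices h : faceSum n ∘ₗ chainMap (n + 1) f = chainMap n f ∘ₗ faceSum n from
    LinearMap.congr_fun h c
  ext σ : 2
  simp only [LinearMap.comp_apply, Finsupp.lsingle_apply, chainMap_single, faceSum_single,
    map_sum, map_smul]
  rfl

lemma boundary_chainMap (n : ℕ) (f : C(X, Y)) (c : SingChain n X) :
    boundary n (chainMap n f c) = chainMap (n - 1) f (boundary n c) := by
  rcases n with _ | n
  · simp [boundary]
  · exact faceSum_chainMap n f c

lemma single_mem_chainsIn {A : Set X} {n : ℕ} {σ : Sing n X} (h : ∀ x, σ x ∈ A) (a : ℤ) :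
    Finsupp.single σ a ∈ chainsIn A n :=
  Finsupp.single_mem_supported ℤ a h

lemma chainsIn_le_iff {A : Set X} {n : ℕ} (P : Submodule ℤ (SingChain n X)) :
    chainsIn A n ≤ P ↔ ∀ σ : Sing n X, (∀ x, σ x ∈ A) → Finsupp.single σ (1 : ℤ) ∈ P := by
  rw [chainsIn, Finsupp.supported_eq_span_single, Submodule.span_le]
  exact ⟨fun h σ hσ => h ⟨σ, hσ, rfl⟩, by rintro h _ ⟨σ, hσ, rfl⟩; exact h σ hσ⟩

lemma chainMap_mem {A : Set X} {B : Set Y} (n : ℕ) (f : C(X, Y)) (hf : Set.MapsTo f A B)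
    {c : SingChain n X} (hc : c ∈ chainsIn A n) : chainMap n f c ∈ chainsIn B n := by
  have : chainsIn A n ≤ (chainsIn B n).comap (chainMap n f) := by
    rw [chainsIn_le_iff]
    intro σ hσ
    rw [Submodule.mem_comap, chainMap_single]
    exact single_mem_chainsIn (fun x => hf (hσ x)) 1
  exact this hc

/-- The relative cycles of the pair `(X, A)`: chains whose boundary lies in `A`. -/
def relCycles (A : Set X) (n : ℕ) : Submodule ℤ (SingChain n X) :=
  (chainsIn A (n - 1)).comap (boundary n)

/-- The relative boundaries of the pair `(X, A)`: sums of a boundary and a chain in `A`. -/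
def relBoundaries (A : Set X) (n : ℕ) : Submodule ℤ (SingChain n X) :=
  LinearMap.range (faceSum n : SingChain (n + 1) X →ₗ[ℤ] SingChain n X) ⊔ chainsIn A n

/-- The relative singular homology group `H_n(X, A)` with integral coefficients. -/
abbrev RelHomology (A : Set X) (n : ℕ) : Type u :=
  relCycles A n ⧸ (relBoundaries A n).comap (relCycles A n).subtype

/-- The homology class of a relative cycle. -/
def homologyClass {A : Set X} {n : ℕ} : relCycles A n →ₗ[ℤ] RelHomology A n :=
  Submodule.mkQ _

lemma homologyClass_eq_iff {A : Set X} {n : ℕ} (z z' : relCycles A n) :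
    homologyClass z = homologyClass z' ↔
      (z : SingChain n X) - (z' : SingChain n X) ∈ relBoundaries A n := by
  rw [homologyClass, Submodule.mkQ_apply, Submodule.mkQ_apply, Submodule.Quotient.eq]
  rfl

lemma chainMap_mem_relCycles {A : Set X} {B : Set Y} (n : ℕ) (f : C(X, Y))
    (hf : Set.MapsTo f A B) :
    ∀ c ∈ relCycles A n, chainMap n f c ∈ relCycles B n := by
  intro c hc
  rw [relCycles, Submodule.mem_comap, boundary_chainMap]
  exact chainMap_mem _ f hf hc

lemma chainMap_mem_relBoundaries {A : Set X} {B : Set Y} (n : ℕ) (f : C(X, Y))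
    (hf : Set.MapsTo f A B) :
    ∀ c ∈ relBoundaries A n, chainMap n f c ∈ relBoundaries B n := by
  intro c hc
  obtain ⟨_, ⟨w, rfl⟩, a, ha, rfl⟩ := Submodule.mem_sup.1 hc
  rw [map_add]
  refine Submodule.add_mem_sup ⟨chainMap (n + 1) f w, ?_⟩ (chainMap_mem n f hf ha)
  exact faceSum_chainMap n f w

/-- The map `H_n(X, A) → H_n(Y, B)` induced by a map of pairs. -/
def homologyMap {A : Set X} {B : Set Y} (n : ℕ) (f : C(X, Y)) (hf : Set.MapsTo f A B) :
    RelHomology A n →ₗ[ℤ] RelHomology B n :=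
  Submodule.mapQ _ _ ((chainMap n f).restrict (chainMap_mem_relCycles n f hf))
    fun z hz => chainMap_mem_relBoundaries n f hf z hz

lemma homologyMap_homologyClass {A : Set X} {B : Set Y} (n : ℕ) (f : C(X, Y))
    (hf : Set.MapsTo f A B) (z : relCycles A n) :
    homologyMap n f hf (homologyClass z) =
      homologyClass ⟨chainMap n f z, chainMap_mem_relCycles n f hf z z.2⟩ :=
  rfl

lemma homologyMap_id {A : Set X} (n : ℕ) (z : RelHomology A n) :
    homologyMap n (ContinuousMap.id X) (Set.mapsTo_id A) z = z := by
  obtain ⟨z, rfl⟩ := Submodule.mkQ_surjective _ z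
  refine (homologyMap_homologyClass n _ _ z).trans (congrArg homologyClass ?_)
  exact Subtype.ext (chainMap_id n _)

lemma homologyMap_comp {A : Set X} {B : Set Y} {C : Set Z} (n : ℕ) (g : C(Y, Z)) (f : C(X, Y))
    (hg : Set.MapsTo g B C) (hf : Set.MapsTo f A B) (z : RelHomology A n) :
    homologyMap n (g.comp f) (hg.comp hf) z = homologyMap n g hg (homologyMap n f hf z) := by
  obtain ⟨z, rfl⟩ := Submodule.mkQ_surjective _ z
  refine (homologyMap_homologyClass n _ _ z).trans (congrArg homologyClass ?_)
  exact Subtype.ext (chainMap_comp n g f _)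

/-! The homology cross product -/

/-- The chain of `X × Y` obtained from a chain of tuples of vertices of `Δᵖ × Δ^q` by means of
`σ : Δᵖ → X` and `τ : Δ^q → Y`. -/
def realize {p q : ℕ} (σ : Sing p X) (τ : Sing q Y) (n : ℕ) :
    TupleChain n (Fin (p + 1) × Fin (q + 1)) →ₗ[ℤ] SingChain n (X × Y) :=
  Finsupp.lmapDomain ℤ ℤ fun φ =>
    (σ.comp (simplexMap (Prod.fst ∘ φ))).prodMk (τ.comp (simplexMap (Prod.snd ∘ φ)))

/-- The degree `n` component of the cross product `C_p(X) ⊗ C_q(Y) → C_•(X × Y)`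
(nonzero only for `n = p + q`). -/
def cross (n p q : ℕ) : SingChain p X →ₗ[ℤ] SingChain q Y →ₗ[ℤ] SingChain n (X × Y) :=
  Finsupp.linearCombination ℤ fun σ : Sing p X =>
    Finsupp.linearCombination ℤ fun τ : Sing q Y => realize σ τ n (shuffleChain n p q)

lemma cross_single (n p q : ℕ) (σ : Sing p X) (τ : Sing q Y) :
    cross n p q (Finsupp.single σ 1) (Finsupp.single τ 1) =
      realize σ τ n (shuffleChain n p q) := by
  simp [cross]

lemma realize_single {p q : ℕ} (σ : Sing p X) (τ : Sing q Y) (n : ℕ)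
    (φ : Fin (n + 1) → Fin (p + 1) × Fin (q + 1)) (a : ℤ) :
    realize σ τ n (Finsupp.single φ a) = Finsupp.single
      ((σ.comp (simplexMap (Prod.fst ∘ φ))).prodMk (τ.comp (simplexMap (Prod.snd ∘ φ)))) a := by
  simp [realize]

lemma faceSum_realize {p q : ℕ} (σ : Sing p X) (τ : Sing q Y) (n : ℕ)
    (c : TupleChain (n + 1) (Fin (p + 1) × Fin (q + 1))) :
    faceSum n (realize σ τ (n + 1) c) = realize σ τ n (TupleChain.boundary n c) := by
  suffices h : faceSum n ∘ₗ realize σ τ (n + 1) = realize σ τ n ∘ₗ TupleChain.boundary n from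
    LinearMap.congr_fun h c
  ext φ : 2
  simp only [LinearMap.comp_apply, Finsupp.lsingle_apply, realize_single, faceSum_single,
    TupleChain.boundary_single, map_sum, map_smul]
  refine Finset.sum_congr rfl fun i _ => ?_
  have h : face i ((σ.comp (simplexMap (Prod.fst ∘ φ))).prodMk
        (τ.comp (simplexMap (Prod.snd ∘ φ)))) =
      (σ.comp (simplexMap (Prod.fst ∘ (φ ∘ i.succAbove)))).prodMk
        (τ.comp (simplexMap (Prod.snd ∘ (φ ∘ i.succAbove)))) := by
    rw [← Function.comp_assoc, ← Function.comp_assoc, ← simplexMap_comp, ← simplexMap_comp]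
    rfl
  rw [h]

lemma realize_map_fst {p q : ℕ} (σ : Sing (p + 1) X) (τ : Sing q Y) (n : ℕ) (i : Fin (p + 2))
    (c : TupleChain n (Fin (p + 1) × Fin (q + 1))) :
    realize σ τ n (TupleChain.map n (Prod.map i.succAbove id) c) = realize (face i σ) τ n c := by
  suffices h : realize σ τ n ∘ₗ TupleChain.map n (Prod.map i.succAbove id) = realize (face i σ) τ n
    from LinearMap.congr_fun h c
  ext φ : 2
  simp only [LinearMap.comp_apply, Finsupp.lsingle_apply, realize_single, TupleChain.map_single]
  congr 2
  rw [face, ContinuousMap.comp_assoc, simplexMap_comp]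
  rfl

lemma realize_map_snd {p q : ℕ} (σ : Sing p X) (τ : Sing (q + 1) Y) (n : ℕ) (i : Fin (q + 2))
    (c : TupleChain n (Fin (p + 1) × Fin (q + 1))) :
    realize σ τ n (TupleChain.map n (Prod.map id i.succAbove) c) = realize σ (face i τ) n c := by
  suffices h : realize σ τ n ∘ₗ TupleChain.map n (Prod.map id i.succAbove) = realize σ (face i τ) n
    from LinearMap.congr_fun h c
  ext φ : 2
  simp only [LinearMap.comp_apply, Finsupp.lsingle_apply, realize_single, TupleChain.map_single]
  congr 2
  rw [face, ContinuousMap.comp_assoc, simplexMap_comp]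
  rfl

/-- The Leibniz rule for the cross product. -/
lemma faceSum_cross (n p q : ℕ) (x : SingChain p X) (y : SingChain q Y) :
    faceSum n (cross (n + 1) p q x y) =
      cross n (p - 1) q (boundary p x) y + (-1 : ℤ) ^ p • cross n p (q - 1) x (boundary q y) := by
  suffices h : (cross (n + 1) p q).compr₂ (faceSum n) =
      (cross n (p - 1) q ∘ₗ boundary p) + (-1 : ℤ) ^ p • (cross n p (q - 1)).compl₂ (boundary q)
    from LinearMap.congr_fun (LinearMap.congr_fun h x) y
  ext σ τ : 4
  simp only [LinearMap.comp_apply, Finsupp.lsingle_apply, LinearMap.compr₂_apply,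
    LinearMap.add_apply, LinearMap.smul_apply, LinearMap.compl₂_apply, cross_single,
    faceSum_realize, boundary_shuffleChain, map_add, map_smul]
  congr 1
  · rcases p with _ | p
    · simp [shuffleFstFaces, boundary]
    · rw [boundary, faceSum_single, shuffleFstFaces, map_sum, map_sum, LinearMap.sum_apply]
      refine Finset.sum_congr rfl fun i _ => ?_
      rw [map_smul, map_smul, LinearMap.smul_apply, realize_map_fst]
      exact congrArg _ (cross_single n p q _ _).symm
  · congr 1
    rcases q with _ | q
    · simp [shuffleSndFaces, boundary]
    · rw [boundary, faceSum_single, shuffleSndFaces, map_sum, map_sum]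
      refine Finset.sum_congr rfl fun i _ => ?_
      rw [map_smul, map_smul, realize_map_snd]
      exact congrArg _ (cross_single n p q _ _).symm

lemma cross_mem {A : Set X} {B : Set Y} {C : Set (X × Y)} (n p q : ℕ)
    (h : ∀ a ∈ A, ∀ b ∈ B, (a, b) ∈ C) {x : SingChain p X} {y : SingChain q Y}
    (hx : x ∈ chainsIn A p) (hy : y ∈ chainsIn B q) : cross n p q x y ∈ chainsIn C n := by
  have key : chainsIn A p ≤ Submodule.comap (cross (X := X) (Y := Y) n p q)
      (Submodule.compatibleMaps (chainsIn B q) (chainsIn C n)) := by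
    rw [chainsIn_le_iff]
    intro σ hσ
    rw [Submodule.mem_comap]
    change chainsIn B q ≤ (chainsIn C n).comap (cross n p q (Finsupp.single σ 1))
    rw [chainsIn_le_iff]
    intro τ hτ
    rw [Submodule.mem_comap, cross_single]
    generalize shuffleChain n p q = c
    induction c using Finsupp.induction_linear with
    | zero => rw [map_zero]; exact Submodule.zero_mem _
    | add c d hc hd => rw [map_add]; exact Submodule.add_mem _ hc hd
    | single φ a =>
      rw [realize_single]
      exact single_mem_chainsIn (fun s => h _ (hσ _) _ (hτ _)) a
  exact key hx hy

/-- The subspace `A × Y ∪ X × B` of `X × Y`. -/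
def pairProd (A : Set X) (B : Set Y) : Set (X × Y) := {z | z.1 ∈ A ∨ z.2 ∈ B}

lemma mem_chainsIn_univ {n : ℕ} (x : SingChain n X) : x ∈ chainsIn (Set.univ : Set X) n := by
  have : {σ : Sing n X | ∀ x, σ x ∈ (Set.univ : Set X)} = Set.univ := by ext; simp
  rw [chainsIn, this, Finsupp.supported_univ]
  trivial

lemma cross_mem_left {A : Set X} (B : Set Y) (n p q : ℕ) {x : SingChain p X} (y : SingChain q Y)
    (hx : x ∈ chainsIn A p) : cross n p q x y ∈ chainsIn (pairProd A B) n :=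
  cross_mem n p q (fun _ ha _ _ => Or.inl ha) hx (mem_chainsIn_univ y)

lemma cross_mem_right (A : Set X) {B : Set Y} (n p q : ℕ) (x : SingChain p X) {y : SingChain q Y}
    (hy : y ∈ chainsIn B q) : cross n p q x y ∈ chainsIn (pairProd A B) n :=
  cross_mem n p q (fun _ _ _ hb => Or.inr hb) (mem_chainsIn_univ x) hy

lemma cross_mem_relCycles {A : Set X} {B : Set Y} (n p q : ℕ) {x : SingChain p X}
    {y : SingChain q Y} (hx : x ∈ relCycles A p) (hy : y ∈ relCycles B q) :
    cross n p q x y ∈ relCycles (pairProd A B) n := by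
  rcases n with _ | n
  · simp [relCycles, boundary]
  · rw [relCycles, Submodule.mem_comap, boundary, faceSum_cross]
    exact Submodule.add_mem _ (cross_mem_left B n _ _ y hx)
      (Submodule.smul_mem _ _ (cross_mem_right A n _ _ x hy))

lemma cross_mem_relBoundaries_left {A : Set X} {B : Set Y} (n p q : ℕ) {x : SingChain p X}
    {y : SingChain q Y} (hx : x ∈ relBoundaries A p) (hy : y ∈ relCycles B q) :
    cross n p q x y ∈ relBoundaries (pairProd A B) n := by
  obtain ⟨_, ⟨w, rfl⟩, a, ha, rfl⟩ := Submodule.mem_sup.1 hx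
  have h := faceSum_cross n (p + 1) q w y
  have h' : cross n p q (faceSum p w) y = faceSum n (cross (n + 1) (p + 1) q w y) -
      (-1 : ℤ) ^ (p + 1) • cross n (p + 1) (q - 1) w (boundary q y) :=
    eq_sub_of_add_eq h.symm
  rw [map_add, LinearMap.add_apply, h', sub_add_eq_add_sub, add_sub_assoc]
  exact Submodule.add_mem_sup ⟨_, rfl⟩ (Submodule.sub_mem _ (cross_mem_left B n p q y ha)
    (Submodule.smul_mem _ _ (cross_mem_right A n _ _ w hy)))

lemma cross_mem_relBoundaries_right {A : Set X} {B : Set Y} (n p q : ℕ) {x : SingChain p X}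
    {y : SingChain q Y} (hx : x ∈ relCycles A p) (hy : y ∈ relBoundaries B q) :
    cross n p q x y ∈ relBoundaries (pairProd A B) n := by
  obtain ⟨_, ⟨w, rfl⟩, b, hb, rfl⟩ := Submodule.mem_sup.1 hy
  have h := faceSum_cross n p (q + 1) x w
  have h' : cross n p q x (faceSum q w) =
      faceSum n ((-1 : ℤ) ^ p • cross (n + 1) p (q + 1) x w) -
      (-1 : ℤ) ^ p • cross n (p - 1) (q + 1) (boundary p x) w := by
    rw [map_smul, h, smul_add, smul_smul, ← mul_pow]
    simp
    rfl
  rw [map_add, h', sub_add_eq_add_sub, add_sub_assoc]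
  exact Submodule.add_mem_sup ⟨_, rfl⟩ (Submodule.sub_mem _ (cross_mem_right A n p q x hb)
    (Submodule.smul_mem _ _ (cross_mem_left B n _ _ w hx)))

/-- The degree `n` component of the relative homology cross product
`H_p(X, A) ⊗ H_q(Y, B) → H_•(X × Y, A × Y ∪ X × B)` (nonzero only for `n = p + q`). -/
def homologyCross (A : Set X) (B : Set Y) (n p q : ℕ) :
    RelHomology A p →ₗ[ℤ] RelHomology B q →ₗ[ℤ] RelHomology (pairProd A B) n :=
  LinearMap.liftQ₂ _ _
    (LinearMap.mk₂ ℤ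
      (fun (x : relCycles A p) (y : relCycles B q) => homologyClass
        (⟨cross n p q x.1 y.1, cross_mem_relCycles n p q x.2 y.2⟩ : relCycles (pairProd A B) n))
      (fun x x' y => by rw [← map_add]; congr 1; ext1; simp)
      (fun a x y => by rw [← map_smul]; congr 1; ext1; simp)
      (fun x y y' => by rw [← map_add]; congr 1; ext1; simp)
      (fun a x y => by rw [← map_smul]; congr 1; ext1; simp))
    (fun x hx => by
      ext y
      exact (Submodule.Quotient.mk_eq_zero _).2 (cross_mem_relBoundaries_left n p q hx y.2))
    (fun y hy => by
      ext x
      exact (Submodule.Quotient.mk_eq_zero _).2 (cross_mem_relBoundaries_right n p q x.2 hy))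

/-! Homotopy invariance -/

/-- The interval as a singular `1`-simplex. -/
def intervalSimplex : Sing 1 unitInterval :=
  ⟨stdSimplexHomeomorphUnitInterval, stdSimplexHomeomorphUnitInterval.continuous⟩

lemma faceSum_intervalSimplex :
    faceSum 0 (Finsupp.single intervalSimplex (1 : ℤ)) =
      Finsupp.single (ContinuousMap.const _ 1) 1 - Finsupp.single (ContinuousMap.const _ 0) 1 := by
  have h (i j : Fin 2) (hij : i.succAbove (0 : Fin 1) = j) :
      face i intervalSimplex = ContinuousMap.const _
        (stdSimplexHomeomorphUnitInterval (stdSimplex.vertex j)) := by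
    ext1 x
    rw [Subsingleton.elim x (stdSimplex.vertex (0 : Fin 1))]
    change stdSimplexHomeomorphUnitInterval (stdSimplex.map i.succAbove _) = _
    rw [stdSimplex.map_vertex, hij]
    rfl
  rw [faceSum_single, Fin.sum_univ_two, h 0 1 rfl, h 1 0 rfl]
  rw [show stdSimplexHomeomorphUnitInterval (stdSimplex.vertex 1) = 1 from rfl,
    show stdSimplexHomeomorphUnitInterval (stdSimplex.vertex 0) = 0 from rfl]
  simp [sub_eq_add_neg]

lemma shuffleChain_self_zero (n : ℕ) :
    shuffleChain n n 0 = Finsupp.single (fun i => (i, 0)) 1 := by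
  induction n with
  | zero =>
    simp only [shuffleChain, and_self, if_true]
    congr 1
    funext i
    rw [show i = 0 from Fin.fin_one_eq_zero i]
  | succ n ih =>
    rw [shuffleChain_succ, shuffleFstTail, shuffleSndTail, ih, TupleChain.map_single, smul_zero,
      add_zero, TupleChain.cone_single]
    congr 1
    funext i
    refine Fin.cases ?_ (fun j => ?_) i <;> simp

lemma cross_const (n : ℕ) (x : SingChain n X) (y : Y) :
    cross n n 0 x (Finsupp.single (ContinuousMap.const _ y) 1) =
      chainMap n ((ContinuousMap.id X).prodMk (ContinuousMap.const X y)) x := by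
  suffices h : (cross n n 0).flip (Finsupp.single (ContinuousMap.const _ y) 1) =
      chainMap n ((ContinuousMap.id X).prodMk (ContinuousMap.const X y)) from
    LinearMap.congr_fun h x
  ext σ : 2
  simp only [LinearMap.comp_apply, Finsupp.lsingle_apply, LinearMap.flip_apply, cross_single,
    shuffleChain_self_zero, realize_single, chainMap_single]
  congr 1
  have : (Prod.fst ∘ fun i : Fin (n + 1) => (i, (0 : Fin 1))) = id := rfl
  rw [this, simplexMap_id]
  rfl

/-- Homotopic maps of pairs induce the same map on relative homology. -/
lemma homologyMap_eq_of_homotopy {A : Set X} {B : Set Y} (n : ℕ) (f g : C(X, Y))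
    (hf : Set.MapsTo f A B) (hg : Set.MapsTo g A B) (F : C(X × unitInterval, Y))
    (hF : ∀ a ∈ A, ∀ t, F (a, t) ∈ B) (h0 : ∀ x, F (x, 0) = f x) (h1 : ∀ x, F (x, 1) = g x) :
    homologyMap n f hf = homologyMap n g hg := by
  ext z
  refine Eq.symm ((homologyClass_eq_iff _ _).2 ?_)
  change chainMap n g z - chainMap n f z ∈ relBoundaries B n
  have hf' : f = F.comp ((ContinuousMap.id X).prodMk (ContinuousMap.const X 0)) := by
    ext1 x; exact (h0 x).symm
  have hg' : g = F.comp ((ContinuousMap.id X).prodMk (ContinuousMap.const X 1)) := by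
    ext1 x; exact (h1 x).symm
  rw [hf', hg', chainMap_comp, chainMap_comp, ← map_sub, ← cross_const, ← cross_const, ← map_sub,
    ← faceSum_intervalSimplex]
  set ι : SingChain 1 unitInterval := Finsupp.single intervalSimplex 1
  have h := faceSum_cross n n 1 z.1 ι
  have h' : cross n n 0 z.1 (faceSum 0 ι) =
      faceSum n ((-1 : ℤ) ^ n • cross (n + 1) n 1 z.1 ι) -
        (-1 : ℤ) ^ n • cross n (n - 1) 1 (boundary n z.1) ι := by
    rw [map_smul, h, smul_add, smul_smul, ← mul_pow]
    simp
    rfl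
  rw [h', map_sub, ← faceSum_chainMap, sub_eq_add_neg]
  refine Submodule.add_mem_sup ⟨_, rfl⟩ (Submodule.neg_mem _ ?_)
  rw [map_smul]
  refine Submodule.smul_mem _ _ (chainMap_mem (A := pairProd A ∅) n F ?_
    (cross_mem_left ∅ n _ _ ι z.2))
  rintro ⟨a, t⟩ (ha | ha)
  · exact hF a ha t
  · exact ha.elim

/-! The fundamental class of the simplex modulo its boundary -/

/-- The boundary of the standard `n`-simplex. -/
def simplexBoundary (n : ℕ) : Set (stdSimplex ℝ (Fin (n + 1))) := {b | ∃ i, b i = 0}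

/-- The class of the identity in `H_n(Δⁿ, ∂Δⁿ)`. -/
def fundamentalClass (n : ℕ) : RelHomology (simplexBoundary n) n :=
  homologyClass ⟨Finsupp.single (ContinuousMap.id _) 1, by
    rcases n with _ | n
    · simp [relCycles, boundary]
    · rw [relCycles, Submodule.mem_comap, boundary, faceSum_single]
      refine Submodule.sum_mem _ fun i _ => Submodule.smul_mem _ _ (single_mem_chainsIn ?_ 1)
      intro x
      refine ⟨i, ?_⟩
      change (stdSimplex.map i.succAbove x) i = 0
      rw [stdSimplex.map_coe, FunOnFinite.linearMap_apply_apply]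
      refine Finset.sum_eq_zero fun j hj => ?_
      exact absurd (Finset.mem_filter.1 hj).2 (Fin.succAbove_ne i j)⟩

end Singular

/-! Configuration spaces of a pointed space -/

section Configurations

variable {X : Type u} [TopologicalSpace X] (x₀ : X)

/-- The complement in `X^N` of the space of injective maps `N → X ∖ {x₀}`. -/
def discriminant (N : Type v) : Set (N → X) :=
  {f | (∃ i, f i = x₀) ∨ ¬ Function.Injective f}

/-- The homology of the pair `(X^N, D_N)` in degree `k`, where `D_N` is the complement of the
configuration space `Conf_N(X ∖ {x₀})`. -/
abbrev ConfHomology (N : Type v) (k : ℕ) : Type (max u v) := RelHomology (discriminant x₀ N) k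

/-- The group `𝓗_N = H_n(X^N, D_N)` with `n = |N|`. -/
abbrev TopHomology (N : Type v) [Fintype N] : Type (max u v) := ConfHomology x₀ N (Fintype.card N)

/-- The functoriality of `H_k(X^N, D_N)` in bijections of `N`. -/
def reindex {M : Type v} {N : Type w} (e : M ≃ N) (k : ℕ) :
    ConfHomology x₀ M k →ₗ[ℤ] ConfHomology x₀ N k :=
  homologyMap k (⟨fun f => f ∘ e.symm, by fun_prop⟩ : C(M → X, N → X)) (by
    rintro f (⟨i, hi⟩ | hf)
    · exact Or.inl ⟨e i, by simpa using hi⟩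
    · refine Or.inr fun h => hf ?_
      have : f = (f ∘ e.symm) ∘ e := by funext i; simp
      rw [this]
      exact h.comp e.injective)

/-- The homeomorphism `X^M × X^N → X^(M ⊔ N)`. -/
def sumElim (M : Type v) (N : Type w) : C((M → X) × (N → X), M ⊕ N → X) :=
  ⟨fun z => Sum.elim z.1 z.2, continuous_pi fun i => by
    rcases i with i | i
    · exact (continuous_apply i).comp continuous_fst
    · exact (continuous_apply i).comp continuous_snd⟩

lemma sumElim_mapsTo (M : Type v) (N : Type w) :
    Set.MapsTo (sumElim (X := X) M N) (pairProd (discriminant x₀ M) (discriminant x₀ N))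
      (discriminant x₀ (M ⊕ N)) := by
  rintro ⟨f, g⟩ ((⟨i, hi⟩ | h) | (⟨i, hi⟩ | h))
  · exact Or.inl ⟨Sum.inl i, hi⟩
  · exact Or.inr fun H => h (H.comp Sum.inl_injective)
  · exact Or.inl ⟨Sum.inr i, hi⟩
  · exact Or.inr fun H => h (H.comp Sum.inr_injective)

/-- The degree `n` component of the Künneth product
`H_k(X^M, D_M) ⊗ H_l(X^N, D_N) → H_•(X^(M ⊔ N), D_(M ⊔ N))` (nonzero only for `n = k + l`). -/
def kunneth₂ (M : Type v) (N : Type w) (n k l : ℕ) :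
    ConfHomology x₀ M k →ₗ[ℤ] ConfHomology x₀ N l →ₗ[ℤ] ConfHomology x₀ (M ⊕ N) n :=
  (homologyCross (discriminant x₀ M) (discriminant x₀ N) n k l).compr₂
    (homologyMap n (sumElim M N) (sumElim_mapsTo x₀ M N))

/-- For empty `M` the class of the single point of `X^M` in degree `0` (and `0` in other degrees),
the unit of the Künneth product. -/
def unitClass (M : Type v) [IsEmpty M] : (n : ℕ) → ConfHomology x₀ M n
  | 0 => homologyClass ⟨Finsupp.single (ContinuousMap.const _ isEmptyElim) 1, by
      simp [relCycles, boundary]⟩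
  | _ + 1 => 0

/-- The first part of a finite family, added to the union of the others. -/
def sigmaSuccEquiv {r : ℕ} (N : Fin (r + 1) → Type v) :
    N 0 ⊕ (Σ i : Fin r, N i.succ) ≃ Σ i : Fin (r + 1), N i where
  toFun := Sum.elim (fun x => ⟨0, x⟩) (fun y => ⟨y.1.succ, y.2⟩)
  invFun z := Fin.cases (motive := fun i => N i → N 0 ⊕ (Σ i : Fin r, N i.succ))
    (fun x => Sum.inl x) (fun i x => Sum.inr ⟨i, x⟩) z.1 z.2
  left_inv := by rintro (x | ⟨i, x⟩) <;> rfl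
  right_inv := by
    rintro ⟨i, x⟩
    induction i using Fin.cases with
    | zero => rfl
    | succ i => rfl

/-- The degree `n` component of the `r`-fold Künneth product
`H_{k_1}(X^{N_1}, D_{N_1}) ⊗ ⋯ ⊗ H_{k_r}(X^{N_r}, D_{N_r}) → H_•(X^N, D_N)`,
`N = N_1 ⊔ ⋯ ⊔ N_r` (nonzero only for `n = k_1 + ⋯ + k_r`). -/
def kunneth : (r : ℕ) → (N : Fin r → Type v) → (k : Fin r → ℕ) → (n : ℕ) →
    MultilinearMap ℤ (fun i => ConfHomology x₀ (N i) (k i)) (ConfHomology x₀ (Σ i, N i) n)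
  | 0, _, _, n => MultilinearMap.constOfIsEmpty ℤ _ (unitClass x₀ _ n)
  | r + 1, N, k, n => LinearMap.uncurryLeft
      { toFun := fun z =>
          (reindex x₀ (sigmaSuccEquiv N) n ∘ₗ
            kunneth₂ x₀ (N 0) (Σ i : Fin r, N i.succ) n (k 0) (∑ i : Fin r, k i.succ) z
            ).compMultilinearMap
            (kunneth r (fun i => N i.succ) (fun i => k i.succ) (∑ i : Fin r, k i.succ))
        map_add' := fun z z' => by ext; simp
        map_smul' := fun a z => by ext; simp }

/-! The classes of loops -/

/-- The coordinate `s_i` on the simplex `0 ≤ s_1 ≤ ⋯ ≤ s_n ≤ 1`, as a function of the barycentric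
coordinates: `s_i = b_0 + ⋯ + b_{i-1}`. The index is shifted by one. -/
def partialSum {n : ℕ} (i : Fin n) : C(stdSimplex ℝ (Fin (n + 1)), unitInterval) :=
  ⟨fun b => ⟨∑ j : Fin (n + 1) with j ≤ i.castSucc, b j,
    Finset.sum_nonneg fun j _ => stdSimplex.zero_le b j, by
      rw [← stdSimplex.sum_eq_one b]
      exact Finset.sum_le_sum_of_subset_of_nonneg (Finset.filter_subset _ _)
        fun j _ _ => stdSimplex.zero_le b j⟩, by
    refine Continuous.subtype_mk (continuous_finsetSum _ fun j _ => ?_) _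
    exact (continuous_apply j).comp continuous_subtype_val⟩

/-- For a totally ordered finite set `N` of size `n`, the coordinates on the simplex
`0 ≤ s_1 ≤ ⋯ ≤ s_n ≤ 1` labelled by the elements of `N` in increasing order. -/
def orderCoord (N : Type v) [Fintype N] [LinearOrder N] (i : N) :
    C(stdSimplex ℝ (Fin (Fintype.card N + 1)), unitInterval) :=
  partialSum ((monoEquivOfFin N rfl).symm i)

lemma partialSum_zero {m : ℕ} (b : stdSimplex ℝ (Fin (m + 2))) :
    (partialSum (0 : Fin (m + 1)) b : ℝ) = b 0 := by
  change ∑ j : Fin (m + 2) with j ≤ (0 : Fin (m + 1)).castSucc, b j = b 0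
  rw [show ({j | j ≤ (0 : Fin (m + 1)).castSucc} : Finset (Fin (m + 2))) = {0} by
    ext j; simp]
  simp

lemma partialSum_last {m : ℕ} (b : stdSimplex ℝ (Fin (m + 2))) :
    (partialSum (Fin.last m) b : ℝ) = 1 - b (Fin.last (m + 1)) := by
  change ∑ j : Fin (m + 2) with j ≤ (Fin.last m).castSucc, b j = _
  rw [← stdSimplex.sum_eq_one b, Fin.sum_univ_castSucc, add_sub_cancel_right, Finset.sum_filter,
    Fin.sum_univ_castSucc]
  simp [Fin.le_def, Fin.is_le]

lemma partialSum_succ {m : ℕ} (b : stdSimplex ℝ (Fin (m + 2))) (i : Fin m) :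
    (partialSum i.succ b : ℝ) = partialSum i.castSucc b + b i.succ.castSucc := by
  change ∑ j : Fin (m + 2) with j ≤ i.succ.castSucc, b j =
    ∑ j : Fin (m + 2) with j ≤ i.castSucc.castSucc, b j + _
  rw [show ({j | j ≤ i.succ.castSucc} : Finset (Fin (m + 2))) =
    insert i.succ.castSucc ({j | j ≤ i.castSucc.castSucc} : Finset (Fin (m + 2))) by
      ext j; simp [Fin.le_def, Fin.ext_iff]; omega, Finset.sum_insert (by simp [Fin.le_def]),
    add_comm]

lemma partialSum_mem_discriminant {X : Type u} (x₀ : X) {n : ℕ} (g : unitInterval → X)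
    (h0 : g 0 = x₀) (h1 : g 1 = x₀) (b : stdSimplex ℝ (Fin (n + 1)))
    (hb : b ∈ simplexBoundary n) :
    (fun i : Fin n => g (partialSum i b)) ∈ discriminant x₀ (Fin n) := by
  obtain ⟨j, hj⟩ := hb
  rcases n with _ | m
  · have := stdSimplex.eq_one_of_unique (X := Fin 1) b j
    rw [hj] at this
    exact absurd this zero_ne_one
  · induction j using Fin.cases with
    | zero =>
      refine Or.inl ⟨0, ?_⟩
      change g (partialSum (0 : Fin (m + 1)) b) = x₀
      rw [show partialSum (0 : Fin (m + 1)) b = 0 from Subtype.ext ((partialSum_zero b).trans hj)]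
      exact h0
    | succ j =>
      induction j using Fin.lastCases with
      | last =>
        refine Or.inl ⟨Fin.last m, ?_⟩
        change g (partialSum (Fin.last m) b) = x₀
        rw [show partialSum (Fin.last m) b = 1 from Subtype.ext (by
          rw [partialSum_last]
          rw [Fin.succ_last] at hj
          simp [hj])]
        exact h1
      | cast i =>
        refine Or.inr fun h => ?_
        have : partialSum i.succ b = partialSum i.castSucc b := Subtype.ext (by
          rw [partialSum_succ]
          simpa using hj)
        have h2 := h (a₁ := i.succ) (a₂ := i.castSucc) (by simp only [this])
        simp [Fin.ext_iff] at h2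

lemma orderCoord_mem_discriminant {X : Type u} (x₀ : X) (N : Type v) [Fintype N] [LinearOrder N] (g : unitInterval → X)
    (h0 : g 0 = x₀) (h1 : g 1 = x₀) (b : stdSimplex ℝ (Fin (Fintype.card N + 1)))
    (hb : b ∈ simplexBoundary (Fintype.card N)) :
    (fun i => g (orderCoord N i b)) ∈ discriminant x₀ N := by
  rcases partialSum_mem_discriminant x₀ g h0 h1 b hb with ⟨k, hk⟩ | h
  · exact Or.inl ⟨monoEquivOfFin N rfl k, by simpa [orderCoord] using hk⟩
  · refine Or.inr fun H => h fun k l hkl => ?_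
    have := H (a₁ := monoEquivOfFin N rfl k) (a₂ := monoEquivOfFin N rfl l)
      (by simpa [orderCoord] using hkl)
    exact (monoEquivOfFin N rfl).injective this

variable {x₀}

/-- The map `(s_i)_{i ∈ N} ↦ (γ(s_i))_{i ∈ N}` from the simplex `0 ≤ s_1 ≤ ⋯ ≤ s_n ≤ 1` to `X^N`. -/
def simplexOfLoop (N : Type v) [Fintype N] [LinearOrder N] (γ : Path x₀ x₀) :
    C(stdSimplex ℝ (Fin (Fintype.card N + 1)), N → X) :=
  ⟨fun b i => γ (orderCoord N i b), by fun_prop⟩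

/-- The class in `𝓗_N` of the simplex `0 ≤ s_1 ≤ ⋯ ≤ s_n ≤ 1` mapped to `X^N` by a loop `γ`. -/
def triangleOfLoop (N : Type v) [Fintype N] [LinearOrder N] (γ : Path x₀ x₀) : TopHomology x₀ N :=
  homologyMap (Fintype.card N) (simplexOfLoop N γ)
    (fun b hb => orderCoord_mem_discriminant x₀ N γ γ.source γ.target b hb)
    (fundamentalClass (Fintype.card N))

lemma triangleOfLoop_eq (N : Type v) [Fintype N] [LinearOrder N] (γ γ' : Path x₀ x₀)
    (h : γ.Homotopic γ') : triangleOfLoop N γ = triangleOfLoop N γ' := by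
  obtain ⟨F⟩ := h
  refine LinearMap.congr_fun (homologyMap_eq_of_homotopy _ _ _ _ _
    ⟨fun z i => F (z.2, orderCoord N i z.1), by fun_prop⟩ (fun b hb t => ?_) ?_ ?_) _
  · exact orderCoord_mem_discriminant x₀ N (fun s => F (t, s)) (F.source t) (F.target t) b hb
  · intro b; funext i; exact F.apply_zero _
  · intro b; funext i; exact F.apply_one _

/-- The element `Δ^N(γ)` of `𝓗_N` for `γ ∈ π₁(X, x₀)` and a totally ordered finite set `N`. -/
def triangle (x₀ : X) (N : Type v) [Fintype N] [LinearOrder N] (γ : FundamentalGroup X x₀) :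
    TopHomology x₀ N :=
  Quotient.lift (triangleOfLoop N) (triangleOfLoop_eq N) γ.toPath

/-- The linear extension of `Δ^N` to the group ring `ℤπ₁(X, x₀)`. -/
def triangleLinear (x₀ : X) (N : Type v) [Fintype N] [LinearOrder N] :
    MonoidAlgebra ℤ (FundamentalGroup X x₀) →ₗ[ℤ] TopHomology x₀ N :=
  Finsupp.linearCombination ℤ (triangle x₀ N) ∘ₗ (MonoidAlgebra.coeffLinearEquiv ℤ).toLinearMap

end Configurations

/-! Truncated augmentation ideals -/

section Augmentation

variable (G : Type u) [Group G] {H : Type v} [Group H]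

/-- The augmentation `ℤG → ℤ`, equal to `1` on `G`. -/
def augmentation : MonoidAlgebra ℤ G →ₐ[ℤ] ℤ := MonoidAlgebra.lift ℤ ℤ G 1

/-- The augmentation ideal `I` of `ℤG`. Its powers are taken as products of `ℤ`-submodules, so that
`I ^ k` is spanned by the products of `k` elements of `I`. -/
def augIdeal : Submodule ℤ (MonoidAlgebra ℤ G) := LinearMap.ker (augmentation G).toLinearMap

/-- The truncation `I / I^{n+1}` of the augmentation ideal. -/
abbrev TruncAug (n : ℕ) : Type u := augIdeal G ⧸ (augIdeal G ^ (n + 1)).comap (augIdeal G).subtype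

variable {G}

/-- The class of `g - 1` in `I / I^{n+1}`. -/
def truncSubOne (n : ℕ) (g : G) : TruncAug G n :=
  Submodule.Quotient.mk ⟨MonoidAlgebra.of ℤ G g - 1, by simp [augIdeal, augmentation]⟩

lemma augmentation_mapDomain (φ : G →* H) (a : MonoidAlgebra ℤ G) :
    augmentation H (MonoidAlgebra.mapDomainAlgHom ℤ ℤ φ a) = augmentation G a := by
  suffices h : (augmentation H).comp (MonoidAlgebra.mapDomainAlgHom ℤ ℤ φ) = augmentation G from
    AlgHom.congr_fun h a
  ext g
  simp [augmentation]

lemma map_augIdeal_le (φ : G →* H) :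
    (augIdeal G).map (MonoidAlgebra.mapDomainAlgHom ℤ ℤ φ).toLinearMap ≤ augIdeal H := by
  rw [Submodule.map_le_iff_le_comap]
  intro a ha
  change augmentation H (MonoidAlgebra.mapDomainAlgHom ℤ ℤ φ a) = 0
  rw [augmentation_mapDomain]
  exact ha

lemma mapDomain_mem_augIdeal_pow (φ : G →* H) (k : ℕ) (a : MonoidAlgebra ℤ G)
    (ha : a ∈ augIdeal G ^ k) : MonoidAlgebra.mapDomainAlgHom ℤ ℤ φ a ∈ augIdeal H ^ k := by
  have h : (augIdeal G ^ k).map (MonoidAlgebra.mapDomainAlgHom ℤ ℤ φ).toLinearMap ≤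
      augIdeal H ^ k := by
    rw [Submodule.map_pow]
    exact pow_le_pow_left' (map_augIdeal_le φ) k
  exact h ⟨a, ha, rfl⟩

/-- The map `I_G / I_G^{n+1} → I_H / I_H^{n+1}` induced by a homomorphism `G → H`. -/
def truncMap (φ : G →* H) (n : ℕ) : TruncAug G n →ₗ[ℤ] TruncAug H n :=
  Submodule.mapQ _ _
    ((MonoidAlgebra.mapDomainAlgHom ℤ ℤ φ).toLinearMap.restrict
      (fun _ ha => map_augIdeal_le φ ⟨_, ha, rfl⟩))
    (fun a ha => mapDomain_mem_augIdeal_pow φ (n + 1) a ha)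

lemma truncMap_id (n : ℕ) : truncMap (MonoidHom.id G) n = LinearMap.id := by
  ext a
  refine congrArg Submodule.Quotient.mk (Subtype.ext ?_)
  change MonoidAlgebra.mapDomainAlgHom ℤ ℤ (MonoidHom.id G) a = a
  rw [MonoidAlgebra.mapDomainAlgHom_id]
  rfl

lemma truncMap_comp {K : Type w} [Group K] (ψ : H →* K) (φ : G →* H) (n : ℕ) :
    truncMap (ψ.comp φ) n = truncMap ψ n ∘ₗ truncMap φ n := by
  ext a
  refine congrArg Submodule.Quotient.mk (Subtype.ext ?_)
  change MonoidAlgebra.mapDomainAlgHom ℤ ℤ (ψ.comp φ) a.1 =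
    MonoidAlgebra.mapDomainAlgHom ℤ ℤ ψ (MonoidAlgebra.mapDomainAlgHom ℤ ℤ φ a.1)
  rw [MonoidAlgebra.mapDomainAlgHom_comp]
  rfl

/-- The action of the endomorphisms of `G` on `I / I^{n+1}`. -/
def truncEnd (G : Type u) [Group G] (n : ℕ) : Monoid.End G →* Module.End ℤ (TruncAug G n) where
  toFun φ := truncMap φ n
  map_one' := truncMap_id n
  map_mul' φ ψ := truncMap_comp φ ψ n

end Augmentation

/-! Ordered partitions and the maps `Δ^{(N_1, …, N_r)}` -/

section Partitions

/-- A partition of `N` into nonempty subsets `N_1, …, N_r` with a total order on each of them. -/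
structure OrderedPartition (N : Type v) where
  /-- The number of parts. -/
  r : ℕ
  /-- The index of the part that contains an element. -/
  part : N → Fin r
  surjective : Function.Surjective part
  /-- The total order on each part. -/
  order : ∀ i, LinearOrder {x : N // part x = i}

namespace OrderedPartition

variable {N : Type v} (P : OrderedPartition N)

/-- The `i`-th part `N_i`. -/
def Part (i : Fin P.r) : Type v := {x : N // P.part x = i}

instance (i : Fin P.r) : LinearOrder (P.Part i) := P.order i

instance [Fintype N] (i : Fin P.r) : Fintype (P.Part i) :=
  inferInstanceAs (Fintype {x : N // P.part x = i})

/-- `N` is the disjoint union of its parts. -/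
def equiv : (Σ i, P.Part i) ≃ N := Equiv.sigmaFiberEquiv P.part

end OrderedPartition

variable {X : Type u} [TopologicalSpace X] (x₀ : X)

/-- For every totally ordered finite set `S`, the map `Δ^S` vanishes on the power `I^{|S|+1}` of the
augmentation ideal of `ℤπ₁(X, x₀)`, so that it is defined on `I / I^{|S|+1}`. -/
def TriangleVanishes : Prop :=
  ∀ (S : Type v) [Fintype S] [LinearOrder S],
    augIdeal (FundamentalGroup X x₀) ^ (Fintype.card S + 1) ≤ LinearMap.ker (triangleLinear x₀ S)

variable {x₀}

/-- The map `Δ^S : I / I^{|S|+1} → 𝓗_S`. -/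
def truncTriangle (h : TriangleVanishes.{u, v} x₀) (S : Type v) [Fintype S] [LinearOrder S] :
    TruncAug (FundamentalGroup X x₀) (Fintype.card S) →ₗ[ℤ] TopHomology x₀ S :=
  Submodule.liftQ _ (triangleLinear x₀ S ∘ₗ (augIdeal _).subtype) (fun _ ha => h S ha)

/-- The map `Δ^{(N_1, …, N_r)} : I/I^{n_1+1} ⊗ ⋯ ⊗ I/I^{n_r+1} → 𝓗_{N_1} ⊗ ⋯ ⊗ 𝓗_{N_r} → 𝓗_N`. -/
def tensorTriangle (h : TriangleVanishes.{u, v} x₀) {N : Type v} [Fintype N]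
    (P : OrderedPartition N) :
    PiTensorProduct ℤ (fun i : Fin P.r =>
      TruncAug (FundamentalGroup X x₀) (Fintype.card (P.Part i))) →ₗ[ℤ] TopHomology x₀ N :=
  reindex x₀ P.equiv (Fintype.card N) ∘ₗ
    PiTensorProduct.lift
      ((kunneth x₀ P.r P.Part (fun i => Fintype.card (P.Part i)) (Fintype.card N)).compLinearMap
        fun i => truncTriangle h (P.Part i))

end Partitions

/-! Pointed self-homotopy equivalences -/

section Htp

variable {X : Type u} [TopologicalSpace X] (x₀ : X)

/-- The continuous maps `(X, x₀) → (X, x₀)`. -/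
structure PointedMap where
  /-- The underlying map. -/
  toMap : C(X, X)
  map_pt : toMap x₀ = x₀

variable {x₀}

namespace PointedMap

@[ext] lemma ext {f g : PointedMap x₀} (h : f.toMap = g.toMap) : f = g := by
  cases f; cases g; cases h; rfl

instance : Monoid (PointedMap x₀) where
  one := ⟨ContinuousMap.id X, rfl⟩
  mul f g := ⟨f.toMap.comp g.toMap, by rw [ContinuousMap.comp_apply, g.map_pt, f.map_pt]⟩
  mul_assoc _ _ _ := rfl
  one_mul _ := rfl
  mul_one _ := rfl

end PointedMap

variable (x₀)

/-- Homotopy relative to the base point, a congruence on the monoid of pointed maps. -/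
def pointedHomotopy : Con (PointedMap x₀) where
  r f g := f.toMap.HomotopicRel g.toMap {x₀}
  iseqv := ⟨fun f => .refl f.toMap, fun h => h.symm, fun h h' => h.trans h'⟩
  mul' := by
    rintro f f' g g' ⟨F⟩ ⟨G⟩
    refine ⟨⟨⟨⟨fun z => F (z.1, G z), by fun_prop⟩, ?_, ?_⟩, ?_⟩⟩
    · intro x
      change F (0, G (0, x)) = f.toMap (g.toMap x)
      rw [G.apply_zero, F.apply_zero]
    · intro x
      change F (1, G (1, x)) = f'.toMap (g'.toMap x)
      rw [G.apply_one, F.apply_one]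
    · rintro t x hx
      rw [Set.mem_singleton_iff] at hx
      subst hx
      change F (t, G (t, x)) = f.toMap (g.toMap x)
      rw [G.eq_fst t rfl, g.map_pt, F.eq_fst t rfl]

/-- The group of self-homotopy equivalences of `(X, x₀)`: the invertible elements of the monoid of
pointed homotopy classes of maps `(X, x₀) → (X, x₀)`. -/
abbrev Htp : Type u := ((pointedHomotopy x₀).Quotient)ˣ

variable {x₀}

/-- The map `f ↦ g ∘ f` on `X^N`. -/
def postcomp (N : Type v) (g : C(X, X)) : C(N → X, N → X) :=
  ⟨fun f i => g (f i), by fun_prop⟩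

lemma postcomp_mem {X : Type u} {x₀ : X} {N : Type v} {g : X → X} (hg : g x₀ = x₀) {f : N → X}
    (hf : f ∈ discriminant x₀ N) : (fun i => g (f i)) ∈ discriminant x₀ N := by
  rcases hf with ⟨i, hi⟩ | hf
  · exact Or.inl ⟨i, by simp only [hi, hg]⟩
  · exact Or.inr fun h => hf (Function.Injective.of_comp (f := g) h)

/-- The endomorphism of `H_k(X^N, D_N)` induced by a pointed map. -/
def confHomologyMap (N : Type v) (k : ℕ) (g : PointedMap x₀) :
    ConfHomology x₀ N k →ₗ[ℤ] ConfHomology x₀ N k :=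
  homologyMap k (postcomp N g.toMap) (fun _ hf => postcomp_mem g.map_pt hf)

variable (x₀)

/-- The action of pointed homotopy classes of maps on `H_k(X^N, D_N)`. -/
def confHomologyHom (N : Type v) (k : ℕ) :
    (pointedHomotopy x₀).Quotient →* Module.End ℤ (ConfHomology x₀ N k) :=
  (pointedHomotopy x₀).lift
    { toFun := confHomologyMap N k
      map_one' := LinearMap.ext fun z => homologyMap_id k z
      map_mul' := fun f g => LinearMap.ext fun z =>
        homologyMap_comp k (postcomp N f.toMap) (postcomp N g.toMap)
          (fun _ h => postcomp_mem f.map_pt h) (fun _ h => postcomp_mem g.map_pt h) z }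
    (by
      rintro f g ⟨F⟩
      change confHomologyMap N k f = confHomologyMap N k g
      refine homologyMap_eq_of_homotopy k _ _ _ _
        ⟨fun z i => F (z.2, z.1 i), by fun_prop⟩ (fun c hc t => ?_) ?_ ?_
      · exact postcomp_mem (g := fun x => F (t, x)) ((F.eq_fst t rfl).trans f.map_pt) hc
      · intro c; funext i; exact F.apply_zero _
      · intro c; funext i; exact F.apply_one _)

/-- The action of the group of self-homotopy equivalences of `(X, x₀)` on `𝓗_N`. -/
def htpTopHomology (N : Type v) [Fintype N] :
    Htp x₀ →* (Module.End ℤ (TopHomology x₀ N))ˣ :=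
  Units.map (confHomologyHom x₀ N (Fintype.card N))

lemma mapOfEq_mk (f : PointedMap x₀) (γ : Path x₀ x₀) :
    FundamentalGroup.mapOfEq f.toMap f.map_pt (Path.Homotopic.Quotient.mk γ) =
      Path.Homotopic.Quotient.mk
        ((γ.map f.toMap.continuous).cast f.map_pt.symm f.map_pt.symm) :=
  FundamentalGroup.mapOfEq_apply _ _ _

/-- The action of pointed homotopy classes of maps on `π₁(X, x₀)`. -/
def fundamentalGroupHom :
    (pointedHomotopy x₀).Quotient →* Monoid.End (FundamentalGroup X x₀) :=
  (pointedHomotopy x₀).lift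
    { toFun := fun f => FundamentalGroup.mapOfEq f.toMap f.map_pt
      map_one' := by
        refine MonoidHom.ext fun p => ?_
        obtain ⟨γ, rfl⟩ := Path.Homotopic.Quotient.mk_surjective p
        exact mapOfEq_mk x₀ 1 γ
      map_mul' := fun f g => by
        refine MonoidHom.ext fun p => ?_
        obtain ⟨γ, rfl⟩ := Path.Homotopic.Quotient.mk_surjective p
        refine (mapOfEq_mk x₀ (f * g) γ).trans ?_
        change _ = FundamentalGroup.mapOfEq f.toMap f.map_pt
          (FundamentalGroup.mapOfEq g.toMap g.map_pt (Path.Homotopic.Quotient.mk γ))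
        rw [mapOfEq_mk, mapOfEq_mk]
        rfl }
    (by
      rintro f g ⟨F⟩
      refine MonoidHom.ext fun p => ?_
      obtain ⟨γ, rfl⟩ := Path.Homotopic.Quotient.mk_surjective p
      refine (mapOfEq_mk x₀ f γ).trans (Eq.trans ?_ (mapOfEq_mk x₀ g γ).symm)
      refine Path.Homotopic.Quotient.eq.2 ⟨⟨⟨⟨fun z => F (z.1, γ z.2), by fun_prop⟩, ?_, ?_⟩, ?_⟩⟩
      · intro t; exact F.apply_zero _
      · intro t; exact F.apply_one _
      · rintro t s (hs | hs)
        · subst hs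
          exact F.eq_fst t (by simp)
        · rw [Set.mem_singleton_iff] at hs
          subst hs
          exact F.eq_fst t (by simp))

/-- The action of the group of self-homotopy equivalences of `(X, x₀)` on `I / I^{n+1}`, where `I` is
the augmentation ideal of `ℤπ₁(X, x₀)`. -/
def htpTruncAug (n : ℕ) : Htp x₀ →* (Module.End ℤ (TruncAug (FundamentalGroup X x₀) n))ˣ :=
  Units.map ((truncEnd (FundamentalGroup X x₀) n).comp (fundamentalGroupHom x₀))

end Htp

/-! The loops given by the `1`-cells -/

section Cells

open Topology

variable {X : Type u} [TopologicalSpace X] [CWComplex (Set.univ : Set X)] (x₀ : X)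

/-- The point `x₀` is the only `0`-cell of the CW complex `X`. -/
def IsOnlyVertex : Prop :=
  ∃ e₀ : RelCWComplex.cell (Set.univ : Set X) 0,
    (∀ e : RelCWComplex.cell (Set.univ : Set X) 0, e = e₀) ∧ RelCWComplex.map 0 e₀ 0 = x₀

variable {x₀}

lemma map_one_eq (h : IsOnlyVertex x₀) (c : RelCWComplex.cell (Set.univ : Set X) 1) (v : Fin 1 → ℝ)
    (hv : v ∈ Metric.sphere (0 : Fin 1 → ℝ) 1) : RelCWComplex.map 1 c v = x₀ := by
  obtain ⟨I, hI⟩ := CWComplex.mapsTo 1 c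
  obtain ⟨e₀, he, hx⟩ := h
  have := hI hv
  simp only [Set.mem_iUnion] at this
  obtain ⟨m, hm, j, -, y, -, hy⟩ := this
  obtain rfl : m = 0 := by omega
  rw [← hy, he j, Subsingleton.elim y 0, hx]

/-- The loop `t ↦ Φ_c(2t - 1)`, where `Φ_c : [-1, 1] → X` is the characteristic map of the
`1`-cell `c`. -/
def cellLoop (h : IsOnlyVertex x₀) (c : RelCWComplex.cell (Set.univ : Set X) 1) : Path x₀ x₀ where
  toFun t := RelCWComplex.map 1 c (fun _ => 2 * (t : ℝ) - 1)
  continuous_toFun := by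
    refine (RelCWComplex.continuousOn 1 c).comp_continuous (by fun_prop) fun t => ?_
    rw [mem_closedBall_zero_iff, pi_norm_le_iff_of_nonneg zero_le_one]
    intro _
    rw [Real.norm_eq_abs, abs_le]
    constructor <;> linarith [t.2.1, t.2.2]
  source' := map_one_eq h c _ (by
    rw [mem_sphere_zero_iff_norm, pi_norm_const]; norm_num)
  target' := map_one_eq h c _ (by
    rw [mem_sphere_zero_iff_norm, pi_norm_const]; norm_num)

/-- The class `γ_c ∈ π₁(X, x₀)` of a `1`-cell `c` with one of its two orientations (the one of the
characteristic map for `true`, the opposite one for `false`). -/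
def cellClass (h : IsOnlyVertex x₀) (o : Bool) (c : RelCWComplex.cell (Set.univ : Set X) 1) :
    FundamentalGroup X x₀ :=
  FundamentalGroup.fromPath
    (Path.Homotopic.Quotient.mk (if o then cellLoop h c else (cellLoop h c).symm))

end Cells

end ConfSpace

end

noncomputable section

namespace ConfSpace

/-! The Alexander–Whitney map followed by the shuffle map -/

/-! Write `X` for the pointed space and `D` for the discriminant in `X^N`, with `n = |N|`.

Generation comes from a stratification of Fox–Neuwirth type of the complement of `D`. The cells of
`X` other than the base point are open cubes. To a configuration one attaches its shape: the cell of
each point, the pairs of points in a common cell whose first coordinates agree, and the sign at the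
first coordinate where they differ. The configurations of a given shape form the interior of a
convex polytope (`Param.poly`), whose boundary goes to `D` and to shapes of smaller `rank`. So `X^N`
is built from `D` by attaching finitely many polytopes (`stratum_induction`), and by
`exists_relCycle_of_cell` each attachment adds only classes from the polytope modulo its boundary.
If some point lies in a cell of dimension at least two, the polytope has dimension greater than `n`
(`card_lt_finrank_space`) and contributes nothing in degree `n`. If all points lie in 1-cells, it is
a product of simplices `0 ≤ s_1 ≤ ⋯ ≤ s_k ≤ 1`, one for each 1-cell that is occupied
(`exists_simplexProd_map`). Its top homology is generated by a cross product of fundamental classes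
(`exists_cross_sub_mem`), which maps to the Künneth product of the classes of the loops `γ_c`. As a
constant loop has class zero, these are the values at `γ_c - 1`. Only generation is claimed, so no
exact sequence and no independence of cells is needed.

The vanishing on powers of the augmentation ideal is a coproduct formula. Cutting the simplex
according to how many `s_i` are at most `1/2` expresses the class of a concatenation as the sum over
`p + q = n` of products of classes of the two loops in degrees `p` and `q`
(`finTriangleOfLoop_trans`). In degree zero the class sees only the augmentation, so induction on
the exponent kills `I^k` for `k > n` (`augIdeal_pow_le_ker`).

One construction serves both arguments. The Alexander–Whitney map followed by the shuffle map, with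
pairs of vertices realized as midpoints, is a natural subdivision `sd`. It is chain homotopic to the
identity and halves the size of simplices, which gives small simplices and excision. Its value on
the standard simplex is also exactly the cut above (`subdiv_simplexChain`).

For the action of self-equivalences, all constructions are natural in pointed maps. Equality on `I /
I^{n+1}` implies equality on every `I / I^{k+1}` with `k ≤ n`, hence on all generators, so the
kernel of one action lies in that of the other (`exists_htpTopHomology_eq`). -/

lemma TupleChain.boundary_boundary {V : Type*} (n : ℕ) (c : TupleChain (n + 2) V) :
    TupleChain.boundary n (TupleChain.boundary (n + 1) c) = 0 := by
  suffices h : TupleChain.boundary n ∘ₗ TupleChain.boundary (n + 1) =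
      (0 : TupleChain (n + 2) V →ₗ[ℤ] TupleChain n V) from LinearMap.congr_fun h c
  ext φ : 2
  simp only [LinearMap.comp_apply, Finsupp.lsingle_apply, LinearMap.zero_apply]
  clear c
  induction n with
  | zero =>
    -- A tuple is the cone from its first entry over its tail. The cone formula then reduces the
    -- claim to one degree less.
    have hc : Finsupp.single φ (1 : ℤ) =
        TupleChain.cone 1 (φ 0) (Finsupp.single (Fin.tail φ) 1) := by
      rw [TupleChain.cone_single, Fin.cons_self_tail]
    have h2 (v : V) (ψ : Fin 1 → V) : TupleChain.boundary 0 (TupleChain.cone 0 v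
        (Finsupp.single ψ 1)) = Finsupp.single ψ 1 - Finsupp.single (fun _ => v) 1 := by
      rw [TupleChain.cone_single, TupleChain.boundary_single, Fin.sum_univ_two, sub_eq_add_neg]
      congr 1
      · simp
      · simp
        congr 1
        funext i
        rw [Fin.fin_one_eq_zero i]
        rfl
    rw [hc, TupleChain.boundary_cone, map_sub, TupleChain.boundary_single, Fin.sum_univ_two]
    simp only [map_add, map_smul, h2, smul_sub]
    simp
  | succ n ih =>
    have hc : Finsupp.single φ (1 : ℤ) =
        TupleChain.cone (n + 2) (φ 0) (Finsupp.single (Fin.tail φ) 1) := by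
      rw [TupleChain.cone_single, Fin.cons_self_tail]
    rw [hc, TupleChain.boundary_cone, map_sub, TupleChain.boundary_cone, ih, map_zero,
      sub_zero, sub_self]

lemma TupleChain.map_congr_of_forall {V W : Type*} (n : ℕ) {f g : V → W} (h : ∀ x, f x = g x)
    (c : TupleChain n V) : TupleChain.map n f c = TupleChain.map n g c := by
  rw [funext h]

/-- The face inclusion that omits `i`, as a map of natural numbers. -/
def skip (i j : ℕ) : ℕ := if j < i then j else j + 1

lemma skip_of_lt {i j : ℕ} (h : j < i) : skip i j = j := if_pos h

lemma skip_of_le {i j : ℕ} (h : i ≤ j) : skip i j = j + 1 := if_neg (by omega)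

lemma val_succAbove {n : ℕ} (i : Fin (n + 1)) (j : Fin n) : (i.succAbove j : ℕ) = skip i j := by
  simp only [Fin.succAbove, skip, Fin.lt_def, Fin.val_castSucc]
  split_ifs <;> simp

/-- The face inclusion that omits `i` in both coordinates. -/
def skipPair (i : ℕ) (x : ℕ × ℕ) : ℕ × ℕ := (skip i x.1, skip i x.2)

/-- The shuffle chain with vertices `(i, j)` for `i ≤ p ≤ j ≤ p + q`. -/
def shiftShuffle (n p q : ℕ) : TupleChain n (ℕ × ℕ) :=
  TupleChain.map n (fun x => ((x.1 : ℕ), p + (x.2 : ℕ))) (shuffleChain n p q)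

/-- The shuffle chain with vertices `(i, j)` for `i ≤ p < j ≤ p + q + 1`. -/
def wallShuffle (n p q : ℕ) : TupleChain n (ℕ × ℕ) :=
  TupleChain.map n (fun x => ((x.1 : ℕ), p + 1 + (x.2 : ℕ))) (shuffleChain n p q)

/-- The composite of the Alexander–Whitney and shuffle maps on the standard `n`-simplex. -/
def diagonalChain (n : ℕ) : TupleChain n (ℕ × ℕ) :=
  ∑ p ∈ Finset.HasAntidiagonal.antidiagonal n, shiftShuffle n p.1 p.2

/-- The front and back simplices share the vertex `p + 1`. Omitting a vertex `i ≤ p` of the front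
shifts the whole back simplex, so it is an honest face of the big simplex. Omitting the shared
vertex from the front alone is not, and leaves a wall. -/
lemma map_shift_shuffleFstFaces (n p q : ℕ) :
    TupleChain.map n (fun x => ((x.1 : ℕ), p + 1 + (x.2 : ℕ))) (shuffleFstFaces n (p + 1) q) =
      ∑ i ∈ Finset.range (p + 1), (-1 : ℤ) ^ i •
        TupleChain.map n (skipPair i) (shiftShuffle n p q) +
      (-1 : ℤ) ^ (p + 1) • wallShuffle n p q := by
  simp only [shuffleFstFaces, map_sum, map_smul, TupleChain.map_map, wallShuffle, shiftShuffle]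
  rw [Fin.sum_univ_castSucc, ← Fin.sum_univ_eq_sum_range
    (fun i => (-1 : ℤ) ^ i • TupleChain.map n (skipPair i ∘ _) (shuffleChain n p q))]
  congr 1
  · refine Finset.sum_congr rfl fun i _ => ?_
    rw [Fin.val_castSucc]
    congr 1
    refine TupleChain.map_congr_of_forall n (fun x => ?_) _
    have := i.2
    simp only [Function.comp_apply, Prod.map, val_succAbove, skipPair, id, Fin.val_castSucc]
    rw [skip_of_le (j := p + (x.2 : ℕ)) (by omega)]
    congr 1
    omega
  · rw [Fin.val_last]
    congr 1
    refine TupleChain.map_congr_of_forall n (fun x => ?_) _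
    have := x.1.2
    simp only [Function.comp_apply, Prod.map, val_succAbove, id, Fin.val_last]
    rw [skip_of_lt (by omega)]

/-- Here the exceptional face omits the shared vertex `p` from the back simplex. It is the same wall
as the one produced by the front faces for `p + 1`, which is what makes the cancellation possible.
-/
lemma map_shift_shuffleSndFaces (n p q : ℕ) :
    TupleChain.map n (fun x => ((x.1 : ℕ), p + (x.2 : ℕ))) (shuffleSndFaces n p (q + 1)) =
      wallShuffle n p q +
      ∑ j ∈ Finset.range (q + 1), (-1 : ℤ) ^ (j + 1) •
        TupleChain.map n (skipPair (p + 1 + j)) (shiftShuffle n p q) := by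
  simp only [shuffleSndFaces, map_sum, map_smul, TupleChain.map_map, wallShuffle, shiftShuffle]
  rw [Fin.sum_univ_succ, ← Fin.sum_univ_eq_sum_range
    (fun j => (-1 : ℤ) ^ (j + 1) • TupleChain.map n (skipPair (p + 1 + j) ∘ _)
      (shuffleChain n p q))]
  congr 1
  · simp only [Fin.val_zero, pow_zero, one_smul]
    refine TupleChain.map_congr_of_forall n (fun x => ?_) _
    simp only [Function.comp_apply, Prod.map, val_succAbove, id, Fin.val_zero]
    rw [skip_of_le (by omega)]
    congr 1
    omega
  · refine Finset.sum_congr rfl fun j _ => ?_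
    rw [Fin.val_succ]
    congr 1
    refine TupleChain.map_congr_of_forall n (fun x => ?_) _
    have := x.1.2
    simp only [Function.comp_apply, Prod.map, val_succAbove, skipPair, id, Fin.val_succ]
    rw [skip_of_lt (i := p + 1 + j) (j := (x.1 : ℕ)) (by omega)]
    congr 1
    simp only [skip]
    split_ifs <;> omega

/-- The walls occur once as a last front face, with sign `(-1)^(p+1)`, and once as a first back
face, with sign `(-1)^p`, and cancel. The remaining faces are those omitting one vertex from both
coordinates. -/
lemma boundary_diagonalChain (n : ℕ) :
    TupleChain.boundary n (diagonalChain (n + 1)) =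
      ∑ i ∈ Finset.range (n + 2), (-1 : ℤ) ^ i •
        TupleChain.map n (skipPair i) (diagonalChain n) := by
  have h1 : TupleChain.boundary n (diagonalChain (n + 1)) =
      ∑ p ∈ Finset.HasAntidiagonal.antidiagonal (n + 1),
        TupleChain.map n (fun x => ((x.1 : ℕ), p.1 + (x.2 : ℕ))) (shuffleFstFaces n p.1 p.2) +
      ∑ p ∈ Finset.HasAntidiagonal.antidiagonal (n + 1), (-1 : ℤ) ^ p.1 •
        TupleChain.map n (fun x => ((x.1 : ℕ), p.1 + (x.2 : ℕ))) (shuffleSndFaces n p.1 p.2) := by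
    rw [diagonalChain, map_sum, ← Finset.sum_add_distrib]
    refine Finset.sum_congr rfl fun p _ => ?_
    rw [shiftShuffle, TupleChain.boundary_map, boundary_shuffleChain, map_add, map_smul]
  rw [h1, Finset.Nat.sum_antidiagonal_succ, Finset.Nat.sum_antidiagonal_succ']
  simp only [map_shift_shuffleFstFaces, map_shift_shuffleSndFaces]
  have h2 : TupleChain.map n (fun x => ((x.1 : ℕ), 0 + (x.2 : ℕ)))
      (shuffleFstFaces n 0 (n + 1)) = 0 := by simp [shuffleFstFaces]
  have h3 : TupleChain.map n (fun x => ((x.1 : ℕ), n + 1 + (x.2 : ℕ)))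
      (shuffleSndFaces n (n + 1) 0) = 0 := by simp [shuffleSndFaces]
  rw [h2, h3, smul_zero, zero_add, zero_add, ← Finset.sum_add_distrib]
  simp only [diagonalChain, map_sum, Finset.smul_sum]
  rw [Finset.sum_comm]
  refine Finset.sum_congr rfl fun p hp => ?_
  rw [Finset.HasAntidiagonal.mem_antidiagonal] at hp
  rw [show n + 2 = (p.1 + 1) + (p.2 + 1) by omega, Finset.sum_range_add _ (p.1 + 1) (p.2 + 1),
    smul_add, pow_succ,
    Finset.smul_sum]
  simp only [smul_smul, pow_add, pow_one]
  have : ((-1 : ℤ) ^ p.1 * -1) • wallShuffle n p.1 p.2 =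
      - ((-1 : ℤ) ^ p.1 • wallShuffle n p.1 p.2) := by simp
  rw [this, add_assoc, neg_add_cancel_left]
  congr 1
  refine Finset.sum_congr rfl fun j _ => ?_
  congr 1
  ring

end ConfSpace

end

noncomputable section

namespace ConfSpace

/-! Affine simplices in a standard simplex -/

/-- The affine map of standard simplices with given values at the vertices. -/
def affineSimplex {m n : ℕ} (v : Fin (n + 1) → stdSimplex ℝ (Fin (m + 1))) :
    C(stdSimplex ℝ (Fin (n + 1)), stdSimplex ℝ (Fin (m + 1))) :=
  ⟨fun b => ⟨fun i => ∑ j, b j * v j i, fun i => Finset.sum_nonneg fun j _ =>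
      mul_nonneg (stdSimplex.zero_le b j) (stdSimplex.zero_le (v j) i), by
      rw [Finset.sum_comm]
      simp only [← Finset.mul_sum, stdSimplex.sum_eq_one, mul_one]⟩, by
    refine Continuous.subtype_mk (continuous_pi fun i => continuous_finsetSum _ fun j _ => ?_) _
    exact ((continuous_apply j).comp continuous_subtype_val).mul continuous_const⟩

lemma affineSimplex_apply {m n : ℕ} (v : Fin (n + 1) → stdSimplex ℝ (Fin (m + 1)))
    (b : stdSimplex ℝ (Fin (n + 1))) (i : Fin (m + 1)) :
    affineSimplex v b i = ∑ j, b j * v j i := rfl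

lemma simplexMap_apply {m n : ℕ} (φ : Fin (m + 1) → Fin (n + 1)) (b : stdSimplex ℝ (Fin (m + 1)))
    (i : Fin (n + 1)) : simplexMap φ b i = ∑ j with φ j = i, b j := by
  change (stdSimplex.map φ b : Fin (n + 1) → ℝ) i = _
  rw [stdSimplex.map_coe, FunOnFinite.linearMap_apply_apply]

lemma sum_simplexMap_mul {m n : ℕ} (φ : Fin (m + 1) → Fin (n + 1))
    (b : stdSimplex ℝ (Fin (m + 1))) (f : Fin (n + 1) → ℝ) :
    ∑ i, simplexMap φ b i * f i = ∑ j, b j * f (φ j) := by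
  simp only [simplexMap_apply, Finset.sum_mul]
  rw [← Finset.sum_fiberwise (s := Finset.univ) (g := φ)]
  refine Finset.sum_congr rfl fun i _ => Finset.sum_congr rfl fun j hj => ?_
  rw [(Finset.mem_filter.1 hj).2]

lemma affineSimplex_comp_simplexMap {l m n : ℕ} (v : Fin (n + 1) → stdSimplex ℝ (Fin (m + 1)))
    (φ : Fin (l + 1) → Fin (n + 1)) :
    (affineSimplex v).comp (simplexMap φ) = affineSimplex (v ∘ φ) := by
  ext b i
  exact sum_simplexMap_mul φ b fun j => v j i

lemma affineSimplex_comp {l m n : ℕ} (v : Fin (n + 1) → stdSimplex ℝ (Fin (m + 1)))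
    (w : Fin (l + 1) → stdSimplex ℝ (Fin (n + 1))) :
    (affineSimplex v).comp (affineSimplex w) = affineSimplex (affineSimplex v ∘ w) := by
  ext b i
  change ∑ j, (∑ k, b k * w k j) * v j i = ∑ k, b k * ∑ j, w k j * v j i
  simp only [Finset.sum_mul, Finset.mul_sum]
  rw [Finset.sum_comm]
  simp only [mul_assoc]

lemma affineSimplex_vertex_apply {m n : ℕ} (v : Fin (n + 1) → stdSimplex ℝ (Fin (m + 1)))
    (i : Fin (n + 1)) : affineSimplex v (stdSimplex.vertex i) = v i := by
  ext k
  rw [affineSimplex_apply, Finset.sum_eq_single i]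
  · simp
  · intro j _ hj
    simp [hj]
  · simp

lemma simplexMap_eq_affineSimplex {m n : ℕ} (φ : Fin (m + 1) → Fin (n + 1)) :
    simplexMap φ = affineSimplex fun j => stdSimplex.vertex (φ j) := by
  ext b i
  rw [simplexMap_apply, affineSimplex_apply, Finset.sum_filter]
  refine Finset.sum_congr rfl fun j _ => ?_
  simp [Pi.single_apply, eq_comm]

/-- The vertices of the standard simplex. -/
def vertices (n : ℕ) : Fin (n + 1) → stdSimplex ℝ (Fin (n + 1)) := fun i => stdSimplex.vertex i

lemma affineSimplex_vertices (n : ℕ) : affineSimplex (vertices n) = ContinuousMap.id _ := by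
  rw [← simplexMap_id, simplexMap_eq_affineSimplex]
  rfl

lemma affineSimplex_comp_vertices {m n : ℕ} (v : Fin (n + 1) → stdSimplex ℝ (Fin (m + 1))) :
    affineSimplex v ∘ vertices n = v :=
  funext (affineSimplex_vertex_apply v)

/-- The midpoint of two points of a standard simplex. -/
def mid {m : ℕ} (x y : stdSimplex ℝ (Fin (m + 1))) : stdSimplex ℝ (Fin (m + 1)) :=
  ⟨fun i => (x i + y i) / 2, fun i => by
    have := stdSimplex.zero_le x i
    have := stdSimplex.zero_le y i
    positivity, by
    rw [← Finset.sum_div, Finset.sum_add_distrib, stdSimplex.sum_eq_one, stdSimplex.sum_eq_one]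
    norm_num⟩

lemma mid_apply {m : ℕ} (x y : stdSimplex ℝ (Fin (m + 1))) (i : Fin (m + 1)) :
    mid x y i = (x i + y i) / 2 := rfl

lemma mid_self {m : ℕ} (x : stdSimplex ℝ (Fin (m + 1))) : mid x x = x := by
  ext i
  rw [mid_apply, add_self_div_two]

lemma affineSimplex_mid {m n : ℕ} (v : Fin (n + 1) → stdSimplex ℝ (Fin (m + 1)))
    (x y : stdSimplex ℝ (Fin (n + 1))) :
    affineSimplex v (mid x y) = mid (affineSimplex v x) (affineSimplex v y) := by
  ext i
  simp only [mid_apply, affineSimplex_apply]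
  rw [← Finset.sum_add_distrib, Finset.sum_div]
  refine Finset.sum_congr rfl fun j _ => ?_
  ring

/-! Subdivision of tuples of points of a standard simplex -/

lemma TupleChain.map_congr_of_supported {V W : Type*} {n : ℕ} {f g : V → W}
    {S : Set (Fin (n + 1) → V)} (h : ∀ φ ∈ S, f ∘ φ = g ∘ φ) {c : TupleChain n V}
    (hc : c ∈ Finsupp.supported ℤ ℤ S) : TupleChain.map n f c = TupleChain.map n g c := by
  simp only [TupleChain.map, Finsupp.lmapDomain_apply]
  exact Finsupp.mapDomain_congr fun φ hφ => h φ (hc hφ)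

lemma TupleChain.map_mem_supported {V W : Type*} {n : ℕ} {f : V → W}
    {S : Set (Fin (n + 1) → V)} {S' : Set (Fin (n + 1) → W)} (h : ∀ φ ∈ S, f ∘ φ ∈ S')
    {c : TupleChain n V} (hc : c ∈ Finsupp.supported ℤ ℤ S) :
    TupleChain.map n f c ∈ Finsupp.supported ℤ ℤ S' := by
  have : Finsupp.supported ℤ ℤ S ≤ (Finsupp.supported ℤ ℤ S').comap (TupleChain.map n f) := by
    rw [Finsupp.supported_eq_span_single, Submodule.span_le]
    rintro _ ⟨φ, hφ, rfl⟩
    rw [SetLike.mem_coe, Submodule.mem_comap, TupleChain.map_single]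
    exact Finsupp.single_mem_supported ℤ _ (h φ hφ)
  exact this hc

/-- Shuffles are lattice paths. Their monotonicity is used below to bound the size of subdivided
simplices. -/
lemma shuffleChain_mem_supported (n p q : ℕ) :
    shuffleChain n p q ∈ Finsupp.supported ℤ ℤ
      {φ : Fin (n + 1) → Fin (p + 1) × Fin (q + 1) | Monotone φ} := by
  have hcone (n p q : ℕ) (c : TupleChain n (Fin (p + 1) × Fin (q + 1)))
      (hc : c ∈ Finsupp.supported ℤ ℤ {φ : Fin (n + 1) → _ | Monotone φ}) :
      TupleChain.cone n (0, 0) c ∈ Finsupp.supported ℤ ℤ {φ : Fin (n + 2) → _ | Monotone φ} := by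
    have : Finsupp.supported ℤ ℤ {φ : Fin (n + 1) → Fin (p + 1) × Fin (q + 1) | Monotone φ} ≤
        (Finsupp.supported ℤ ℤ {φ : Fin (n + 2) → Fin (p + 1) × Fin (q + 1) | Monotone φ}).comap
          (TupleChain.cone n (0, 0)) := by
      rw [Finsupp.supported_eq_span_single, Submodule.span_le]
      rintro _ ⟨φ, hφ, rfl⟩
      rw [SetLike.mem_coe, Submodule.mem_comap, TupleChain.cone_single]
      refine Finsupp.single_mem_supported ℤ _ (Fin.monotone_iff_le_succ.2 fun i => ?_)
      induction i using Fin.cases with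
      | zero => exact ⟨Fin.zero_le _, Fin.zero_le _⟩
      | succ i =>
        simp only [Fin.castSucc_succ, Fin.cons_succ]
        exact hφ (Fin.castSucc_le_succ i)
    exact this hc
  induction n generalizing p q with
  | zero =>
    rw [shuffleChain]
    split_ifs with h
    · exact Finsupp.single_mem_supported ℤ _ fun _ _ _ => le_rfl
    · exact Submodule.zero_mem _
  | succ n ih =>
    rw [shuffleChain_succ]
    refine hcone n p q _ (Submodule.add_mem _ ?_ (Submodule.smul_mem _ _ ?_))
    · rcases p with _ | p
      · exact Submodule.zero_mem _
      · refine TupleChain.map_mem_supported (fun φ hφ i j hij => ?_) (ih p q)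
        exact ⟨Fin.succ_le_succ_iff.2 (hφ hij).1, (hφ hij).2⟩
    · rcases q with _ | q
      · exact Submodule.zero_mem _
      · refine TupleChain.map_mem_supported (fun φ hφ i j hij => ?_) (ih p q)
        exact ⟨(hφ hij).1, Fin.succ_le_succ_iff.2 (hφ hij).2⟩

/-- Monotone sequences of pairs `(i, j)` with `i ≤ p ≤ j ≤ n` for some `p`. -/
def splitPaths (n : ℕ) : Set (Fin (n + 1) → ℕ × ℕ) :=
  {φ | Monotone φ ∧ ∃ p, ∀ t, (φ t).1 ≤ p ∧ p ≤ (φ t).2 ∧ (φ t).2 ≤ n}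

/-- The index `p` separating the two coordinates of a path is what will halve the size of a simplex
under subdivision. -/
lemma diagonalChain_mem_supported (n : ℕ) :
    diagonalChain n ∈ Finsupp.supported ℤ ℤ (splitPaths n) := by
  refine Submodule.sum_mem _ fun p hp => ?_
  rw [Finset.HasAntidiagonal.mem_antidiagonal] at hp
  refine TupleChain.map_mem_supported (S' := splitPaths n)
    (fun φ hφ => ⟨fun i j hij => ?_, p.1, fun t => ?_⟩) (shuffleChain_mem_supported n p.1 p.2)
  · exact ⟨(hφ hij).1, Nat.add_le_add_left (hφ hij).2 _⟩
  · have h1 := (φ t).1.2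
    have h2 := (φ t).2.2
    simp only [Function.comp_apply]
    omega

/-- The midpoints of pairs of points of a tuple. -/
def midPair {m n : ℕ} (v : Fin (n + 1) → stdSimplex ℝ (Fin (m + 1))) (x : ℕ × ℕ) :
    stdSimplex ℝ (Fin (m + 1)) :=
  mid (v (Fin.ofNat (n + 1) x.1)) (v (Fin.ofNat (n + 1) x.2))

/-- The edgewise subdivision. -/
def sd {m : ℕ} (n : ℕ) : TupleChain n (stdSimplex ℝ (Fin (m + 1))) →ₗ[ℤ]
    TupleChain n (stdSimplex ℝ (Fin (m + 1))) :=
  Finsupp.linearCombination ℤ fun v => TupleChain.map n (midPair v) (diagonalChain n)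

lemma sd_single {m n : ℕ} (v : Fin (n + 1) → stdSimplex ℝ (Fin (m + 1))) :
    sd n (Finsupp.single v 1) = TupleChain.map n (midPair v) (diagonalChain n) := by
  simp [sd]

lemma boundary_sd {m n : ℕ} (c : TupleChain (n + 1) (stdSimplex ℝ (Fin (m + 1)))) :
    TupleChain.boundary n (sd (n + 1) c) = sd n (TupleChain.boundary n c) := by
  suffices h : TupleChain.boundary n ∘ₗ sd (m := m) (n + 1) = sd n ∘ₗ TupleChain.boundary n from
    LinearMap.congr_fun h c
  ext1 v
  ext1
  simp only [LinearMap.comp_apply, Finsupp.lsingle_apply, sd_single, TupleChain.boundary_map,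
    boundary_diagonalChain, TupleChain.boundary_single, map_sum, map_smul, TupleChain.map_map]
  rw [← Fin.sum_univ_eq_sum_range (fun i => (-1 : ℤ) ^ i •
    TupleChain.map n (midPair v ∘ skipPair i) (diagonalChain n))]
  refine Finset.sum_congr rfl fun i _ => ?_
  congr 1
  -- `midPair` reads indices through `Fin.ofNat`, which wraps around. On the support all indices are
  -- at most `n`, so nothing wraps and `skip` agrees with `succAbove`.
  refine TupleChain.map_congr_of_supported (fun φ hφ => ?_) (diagonalChain_mem_supported n)
  obtain ⟨-, p, hp⟩ := hφ
  funext t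
  have hi (j : ℕ) (hj : j ≤ n) : Fin.ofNat (n + 2) (skip i j) =
      i.succAbove (Fin.ofNat (n + 1) j) := by
    apply Fin.ext
    have h2 : skip i j ≤ j + 1 := by
      simp only [skip]; split_ifs <;> omega
    rw [val_succAbove, Fin.val_ofNat, Fin.val_ofNat, Nat.mod_eq_of_lt, Nat.mod_eq_of_lt] <;> omega
  have := hp t
  simp only [Function.comp_apply, midPair, skipPair]
  rw [hi _ (by omega), hi _ (by omega)]

lemma sd_zero {m : ℕ} (c : TupleChain 0 (stdSimplex ℝ (Fin (m + 1)))) : sd 0 c = c := by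
  suffices h : sd (m := m) 0 = LinearMap.id from LinearMap.congr_fun h c
  ext1 v
  ext1
  simp only [LinearMap.comp_apply, Finsupp.lsingle_apply, sd_single, LinearMap.id_apply]
  rw [diagonalChain, Finset.Nat.antidiagonal_zero, Finset.sum_singleton, shiftShuffle]
  simp only [shuffleChain, and_self, if_true, TupleChain.map_single]
  congr 1
  funext i
  rw [Fin.fin_one_eq_zero i]
  exact mid_self _

lemma map_sd {l m n : ℕ} (f : stdSimplex ℝ (Fin (m + 1)) → stdSimplex ℝ (Fin (l + 1)))
    (hf : ∀ x y, f (mid x y) = mid (f x) (f y))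
    (c : TupleChain n (stdSimplex ℝ (Fin (m + 1)))) :
    TupleChain.map n f (sd n c) = sd n (TupleChain.map n f c) := by
  suffices h : TupleChain.map n f ∘ₗ sd n = sd n ∘ₗ TupleChain.map n f from LinearMap.congr_fun h c
  ext1 v
  ext1
  simp only [LinearMap.comp_apply, Finsupp.lsingle_apply, sd_single, TupleChain.map_single,
    TupleChain.map_map]
  refine TupleChain.map_congr_of_forall n (fun x => ?_) _
  exact hf _ _

/-- The chain homotopy between the identity and the subdivision. -/
def sdHomotopy {m : ℕ} : (n : ℕ) → TupleChain n (stdSimplex ℝ (Fin (m + 1))) →ₗ[ℤ]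
    TupleChain (n + 1) (stdSimplex ℝ (Fin (m + 1)))
  | 0 => 0
  | n + 1 => Finsupp.linearCombination ℤ fun v =>
      TupleChain.cone (n + 1) (v 0) (Finsupp.single v 1 - sd (n + 1) (Finsupp.single v 1) -
        sdHomotopy n (TupleChain.boundary n (Finsupp.single v 1)))

lemma sdHomotopy_single {m n : ℕ} (v : Fin (n + 2) → stdSimplex ℝ (Fin (m + 1))) :
    sdHomotopy (n + 1) (Finsupp.single v 1) =
      TupleChain.cone (n + 1) (v 0) (Finsupp.single v 1 - sd (n + 1) (Finsupp.single v 1) -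
        sdHomotopy n (TupleChain.boundary n (Finsupp.single v 1))) := by
  simp [sdHomotopy]

/-- The boundary of a cone is the chain minus the cone of its boundary. The homotopy identity
therefore holds as soon as the coned chain is a cycle, which is the hypothesis `H`; the induction
only has to supply it. -/
lemma boundary_sdHomotopy_of {m n : ℕ}
    (H : ∀ c : TupleChain (n + 1) (stdSimplex ℝ (Fin (m + 1))),
      TupleChain.boundary n (c - sd (n + 1) c - sdHomotopy n (TupleChain.boundary n c)) = 0)
    (c : TupleChain (n + 1) (stdSimplex ℝ (Fin (m + 1)))) :
    TupleChain.boundary (n + 1) (sdHomotopy (n + 1) c) =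
      c - sd (n + 1) c - sdHomotopy n (TupleChain.boundary n c) := by
  suffices h : TupleChain.boundary (n + 1) ∘ₗ sdHomotopy (m := m) (n + 1) =
      LinearMap.id - sd (n + 1) - sdHomotopy n ∘ₗ TupleChain.boundary n from
    LinearMap.congr_fun h c
  clear c
  ext1 v
  ext1
  simp only [LinearMap.comp_apply, Finsupp.lsingle_apply, LinearMap.sub_apply, LinearMap.id_apply,
    sdHomotopy_single, TupleChain.boundary_cone]
  rw [H, map_zero, sub_zero]

lemma boundary_sdHomotopy {m n : ℕ} (c : TupleChain (n + 1) (stdSimplex ℝ (Fin (m + 1)))) :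
    TupleChain.boundary (n + 1) (sdHomotopy (n + 1) c) =
      c - sd (n + 1) c - sdHomotopy n (TupleChain.boundary n c) := by
  induction n with
  | zero =>
    refine boundary_sdHomotopy_of (fun c => ?_) c
    rw [map_sub, map_sub, boundary_sd]
    simp [sdHomotopy, sd_zero]
  | succ n ih =>
    refine boundary_sdHomotopy_of (fun c => ?_) c
    rw [map_sub, map_sub, boundary_sd, ih, TupleChain.boundary_boundary, map_zero, sub_zero,
      sub_self]

/-- The cone point is the first vertex of the tuple itself, not a chosen base point, so the homotopy
commutes with every map that preserves midpoints. -/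
lemma map_sdHomotopy {l m n : ℕ} (f : stdSimplex ℝ (Fin (m + 1)) → stdSimplex ℝ (Fin (l + 1)))
    (hf : ∀ x y, f (mid x y) = mid (f x) (f y))
    (c : TupleChain n (stdSimplex ℝ (Fin (m + 1)))) :
    TupleChain.map (n + 1) f (sdHomotopy n c) = sdHomotopy n (TupleChain.map n f c) := by
  induction n with
  | zero => simp [sdHomotopy]
  | succ n ih =>
    suffices h : TupleChain.map (n + 2) f ∘ₗ sdHomotopy (n + 1) =
      sdHomotopy (n + 1) ∘ₗ TupleChain.map (n + 1) f from LinearMap.congr_fun h c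
    clear c
    ext1 v
    ext1
    simp only [LinearMap.comp_apply, Finsupp.lsingle_apply, TupleChain.map_single,
      sdHomotopy_single, TupleChain.map_cone, map_sub, map_sd f hf, ih]
    simp only [← TupleChain.boundary_map, TupleChain.map_single]
    rfl

end ConfSpace

end


noncomputable section

namespace ConfSpace

/-! Subdivision of singular chains -/

section Subdivision

variable {X : Type u} {Y : Type v} [TopologicalSpace X] [TopologicalSpace Y]

/-- The singular chain of affine simplices with given tuples of vertices. -/
def affineChain {m : ℕ} (n : ℕ) : TupleChain n (stdSimplex ℝ (Fin (m + 1))) →ₗ[ℤ]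
    SingChain n (stdSimplex ℝ (Fin (m + 1))) :=
  Finsupp.lmapDomain ℤ ℤ affineSimplex

lemma affineChain_single {m n : ℕ} (v : Fin (n + 1) → stdSimplex ℝ (Fin (m + 1))) (a : ℤ) :
    affineChain n (Finsupp.single v a) = Finsupp.single (affineSimplex v) a := by
  simp [affineChain]

lemma faceSum_affineChain {m n : ℕ} (c : TupleChain (n + 1) (stdSimplex ℝ (Fin (m + 1)))) :
    faceSum n (affineChain (n + 1) c) = affineChain n (TupleChain.boundary n c) := by
  suffices h : faceSum n ∘ₗ affineChain (m := m) (n + 1) =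
      affineChain n ∘ₗ TupleChain.boundary n from LinearMap.congr_fun h c
  ext1 v
  ext1
  simp only [LinearMap.comp_apply, Finsupp.lsingle_apply, affineChain_single, faceSum_single,
    TupleChain.boundary_single, map_sum, map_smul]
  refine Finset.sum_congr rfl fun i _ => ?_
  rw [face, affineSimplex_comp_simplexMap]

lemma chainMap_affineChain {l m n : ℕ} (v : Fin (m + 1) → stdSimplex ℝ (Fin (l + 1)))
    (c : TupleChain n (stdSimplex ℝ (Fin (m + 1)))) :
    chainMap n (affineSimplex v) (affineChain n c) =
      affineChain n (TupleChain.map n (affineSimplex v) c) := by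
  suffices h : chainMap n (affineSimplex v) ∘ₗ affineChain n =
      affineChain n ∘ₗ TupleChain.map n (affineSimplex v) from LinearMap.congr_fun h c
  ext1 w
  ext1
  simp only [LinearMap.comp_apply, Finsupp.lsingle_apply, affineChain_single, chainMap_single,
    TupleChain.map_single, affineSimplex_comp]

/-- The tuple of vertices of the standard simplex, as a chain. -/
def vertexChain (n : ℕ) : TupleChain n (stdSimplex ℝ (Fin (n + 1))) :=
  Finsupp.single (vertices n) 1

/-- Every singular simplex is the image of the universal affine one, so identities between natural
operators need only be checked on affine chains, where they are combinatorial. -/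
lemma single_eq_chainMap (n : ℕ) (σ : Sing n X) :
    Finsupp.single σ 1 = chainMap n σ (affineChain n (vertexChain n)) := by
  rw [vertexChain, affineChain_single, affineSimplex_vertices, chainMap_single]
  rfl

/-- The natural transformation of singular chains given by a universal chain. -/
def naturalOp {n k : ℕ} (u : TupleChain k (stdSimplex ℝ (Fin (n + 1)))) :
    SingChain n X →ₗ[ℤ] SingChain k X :=
  Finsupp.linearCombination ℤ fun σ : Sing n X => chainMap k σ (affineChain k u)

lemma naturalOp_single {n k : ℕ} (u : TupleChain k (stdSimplex ℝ (Fin (n + 1)))) (σ : Sing n X) :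
    naturalOp u (Finsupp.single σ 1) = chainMap k σ (affineChain k u) := by
  simp [naturalOp]

lemma naturalOp_chainMap {n k : ℕ} (u : TupleChain k (stdSimplex ℝ (Fin (n + 1)))) (f : C(X, Y))
    (c : SingChain n X) : naturalOp u (chainMap n f c) = chainMap k f (naturalOp u c) := by
  suffices h : naturalOp u ∘ₗ chainMap n f = chainMap k f ∘ₗ naturalOp u from
    LinearMap.congr_fun h c
  ext1 σ
  ext1
  simp only [LinearMap.comp_apply, Finsupp.lsingle_apply, chainMap_single, naturalOp_single,
    ← chainMap_comp]

lemma naturalOp_mem {n k : ℕ} (u : TupleChain k (stdSimplex ℝ (Fin (n + 1)))) {A : Set X}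
    {c : SingChain n X} (hc : c ∈ chainsIn A n) : naturalOp u c ∈ chainsIn A k := by
  have : chainsIn A n ≤ (chainsIn A k).comap (naturalOp u) := by
    rw [chainsIn_le_iff]
    intro σ hσ
    rw [Submodule.mem_comap, naturalOp_single]
    exact chainMap_mem (A := Set.univ) k σ (fun x _ => hσ x) (mem_chainsIn_univ _)
  exact this hc

/-- The subdivision operator on singular chains. -/
def subdiv (n : ℕ) : SingChain n X →ₗ[ℤ] SingChain n X := naturalOp (sd n (vertexChain n))

/-- The chain homotopy between the identity and the subdivision operator. -/
def subdivHomotopy (n : ℕ) : SingChain n X →ₗ[ℤ] SingChain (n + 1) X :=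
  naturalOp (sdHomotopy n (vertexChain n))

lemma map_vertexChain {m n : ℕ} (v : Fin (n + 1) → stdSimplex ℝ (Fin (m + 1))) :
    TupleChain.map n (affineSimplex v) (vertexChain n) = Finsupp.single v 1 := by
  rw [vertexChain, TupleChain.map_single, affineSimplex_comp_vertices]

/-- Affine maps preserve midpoints, so the subdivision of vertex tuples is compatible with the
universal definition. -/
lemma subdiv_affineChain {m n : ℕ} (c : TupleChain n (stdSimplex ℝ (Fin (m + 1)))) :
    subdiv n (affineChain n c) = affineChain n (sd n c) := by
  suffices h : subdiv n ∘ₗ affineChain (m := m) n = affineChain n ∘ₗ sd n from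
    LinearMap.congr_fun h c
  ext1 v
  ext1
  simp only [LinearMap.comp_apply, Finsupp.lsingle_apply, affineChain_single]
  rw [subdiv, naturalOp_single, chainMap_affineChain, map_sd _ (affineSimplex_mid v),
    map_vertexChain]

lemma subdivHomotopy_affineChain {m n : ℕ} (c : TupleChain n (stdSimplex ℝ (Fin (m + 1)))) :
    subdivHomotopy n (affineChain n c) = affineChain (n + 1) (sdHomotopy n c) := by
  suffices h : subdivHomotopy n ∘ₗ affineChain (m := m) n =
      affineChain (n + 1) ∘ₗ sdHomotopy n from LinearMap.congr_fun h c
  ext1 v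
  ext1
  simp only [LinearMap.comp_apply, Finsupp.lsingle_apply, affineChain_single]
  rw [subdivHomotopy, naturalOp_single, chainMap_affineChain,
    map_sdHomotopy _ (affineSimplex_mid v), map_vertexChain]

lemma subdiv_chainMap {n : ℕ} (f : C(X, Y)) (c : SingChain n X) :
    subdiv n (chainMap n f c) = chainMap n f (subdiv n c) := naturalOp_chainMap _ f c

lemma faceSum_subdiv {n : ℕ} (c : SingChain (n + 1) X) :
    faceSum n (subdiv (n + 1) c) = subdiv n (faceSum n c) := by
  suffices h : faceSum n ∘ₗ subdiv (X := X) (n + 1) = subdiv n ∘ₗ faceSum n from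
    LinearMap.congr_fun h c
  ext1 σ
  ext1
  simp only [LinearMap.comp_apply, Finsupp.lsingle_apply]
  rw [single_eq_chainMap, subdiv_chainMap, faceSum_chainMap, faceSum_chainMap, subdiv_chainMap,
    subdiv_affineChain, faceSum_affineChain, faceSum_affineChain, subdiv_affineChain, boundary_sd]

lemma faceSum_subdivHomotopy {n : ℕ} (c : SingChain (n + 1) X) :
    faceSum (n + 1) (subdivHomotopy (n + 1) c) =
      c - subdiv (n + 1) c - subdivHomotopy n (faceSum n c) := by
  suffices h : faceSum (n + 1) ∘ₗ subdivHomotopy (X := X) (n + 1) =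
      LinearMap.id - subdiv (n + 1) - subdivHomotopy n ∘ₗ faceSum n from
    LinearMap.congr_fun h c
  ext1 σ
  ext1
  simp only [LinearMap.comp_apply, Finsupp.lsingle_apply, LinearMap.sub_apply, LinearMap.id_apply]
  rw [single_eq_chainMap, subdiv_chainMap, faceSum_chainMap, subdivHomotopy, naturalOp_chainMap,
    ← subdivHomotopy, faceSum_chainMap, subdivHomotopy_affineChain, faceSum_affineChain,
    boundary_sdHomotopy, subdiv_affineChain, faceSum_affineChain, subdivHomotopy,
    naturalOp_chainMap, ← subdivHomotopy, subdivHomotopy_affineChain]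
  simp only [map_sub]

lemma subdiv_zero (c : SingChain 0 X) : subdiv 0 c = c := by
  suffices h : subdiv (X := X) 0 = LinearMap.id from LinearMap.congr_fun h c
  ext1 σ
  ext1
  simp only [LinearMap.comp_apply, Finsupp.lsingle_apply, LinearMap.id_apply]
  rw [single_eq_chainMap, subdiv_chainMap, subdiv_affineChain, sd_zero]

lemma boundary_subdiv {n : ℕ} (c : SingChain n X) :
    boundary n (subdiv n c) = subdiv (n - 1) (boundary n c) := by
  rcases n with _ | n
  · simp [boundary]
  · exact faceSum_subdiv c

/-- The homotopy gives `c - Sd c = ∂ h c + h ∂ c`. Being natural, `h` sends chains in `A` to chains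
in `A`, so the last term is harmless. -/
lemma sub_subdiv_mem {A : Set X} {n : ℕ} {c : SingChain n X} (hc : c ∈ relCycles A n) :
    c - subdiv n c ∈ relBoundaries A n := by
  rcases n with _ | n
  · rw [subdiv_zero, sub_self]
    exact Submodule.zero_mem _
  · have h := faceSum_subdivHomotopy c
    rw [eq_sub_iff_add_eq] at h
    rw [← h]
    exact Submodule.add_mem_sup ⟨_, rfl⟩ (naturalOp_mem _ hc)

lemma subdiv_mem_relCycles {A : Set X} {n : ℕ} {c : SingChain n X} (hc : c ∈ relCycles A n) :
    subdiv n c ∈ relCycles A n := by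
  rw [relCycles, Submodule.mem_comap, boundary_subdiv]
  exact naturalOp_mem _ hc

lemma subdiv_pow_mem_relCycles {A : Set X} {n : ℕ} {c : SingChain n X} (hc : c ∈ relCycles A n)
    (k : ℕ) : (subdiv n ^ k) c ∈ relCycles A n := by
  induction k with
  | zero => exact hc
  | succ k ih => rw [pow_succ']; exact subdiv_mem_relCycles ih

lemma sub_subdiv_pow_mem {A : Set X} {n : ℕ} {c : SingChain n X} (hc : c ∈ relCycles A n) (k : ℕ) :
    c - (subdiv n ^ k) c ∈ relBoundaries A n := by
  induction k with
  | zero => simp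
  | succ k ih =>
    have := Submodule.add_mem _ ih (sub_subdiv_mem (subdiv_pow_mem_relCycles hc k))
    rw [sub_add_sub_cancel] at this
    rwa [pow_succ']

/-! Small simplices -/

/-- The sum of the first barycentric coordinates. -/
def cumulative {m : ℕ} (i : ℕ) (x : stdSimplex ℝ (Fin (m + 1))) : ℝ :=
  ∑ j : Fin (m + 1) with j.val < i, x j

lemma cumulative_mid {m : ℕ} (i : ℕ) (x y : stdSimplex ℝ (Fin (m + 1))) :
    cumulative i (mid x y) = (cumulative i x + cumulative i y) / 2 := by
  simp only [cumulative, mid_apply, ← Finset.sum_div, Finset.sum_add_distrib]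

lemma cumulative_affineSimplex {m n : ℕ} (i : ℕ) (v : Fin (n + 1) → stdSimplex ℝ (Fin (m + 1)))
    (b : stdSimplex ℝ (Fin (n + 1))) :
    cumulative i (affineSimplex v b) = ∑ j, b j * cumulative i (v j) := by
  simp only [cumulative, affineSimplex_apply, Finset.mul_sum]
  rw [Finset.sum_comm]

lemma cumulative_vertices {n : ℕ} (i : ℕ) (t : Fin (n + 1)) :
    cumulative i (vertices n t) = if (t : ℕ) < i then 1 else 0 := by
  simp only [cumulative, vertices, Finset.sum_filter]
  rw [Finset.sum_eq_single t]
  · simp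
  · intro j _ hj
    simp [hj]
  · simp

lemma cumulative_succ {m : ℕ} (i : Fin (m + 1)) (x : stdSimplex ℝ (Fin (m + 1))) :
    cumulative (i + 1) x = cumulative i x + x i := by
  simp only [cumulative]
  rw [show ({j | j.val < i + 1} : Finset (Fin (m + 1))) =
    insert i ({j | j.val < i} : Finset (Fin (m + 1))) by
      ext j; simp [Fin.ext_iff]; omega, Finset.sum_insert (by simp), add_comm]

/-- Tuples of points whose cumulative coordinates decrease by at most `ε`. -/
def narrowTuples (m n : ℕ) (ε : ℝ) : Set (Fin (n + 1) → stdSimplex ℝ (Fin (m + 1))) :=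
  {v | ∀ i, Antitone (fun t => cumulative i (v t)) ∧
    cumulative i (v 0) - cumulative i (v (Fin.last n)) ≤ ε}

lemma vertices_mem_narrowTuples (n : ℕ) : vertices n ∈ narrowTuples n n 1 := by
  intro i
  refine ⟨fun s t hst => ?_, ?_⟩
  · simp only [cumulative_vertices]
    have : (s : ℕ) ≤ t := hst
    split_ifs
    · exact le_rfl
    · omega
    · exact zero_le_one
    · exact le_rfl
  · simp only [cumulative_vertices]
    split_ifs <;> norm_num

/-- With `a` the cumulative coordinate along the tuple and the path confined to `i ≤ p ≤ j`, the
drop along the subdivided simplex is at most `((a 0 - a p) + (a p - a n)) / 2`, half of the original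
drop. Along the path both indices increase, so the new values again decrease. -/
lemma midPair_comp_mem_narrowTuples {m n : ℕ} {ε : ℝ}
    {v : Fin (n + 1) → stdSimplex ℝ (Fin (m + 1))} (hv : v ∈ narrowTuples m n ε)
    {φ : Fin (n + 1) → ℕ × ℕ} (hφ : φ ∈ splitPaths n) :
    midPair v ∘ φ ∈ narrowTuples m n (ε / 2) := by
  obtain ⟨hmon, p, hp⟩ := hφ
  intro i
  obtain ⟨h1, h2⟩ := hv i
  set a : ℕ → ℝ := fun j => cumulative i (v (Fin.ofNat (n + 1) j)) with ha
  have hval (t) : cumulative i ((midPair v ∘ φ) t) = (a (φ t).1 + a (φ t).2) / 2 :=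
    cumulative_mid _ _ _
  have hanti {j k : ℕ} (hjk : j ≤ k) (hk : k ≤ n) : a k ≤ a j := by
    refine h1 ?_
    rw [Fin.le_def, Fin.val_ofNat, Fin.val_ofNat, Nat.mod_eq_of_lt, Nat.mod_eq_of_lt] <;> omega
  have h0 : cumulative i (v 0) = a 0 := rfl
  have hn : cumulative i (v (Fin.last n)) = a n := by
    rw [ha]
    congr 2
    rw [Fin.ext_iff, Fin.val_ofNat, Nat.mod_eq_of_lt (by omega), Fin.val_last]
  rw [h0, hn] at h2
  refine ⟨fun s t hst => ?_, ?_⟩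
  · simp only [hval]
    have := hp t
    have e1 := hanti (hmon hst).1 (by omega)
    have e2 := hanti (hmon hst).2 (by omega)
    linarith
  · rw [hval, hval]
    have g0 := hp 0
    have gn := hp (Fin.last n)
    have e1 := hanti (j := 0) (k := (φ 0).1) (by omega) (by omega)
    have e2 := hanti (j := p) (k := (φ 0).2) (by omega) (by omega)
    have e3 := hanti (j := (φ (Fin.last n)).1) (k := p) (by omega) (by omega)
    have e4 := hanti (j := (φ (Fin.last n)).2) (k := n) (by omega) (by omega)
    linarith

lemma sd_mem_supported {m n : ℕ} {ε : ℝ} {c : TupleChain n (stdSimplex ℝ (Fin (m + 1)))}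
    (hc : c ∈ Finsupp.supported ℤ ℤ (narrowTuples m n ε)) :
    sd n c ∈ Finsupp.supported ℤ ℤ (narrowTuples m n (ε / 2)) := by
  have : Finsupp.supported ℤ ℤ (narrowTuples m n ε) ≤
      (Finsupp.supported ℤ ℤ (narrowTuples m n (ε / 2))).comap (sd n) := by
    rw [Finsupp.supported_eq_span_single, Submodule.span_le]
    rintro _ ⟨v, hv, rfl⟩
    rw [SetLike.mem_coe, Submodule.mem_comap, sd_single]
    exact TupleChain.map_mem_supported (fun φ hφ => midPair_comp_mem_narrowTuples hv hφ)
      (diagonalChain_mem_supported n)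
  exact this hc

lemma sd_pow_vertexChain_mem (n k : ℕ) :
    (sd n ^ k) (vertexChain n) ∈ Finsupp.supported ℤ ℤ (narrowTuples n n ((1 / 2) ^ k)) := by
  induction k with
  | zero =>
    rw [pow_zero, pow_zero]
    exact Finsupp.single_mem_supported ℤ _ (vertices_mem_narrowTuples n)
  | succ k ih =>
    rw [pow_succ' (sd n), pow_succ (1 / 2 : ℝ), mul_one_div]
    exact sd_mem_supported ih

/-- A barycentric coordinate is the difference of two consecutive cumulative ones. Each of these
varies by at most `ε` on the simplex, whence the factor two in the maximum metric. -/
lemma dist_affineSimplex_le {m n : ℕ} {ε : ℝ} {v : Fin (n + 1) → stdSimplex ℝ (Fin (m + 1))}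
    (hv : v ∈ narrowTuples m n ε) (x y : stdSimplex ℝ (Fin (n + 1))) :
    dist (affineSimplex v x) (affineSimplex v y) ≤ 2 * ε := by
  have hb (i : ℕ) (x : stdSimplex ℝ (Fin (n + 1))) :
      cumulative i (v (Fin.last n)) ≤ cumulative i (affineSimplex v x) ∧
      cumulative i (affineSimplex v x) ≤ cumulative i (v 0) := by
    rw [cumulative_affineSimplex]
    constructor
    · rw [← one_mul (cumulative i (v (Fin.last n))), ← stdSimplex.sum_eq_one x, Finset.sum_mul]
      exact Finset.sum_le_sum fun j _ =>
        mul_le_mul_of_nonneg_left ((hv i).1 (Fin.le_last j)) (stdSimplex.zero_le x j)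
    · rw [← one_mul (cumulative i (v 0)), ← stdSimplex.sum_eq_one x, Finset.sum_mul]
      exact Finset.sum_le_sum fun j _ =>
        mul_le_mul_of_nonneg_left ((hv i).1 (Fin.zero_le j)) (stdSimplex.zero_le x j)
  have hε : 0 ≤ ε := by
    have := (hv 0).1 (Fin.zero_le (Fin.last n))
    have := (hv 0).2
    simp only at *
    linarith
  rw [Subtype.dist_eq, dist_pi_le_iff (by positivity)]
  intro i
  change dist (affineSimplex v x i) (affineSimplex v y i) ≤ _
  have hx := cumulative_succ i (affineSimplex v x)
  have hy := cumulative_succ i (affineSimplex v y)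
  have h1 := hb i x
  have h2 := hb i y
  have h3 := hb (i + 1) x
  have h4 := hb (i + 1) y
  have h5 := (hv i).2
  have h6 := (hv (i + 1)).2
  rw [Real.dist_eq, abs_le]
  constructor <;> linarith

lemma subdiv_pow_single (n k : ℕ) (σ : Sing n X) :
    (subdiv n ^ k) (Finsupp.single σ 1) =
      chainMap n σ (affineChain n ((sd n ^ k) (vertexChain n))) := by
  induction k with
  | zero => exact single_eq_chainMap n σ
  | succ k ih =>
    rw [pow_succ', Module.End.mul_apply, ih, subdiv_chainMap, subdiv_affineChain, pow_succ',
      Module.End.mul_apply]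

lemma exists_subdiv_pow_single_mem {V W : Set X} (hV : IsOpen V) (hW : IsOpen W)
    (hVW : V ∪ W = Set.univ) {n : ℕ} (σ : Sing n X) :
    ∃ k, (subdiv n ^ k) (Finsupp.single σ 1) ∈ chainsIn V n ⊔ chainsIn W n := by
  obtain ⟨δ, hδ, hball⟩ := lebesgue_number_lemma_of_metric
    (s := (Set.univ : Set (stdSimplex ℝ (Fin (n + 1)))))
    (c := fun b : Bool => if b then σ ⁻¹' V else σ ⁻¹' W) isCompact_univ
    (by rintro (_ | _)
        · exact hW.preimage σ.continuous
        · exact hV.preimage σ.continuous)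
    (fun x _ => by
      have : σ x ∈ V ∪ W := hVW ▸ Set.mem_univ _
      rw [Set.mem_iUnion]
      rcases this with h | h
      · exact ⟨true, h⟩
      · exact ⟨false, h⟩)
  -- After `k` subdivisions the pieces have diameter at most `2 * (1 / 2) ^ k`, so this is below the
  -- Lebesgue number `δ`.
  obtain ⟨k, hk⟩ := exists_pow_lt_of_lt_one (show 0 < δ / 2 by positivity)
    (show (1 / 2 : ℝ) < 1 by norm_num)
  refine ⟨k, ?_⟩
  rw [subdiv_pow_single]
  have : Finsupp.supported ℤ ℤ (narrowTuples n n ((1 / 2) ^ k)) ≤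
      (chainsIn V n ⊔ chainsIn W n).comap (chainMap n σ ∘ₗ affineChain n) := by
    rw [Finsupp.supported_eq_span_single, Submodule.span_le]
    rintro _ ⟨v, hv, rfl⟩
    rw [SetLike.mem_coe, Submodule.mem_comap, LinearMap.comp_apply, affineChain_single,
      chainMap_single]
    obtain ⟨b, hb⟩ := hball (affineSimplex v (vertices n 0)) (Set.mem_univ _)
    have hmem (x : stdSimplex ℝ (Fin (n + 1))) : affineSimplex v x ∈
        Metric.ball (affineSimplex v (vertices n 0)) δ := by
      rw [Metric.mem_ball]
      exact (dist_affineSimplex_le hv _ _).trans_lt (by linarith)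
    rcases b with _ | _
    · exact Submodule.mem_sup_right (single_mem_chainsIn (A := W)
        (σ := σ.comp (affineSimplex v)) (fun x => hb (hmem x)) 1)
    · exact Submodule.mem_sup_left (single_mem_chainsIn (A := V)
        (σ := σ.comp (affineSimplex v)) (fun x => hb (hmem x)) 1)
  exact this (sd_pow_vertexChain_mem n k)

lemma subdiv_pow_mem_sup {V W : Set X} {n : ℕ} {c : SingChain n X}
    (hc : c ∈ chainsIn V n ⊔ chainsIn W n) (k : ℕ) :
    (subdiv n ^ k) c ∈ chainsIn V n ⊔ chainsIn W n := by
  induction k with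
  | zero => exact hc
  | succ k ih =>
    rw [pow_succ', Module.End.mul_apply]
    obtain ⟨a, ha, b, hb, h⟩ := Submodule.mem_sup.1 ih
    rw [← h, map_add]
    exact Submodule.add_mem_sup (naturalOp_mem _ ha) (naturalOp_mem _ hb)

/-- The theorem of small simplices for a cover by two open sets. -/
lemma exists_subdiv_pow_mem {V W : Set X} (hV : IsOpen V) (hW : IsOpen W)
    (hVW : V ∪ W = Set.univ) {n : ℕ} (c : SingChain n X) :
    ∃ k, (subdiv n ^ k) c ∈ chainsIn V n ⊔ chainsIn W n := by
  induction c using Finsupp.induction_linear with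
  | zero => exact ⟨0, by simp⟩
  | add a b ha hb =>
    obtain ⟨k, hk⟩ := ha
    obtain ⟨l, hl⟩ := hb
    -- Further subdivision keeps a small chain small, so both summands may be subdivided `k + l`
    -- times.
    refine ⟨k + l, ?_⟩
    rw [map_add]
    refine Submodule.add_mem _ ?_ ?_
    · rw [add_comm, pow_add]
      exact subdiv_pow_mem_sup hk l
    · rw [pow_add]
      exact subdiv_pow_mem_sup hl k
  | single σ a =>
    obtain ⟨k, hk⟩ := exists_subdiv_pow_single_mem hV hW hVW σ
    refine ⟨k, ?_⟩
    rw [← mul_one a, ← smul_eq_mul, ← Finsupp.smul_single, map_smul]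
    exact Submodule.smul_mem _ _ hk

end Subdivision

end ConfSpace

end


noncomputable section

namespace ConfSpace

/-! Attaching cells -/

section Cells

variable {X : Type u} {Y : Type v} {P : Type w} [TopologicalSpace X] [TopologicalSpace Y]
  [TopologicalSpace P]

/-- A radial structure on `P` with boundary `B`: a function `level` with maximum `1` attained on `B`,
and maps `push (·, τ)` that expand the part `level < τ` onto `P` and the rest into `B`. -/
structure Collar (B : Set P) where
  level : C(P, ℝ)
  push : C(P × ℝ, P)
  level_le : ∀ x, level x ≤ 1
  mem_iff : ∀ x, x ∈ B ↔ level x = 1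
  push_one : ∀ x, push (x, 1) = x
  push_of_mem : ∀ x τ, x ∈ B → τ ≤ 1 → push (x, τ) = x
  push_mem : ∀ x τ, 1 / 2 ≤ τ → τ ≤ level x → push (x, τ) ∈ B

/-- The product of two collars. -/
def Collar.prod {Q : Type*} [TopologicalSpace Q] {B : Set P} {C : Set Q} (b : Collar B)
    (c : Collar C) : Collar (pairProd B C) where
  level := ⟨fun z => max (b.level z.1) (c.level z.2), by fun_prop⟩
  -- The threshold in each factor is raised to the level of the other factor. The factor with the
  -- larger level still reaches its boundary, and if one factor is on the boundary the other is not
  -- moved.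
  push := ⟨fun z => (b.push (z.1.1, max (c.level z.1.2) z.2),
    c.push (z.1.2, max (b.level z.1.1) z.2)), by fun_prop⟩
  level_le z := max_le (b.level_le _) (c.level_le _)
  mem_iff z := by
    change z.1 ∈ B ∨ z.2 ∈ C ↔ max _ _ = _
    rw [b.mem_iff, c.mem_iff]
    have h1 := b.level_le z.1
    have h2 := c.level_le z.2
    rcases max_cases (b.level z.1) (c.level z.2) with h | h <;> rw [h.1]
    · exact ⟨fun h' => h'.elim id fun h' => by linarith, Or.inl⟩
    · exact ⟨fun h' => h'.elim (fun h' => by linarith) id, Or.inr⟩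
  push_one z := by
    simp [max_eq_right (b.level_le z.1), max_eq_right (c.level_le z.2), b.push_one, c.push_one]
  push_of_mem := by
    rintro ⟨x, y⟩ τ (h | h) hτ
    · refine Prod.ext (b.push_of_mem _ _ h (max_le (c.level_le _) hτ)) ?_
      change c.push (y, max (b.level x) τ) = y
      rw [(b.mem_iff x).1 h, max_eq_left hτ, c.push_one]
    · refine Prod.ext ?_ (c.push_of_mem _ _ h (max_le (b.level_le _) hτ))
      change b.push (x, max (c.level y) τ) = x
      rw [(c.mem_iff y).1 h, max_eq_left hτ, b.push_one]
  push_mem := by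
    rintro ⟨x, y⟩ τ h1 h2
    change τ ≤ max (b.level x) (c.level y) at h2
    rcases max_cases (b.level x) (c.level y) with h | h
    · rw [h.1] at h2
      exact Or.inl (b.push_mem _ _ (h1.trans (le_max_right _ _)) (max_le h.2 h2))
    · rw [h.1] at h2
      exact Or.inr (c.push_mem _ _ (h1.trans (le_max_right _ _)) (max_le h.2.le h2))

/-- The collar of the empty boundary. -/
def Collar.empty : Collar (∅ : Set P) where
  level := ContinuousMap.const _ 0
  push := ⟨Prod.fst, continuous_fst⟩
  level_le _ := zero_le_one
  mem_iff _ := by simp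
  push_one _ := rfl
  push_of_mem _ _ h := h.elim
  push_mem x τ h1 h2 := by
    simp only [ContinuousMap.const_apply] at h2
    linarith

/-- Transport of a collar along a homeomorphism. -/
def Collar.ofHomeomorph {Q : Type*} [TopologicalSpace Q] {B : Set P} {C : Set Q} (b : Collar B)
    (e : Q ≃ₜ P) (h : ∀ x, x ∈ C ↔ e x ∈ B) : Collar C where
  level := b.level.comp ⟨e, e.continuous⟩
  push := ⟨fun z => e.symm (b.push (e z.1, z.2)), by fun_prop⟩
  level_le _ := b.level_le _
  mem_iff x := by rw [h]; exact b.mem_iff _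
  push_one x := by simp [b.push_one]
  push_of_mem x τ hx hτ := by
    simp [b.push_of_mem _ _ ((h x).1 hx) hτ]
  push_mem x τ h1 h2 := by
    rw [h]
    simpa using b.push_mem (e x) τ h1 h2

/-! ### Excision for an attached cell. -/

lemma boundary_mem_chainsIn {A : Set X} {n : ℕ} {c : SingChain n X} (hc : c ∈ chainsIn A n) :
    boundary n c ∈ chainsIn A (n - 1) := by
  rcases n with _ | n
  · simp [boundary]
  · have : chainsIn A (n + 1) ≤ (chainsIn A n).comap (faceSum n) := by
      rw [chainsIn_le_iff]
      intro σ hσ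
      rw [Submodule.mem_comap, faceSum_single]
      exact Submodule.sum_mem _ fun i _ =>
        Submodule.smul_mem _ _ (single_mem_chainsIn (σ := face i σ) (fun x => hσ _) 1)
    exact this hc

lemma chainsIn_mono {A A' : Set X} (h : A ⊆ A') (n : ℕ) : chainsIn A n ≤ chainsIn A' n :=
  Finsupp.supported_mono fun _ hσ x => h (hσ x)

lemma chainsIn_le_relBoundaries (A : Set X) (n : ℕ) : chainsIn A n ≤ relBoundaries A n :=
  le_sup_right

lemma relBoundaries_mono {A A' : Set X} (h : A ⊆ A') (n : ℕ) :
    relBoundaries A n ≤ relBoundaries A' n :=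
  sup_le_sup le_rfl (chainsIn_mono h n)

lemma sub_mem_relBoundaries_of_homotopy {A : Set X} {B : Set Y} (n : ℕ) (f g : C(X, Y))
    (hf : Set.MapsTo f A B) (hg : Set.MapsTo g A B) (F : C(X × unitInterval, Y))
    (hF : ∀ a ∈ A, ∀ t, F (a, t) ∈ B) (h0 : ∀ x, F (x, 0) = f x) (h1 : ∀ x, F (x, 1) = g x)
    {z : SingChain n X} (hz : z ∈ relCycles A n) :
    chainMap n f z - chainMap n g z ∈ relBoundaries B n :=
  (homologyClass_eq_iff _ _).1 (LinearMap.congr_fun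
    (homologyMap_eq_of_homotopy n f g hf hg F hF h0 h1) (homologyClass ⟨z, hz⟩))

/-- Compactness makes `Φ` closed, so its restriction over the complement of `A` is a closed
continuous bijection, hence a homeomorphism. -/
lemma exists_lift_sing [CompactSpace P] [T2Space Y] {A : Set Y} {B : Set P} (Φ : C(P, Y))
    (hB : ∀ x, Φ x ∈ A ↔ x ∈ B) (hinj : ∀ x x', x ∉ B → Φ x = Φ x' → x = x')
    (hsurj : ∀ y ∉ A, ∃ x, Φ x = y) {n : ℕ} (σ : Sing n Y) (hσ : ∀ x, σ x ∈ Aᶜ) :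
    ∃ σ' : Sing n P, (∀ x, σ' x ∈ Bᶜ) ∧ Φ.comp σ' = σ := by
  have hh : IsHomeomorph (Aᶜ.restrictPreimage Φ) := by
    rw [isHomeomorph_iff_continuous_isClosedMap_bijective]
    refine ⟨Φ.continuous.restrictPreimage, Φ.continuous.isClosedMap.restrictPreimage _, ?_, ?_⟩
    · rintro ⟨x, hx⟩ ⟨x', hx'⟩ h
      exact Subtype.ext (hinj x x' (fun hxB => hx ((hB x).2 hxB)) (congrArg Subtype.val h))
    · rintro ⟨y, hy⟩
      obtain ⟨x, rfl⟩ := hsurj y hy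
      exact ⟨⟨x, hy⟩, rfl⟩
  let e := hh.homeomorph
  refine ⟨⟨fun x => (e.symm ⟨σ x, hσ x⟩ : P), by fun_prop⟩, fun x hx => ?_, ?_⟩
  · exact (e.symm ⟨σ x, hσ x⟩).2 ((hB _).2 hx)
  · ext1 x
    exact congrArg Subtype.val (e.apply_symm_apply ⟨σ x, hσ x⟩)

lemma chainsIn_le_map [CompactSpace P] [T2Space Y] {A : Set Y} {B : Set P} (Φ : C(P, Y))
    (hB : ∀ x, Φ x ∈ A ↔ x ∈ B) (hinj : ∀ x x', x ∉ B → Φ x = Φ x' → x = x')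
    (hsurj : ∀ y ∉ A, ∃ x, Φ x = y) (n : ℕ) :
    chainsIn Aᶜ n ≤ (chainsIn Bᶜ n).map (chainMap n Φ) := by
  rw [chainsIn_le_iff]
  intro σ hσ
  obtain ⟨σ', h1, h2⟩ := exists_lift_sing Φ hB hinj hsurj σ hσ
  exact ⟨_, single_mem_chainsIn h1 1, by rw [chainMap_single, h2]⟩

/-- Injectivity on `C` prevents cancellation between images of different simplices, so the support
of a chain can be read off from its image. -/
lemma mem_chainsIn_preimage {C : Set P} (Φ : C(P, Y)) (hinj : Set.InjOn Φ C) {V : Set Y} {n : ℕ}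
    {c : SingChain n P} (hc : c ∈ chainsIn C n) (hV : chainMap n Φ c ∈ chainsIn V n) :
    c ∈ chainsIn (Φ ⁻¹' V) n := by
  classical
  rw [chainsIn, Finsupp.mem_supported] at hc hV ⊢
  rw [chainMap, Finsupp.lmapDomain_apply, Finsupp.mapDomain_support_of_injOn] at hV
  · intro σ hσ
    exact hV (Finset.mem_coe.2 (Finset.mem_image_of_mem _ hσ))
  · intro σ hσ τ hτ h
    ext1 x
    exact hinj (hc hσ x) (hc hτ x) (DFunLike.congr_fun h x)

/-- The push on `P` and the constant homotopy on `A` agree where they meet, since the push fixes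
`B`. They descend along the map from the disjoint union, which is a quotient map because it is a
closed surjection. The parameter `τ` runs from `1`, the identity, to `1 / 2`. -/
lemma exists_collar_homotopy [CompactSpace P] [CompactSpace Y] [T2Space Y] {A : Set Y}
    (hA : IsClosed A) {B : Set P} (col : Collar B) (Φ : C(P, Y))
    (hB : ∀ x, Φ x ∈ A ↔ x ∈ B) (hinj : ∀ x x', x ∉ B → Φ x = Φ x' → x = x')
    (hsurj : ∀ y ∉ A, ∃ x, Φ x = y) :
    ∃ K : C(Y × unitInterval, Y), (∀ y ∈ A, ∀ t, K (y, t) = y) ∧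
      ∀ x t, K (Φ x, t) = Φ (col.push (x, 1 - (t : ℝ) / 2)) := by
  have := isCompact_iff_compactSpace.1 hA.isCompact
  let q : C((P × unitInterval) ⊕ (A × unitInterval), Y × unitInterval) :=
    ⟨Sum.elim (fun z => (Φ z.1, z.2)) fun z => (z.1.1, z.2), by
      refine Continuous.sumElim ?_ ?_ <;> fun_prop⟩
  have hq : Topology.IsQuotientMap q := by
    refine q.continuous.isClosedMap.isQuotientMap q.continuous ?_
    rintro ⟨y, t⟩
    by_cases hy : y ∈ A
    · exact ⟨Sum.inr (⟨y, hy⟩, t), rfl⟩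
    · obtain ⟨x, rfl⟩ := hsurj y hy
      exact ⟨Sum.inl (x, t), rfl⟩
  let g : C((P × unitInterval) ⊕ (A × unitInterval), Y) :=
    ⟨Sum.elim (fun z => Φ (col.push (z.1, 1 - (z.2 : ℝ) / 2))) fun z => z.1.1, by
      refine Continuous.sumElim ?_ ?_ <;> fun_prop⟩
  have hmem (x : P) (hx : x ∈ B) (t : unitInterval) : col.push (x, 1 - (t : ℝ) / 2) = x :=
    col.push_of_mem _ _ hx (by linarith [t.2.1])
  have hg : Function.FactorsThrough g q := by
    rintro (⟨x, t⟩ | ⟨y, t⟩) (⟨x', t'⟩ | ⟨y', t'⟩) h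
    · obtain ⟨h1, rfl⟩ := Prod.ext_iff.1 h
      change Φ x = Φ x' at h1
      change Φ (col.push (x, _)) = Φ (col.push (x', _))
      by_cases hx : x ∈ B
      · rw [hmem x hx, hmem x' ((hB x').1 (h1 ▸ (hB x).2 hx)), h1]
      · rw [hinj x x' hx h1]
        rfl
    · obtain ⟨h1, rfl⟩ := Prod.ext_iff.1 h
      change Φ x = y' at h1
      change Φ (col.push (x, _)) = y'
      rw [hmem x ((hB x).1 (h1 ▸ y'.2)), h1]
    · obtain ⟨h1, rfl⟩ := Prod.ext_iff.1 h
      change y = Φ x' at h1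
      change (y : Y) = Φ (col.push (x', _))
      rw [hmem x' ((hB x').1 (h1 ▸ y.2)), h1]
    · obtain ⟨h1, rfl⟩ := Prod.ext_iff.1 h
      exact h1
  have hlift (z) : hq.lift g hg (q z) = g z := DFunLike.congr_fun (hq.lift_comp g hg) z
  exact ⟨hq.lift g hg, fun y hy t => hlift (Sum.inr (⟨y, hy⟩, t)),
    fun x t => hlift (Sum.inl (x, t))⟩

/-- Subdivide the cycle into a part `v` near `A` and a part `u` away from `A`. The part `u` lifts to
`P`, and the end map `k` of the collar homotopy moves `v` into `A`. As `k` is homotopic to the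
identity relative to `A`, only the pushed lift of `u` survives. -/
lemma exists_relCycle_of_cell_univ [CompactSpace P] [CompactSpace Y] [T2Space Y] {A : Set Y}
    (hA : IsClosed A) {B : Set P} (col : Collar B) (Φ : C(P, Y))
    (hB : ∀ x, Φ x ∈ A ↔ x ∈ B) (hinj : ∀ x x', x ∉ B → Φ x = Φ x' → x = x')
    (hsurj : ∀ y ∉ A, ∃ x, Φ x = y) {n : ℕ} {z : SingChain n Y} (hz : z ∈ relCycles A n) :
    ∃ c ∈ relCycles B n, z - chainMap n Φ c ∈ relBoundaries A n := by
  obtain ⟨K, hKA, hKΦ⟩ := exists_collar_homotopy hA col Φ hB hinj hsurj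
  set O : Set P := {x | 1 / 2 < col.level x} with hO
  have hOo : IsOpen O := isOpen_lt continuous_const col.level.continuous
  -- An open neighbourhood of `A` consisting of `A` and the outer half of the cell; the push at `τ =
  -- 1 / 2` moves all of it into `A`.
  set V : Set Y := (Φ '' Oᶜ)ᶜ with hVdef
  have hVo : IsOpen V := (Φ.continuous.isClosedMap _ hOo.isClosed_compl).isOpen_compl
  have hAV : A ⊆ V := by
    rintro y hy ⟨x, hx, rfl⟩
    have := (col.mem_iff x).1 ((hB x).1 hy)
    apply hx
    change 1 / 2 < col.level x
    rw [this]
    norm_num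
  have hVW : V ∪ Aᶜ = Set.univ := by
    rw [Set.eq_univ_iff_forall]
    intro y
    by_cases hy : y ∈ A
    · exact Or.inl (hAV hy)
    · exact Or.inr hy
  let k : C(Y, Y) := K.comp ((ContinuousMap.id Y).prodMk (ContinuousMap.const Y 1))
  let kP : C(P, P) := col.push.comp ((ContinuousMap.id P).prodMk (ContinuousMap.const P (1 / 2)))
  have hkA (y) (hy : y ∈ A) : k y = y := hKA y hy 1
  have hkΦ : k.comp Φ = Φ.comp kP := by
    ext1 x
    refine (hKΦ x 1).trans ?_
    change Φ (col.push (x, 1 - (1 : ℝ) / 2)) = Φ (col.push (x, 1 / 2))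
    norm_num
  have hkP : Set.MapsTo kP (Φ ⁻¹' V) B := by
    intro x hx
    have hxO : x ∈ O := by
      by_contra h
      exact hx ⟨x, h, rfl⟩
    exact col.push_mem x _ le_rfl (le_of_lt hxO)
  have hkV : Set.MapsTo k V A := by
    intro y hy
    by_cases hyA : y ∈ A
    · rwa [hkA y hyA]
    · obtain ⟨x, rfl⟩ := hsurj y hyA
      rw [← ContinuousMap.comp_apply, hkΦ]
      exact (hB _).2 (hkP hy)
  obtain ⟨m, hm⟩ := exists_subdiv_pow_mem hVo hA.isOpen_compl hVW z
  have hz0 := subdiv_pow_mem_relCycles hz m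
  have hz1 := sub_subdiv_pow_mem hz m
  set z0 := (subdiv n ^ m) z
  obtain ⟨v, hv, u, hu, hvu⟩ := Submodule.mem_sup.1 hm
  obtain ⟨u', hu', rfl⟩ := chainsIn_le_map Φ hB hinj hsurj n hu
  -- The boundary of `u` is that of `z0` minus that of `v`, hence lies in `V`. The lifted boundary
  -- avoids `B`, where `Φ` is injective, so it lies in the preimage of `V`, which `kP` sends to `B`.
  have hcycle : chainMap n kP u' ∈ relCycles B n := by
    rw [relCycles, Submodule.mem_comap, boundary_chainMap]
    refine chainMap_mem _ kP hkP (mem_chainsIn_preimage Φ ?_ (boundary_mem_chainsIn hu') ?_)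
    · exact fun x hx x' _ h => hinj x x' hx h
    · rw [← boundary_chainMap, eq_sub_of_add_eq' hvu, map_sub]
      exact Submodule.sub_mem _ (chainsIn_mono hAV _ hz0) (boundary_mem_chainsIn hv)
  refine ⟨chainMap n kP u', hcycle, ?_⟩
  have hhom := sub_mem_relBoundaries_of_homotopy (A := A) (B := A) n (ContinuousMap.id Y) k
    (Set.mapsTo_id A) (fun y hy => by rwa [hkA y hy]) K (fun y hy t => by rwa [hKA y hy])
    (fun y => by
      by_cases hy : y ∈ A
      · exact hKA y hy 0
      · obtain ⟨x, rfl⟩ := hsurj y hy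
        rw [hKΦ]
        simp [col.push_one]) (fun _ => rfl) hz0
  rw [chainMap_id] at hhom
  have hk : chainMap n k z0 = chainMap n k v + chainMap n Φ (chainMap n kP u') := by
    rw [← hvu, map_add, ← chainMap_comp, hkΦ, chainMap_comp n Φ kP]
  have : z - chainMap n Φ (chainMap n kP u') =
      (z - z0) + (z0 - chainMap n k z0) + chainMap n k v := by
    rw [hk]; abel
  rw [this]
  exact Submodule.add_mem _ (Submodule.add_mem _ hz1 hhom)
    (chainsIn_le_relBoundaries A n (chainMap_mem n k hkV hv))

lemma exists_chain_subtype (F : Set Y) {n : ℕ} {z : SingChain n Y} (hz : z ∈ chainsIn F n) :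
    ∃ z' : SingChain n F, chainMap n ⟨Subtype.val, continuous_subtype_val⟩ z' = z := by
  have : chainsIn F n ≤ LinearMap.range
      (chainMap n (⟨Subtype.val, continuous_subtype_val⟩ : C(F, Y))) := by
    rw [chainsIn_le_iff]
    intro σ hσ
    refine ⟨Finsupp.single ⟨fun x => ⟨σ x, hσ x⟩, by fun_prop⟩ 1, ?_⟩
    rw [chainMap_single]
    rfl
  exact this hz

/-- If `F'` is obtained from `F` by attaching `P` along `B`, then the homology of `(F', F)` comes
from the homology of `(P, B)`. -/
lemma exists_relCycle_of_cell [CompactSpace P] [CompactSpace Y] [T2Space Y] {F F' : Set Y}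
    (hF : IsClosed F) {B : Set P} (col : Collar B) (Φ : C(P, Y)) (hF' : F' = F ∪ Set.range Φ)
    (hB : ∀ x, Φ x ∈ F ↔ x ∈ B) (hinj : ∀ x x', x ∉ B → Φ x = Φ x' → x = x')
    {n : ℕ} {z : SingChain n Y} (hz : z ∈ chainsIn F' n)
    (hdz : boundary n z ∈ chainsIn F (n - 1)) :
    ∃ c ∈ relCycles B n, ∃ w ∈ chainsIn F' (n + 1),
      z - chainMap n Φ c - faceSum n w ∈ chainsIn F n := by
  have hFc : IsClosed F' := hF' ▸ hF.union (isCompact_range Φ.continuous).isClosed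
  have := isCompact_iff_compactSpace.1 hFc.isCompact
  let ι : C(F', Y) := ⟨Subtype.val, continuous_subtype_val⟩
  obtain ⟨z', rfl⟩ := exists_chain_subtype F' hz
  have hmem (x) : Φ x ∈ F' := hF' ▸ Or.inr ⟨x, rfl⟩
  let Φ' : C(P, F') := ⟨fun x => ⟨Φ x, hmem x⟩, by fun_prop⟩
  obtain ⟨c, hc, h⟩ := exists_relCycle_of_cell_univ (A := ι ⁻¹' F) (hF.preimage ι.continuous) col Φ'
    hB (fun x x' hx h => hinj x x' hx (congrArg Subtype.val h)) (by
      rintro ⟨y, hy⟩ hyF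
      have hy' := hy
      rw [hF'] at hy'
      rcases hy' with hy' | ⟨x, hx⟩
      · exact (hyF hy').elim
      · exact ⟨x, Subtype.ext hx⟩) (z := z') (by
      rw [relCycles, Submodule.mem_comap]
      rw [boundary_chainMap] at hdz
      exact mem_chainsIn_preimage ι Subtype.val_injective.injOn (mem_chainsIn_univ _) hdz)
  obtain ⟨_, ⟨w, rfl⟩, a, ha, hwa⟩ := Submodule.mem_sup.1 h
  refine ⟨c, hc, chainMap (n + 1) ι w,
    chainMap_mem (A := Set.univ) _ ι (fun x _ => x.2) (mem_chainsIn_univ w), ?_⟩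
  have hc' : chainMap n Φ c = chainMap n ι (chainMap n Φ' c) := by
    rw [← chainMap_comp]
    rfl
  rw [faceSum_chainMap, hc', ← map_sub, ← map_sub, ← hwa, add_sub_cancel_left]
  exact chainMap_mem n ι (fun _ h => h) ha

end Cells

end ConfSpace

end


noncomputable section

namespace ConfSpace

/-! The homology of a simplex times a pair -/

section Simplex

variable {X : Type u} {Y : Type v} [TopologicalSpace X] [TopologicalSpace Y]

/-- The smallest barycentric coordinate. -/
def minCoord {p : ℕ} (x : stdSimplex ℝ (Fin (p + 1))) : ℝ :=
  Finset.univ.inf' Finset.univ_nonempty fun i => x i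

lemma continuous_minCoord {p : ℕ} : Continuous (minCoord (p := p)) :=
  Continuous.finset_inf'_apply _ fun i _ => (continuous_apply i).comp continuous_subtype_val

lemma minCoord_le {p : ℕ} (x : stdSimplex ℝ (Fin (p + 1))) (i : Fin (p + 1)) :
    minCoord x ≤ x i := Finset.inf'_le _ (Finset.mem_univ i)

lemma exists_eq_minCoord {p : ℕ} (x : stdSimplex ℝ (Fin (p + 1))) : ∃ i, x i = minCoord x := by
  obtain ⟨i, -, hi⟩ := Finset.exists_mem_eq_inf' Finset.univ_nonempty fun i => x i
  exact ⟨i, hi.symm⟩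

lemma minCoord_nonneg {p : ℕ} (x : stdSimplex ℝ (Fin (p + 1))) : 0 ≤ minCoord x := by
  obtain ⟨i, hi⟩ := exists_eq_minCoord x
  rw [← hi]
  exact stdSimplex.zero_le x i

/-- The radial structure of the standard simplex. -/
def simplexCollar (p : ℕ) : Collar (simplexBoundary p) where
  level := ⟨fun x => 1 - (p + 1) * minCoord x, by
    have := continuous_minCoord (p := p)
    fun_prop⟩
  -- Radial expansion from the barycenter. Dividing by the level itself lands exactly on the
  -- boundary, and the bound `1 / 2` keeps the denominator positive.
  push := ⟨fun z => ⟨fun i => 1 / ((p : ℝ) + 1) + (z.1 i - 1 / ((p : ℝ) + 1)) /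
      max (max (1 - (p + 1) * minCoord z.1) z.2) (1 / 2), fun i => by
        have h1 := minCoord_le z.1 i
        have hp : (0 : ℝ) < p + 1 := by positivity
        set μ := max (max (1 - (p + 1) * minCoord z.1) z.2) (1 / 2)
        have hμ : 1 - (p + 1) * minCoord z.1 ≤ μ := (le_max_left _ _).trans (le_max_left _ _)
        have hμ0 : 0 < μ := lt_of_lt_of_le (by norm_num) (le_max_right _ _)
        have : -(1 / ((p : ℝ) + 1)) ≤ (z.1 i - 1 / ((p : ℝ) + 1)) / μ := by
          rw [le_div_iff₀ hμ0]
          have h2 : 1 / ((p : ℝ) + 1) * (1 - (p + 1) * minCoord z.1) ≤ 1 / ((p : ℝ) + 1) * μ :=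
            mul_le_mul_of_nonneg_left hμ (by positivity)
          have h3 : 1 / ((p : ℝ) + 1) * (1 - (p + 1) * minCoord z.1) =
            1 / ((p : ℝ) + 1) - minCoord z.1 := by field_simp
          linarith
        linarith, by
        have hp : (p : ℝ) + 1 ≠ 0 := by positivity
        have hs := stdSimplex.sum_eq_one z.1
        simp only [sub_div, Finset.sum_add_distrib, Finset.sum_sub_distrib, ← Finset.sum_div, hs]
        simp [hp]⟩, by
    refine Continuous.subtype_mk (continuous_pi fun i => ?_) _
    have h1 := (continuous_minCoord (p := p)).comp (continuous_fst (Y := ℝ))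
    have h2 : Continuous fun z : stdSimplex ℝ (Fin (p + 1)) × ℝ => z.1 i :=
      (continuous_apply i).comp (continuous_subtype_val.comp continuous_fst)
    refine continuous_const.add ((h2.sub continuous_const).div ?_ fun z => ?_)
    · exact ((continuous_const.sub (continuous_const.mul h1)).max continuous_snd).max
        continuous_const
    · exact (lt_of_lt_of_le (by norm_num) (le_max_right _ _)).ne'⟩
  level_le x := by
    have := minCoord_nonneg x
    have : 0 ≤ ((p : ℝ) + 1) * minCoord x := by positivity
    simp only [ContinuousMap.coe_mk]
    linarith
  mem_iff x := by
    have hp : (p : ℝ) + 1 ≠ 0 := by positivity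
    simp only [ContinuousMap.coe_mk, sub_eq_self, mul_eq_zero, hp, false_or]
    constructor
    · rintro ⟨i, hi⟩
      exact le_antisymm (hi ▸ minCoord_le x i) (minCoord_nonneg x)
    · intro h
      obtain ⟨i, hi⟩ := exists_eq_minCoord x
      exact ⟨i, hi.trans h⟩
  push_one x := by
    ext i
    have h0 := minCoord_nonneg x
    have h1 : 1 - (p + 1) * minCoord x ≤ 1 := by
      have : 0 ≤ ((p : ℝ) + 1) * minCoord x := by positivity
      linarith
    change 1 / ((p : ℝ) + 1) + (x i - 1 / ((p : ℝ) + 1)) / max (max _ 1) (1 / 2) = x i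
    rw [max_eq_right h1, max_eq_left (by norm_num)]
    ring
  push_of_mem x τ hx hτ := by
    ext i
    have h0 : minCoord x = 0 := by
      obtain ⟨i, hi⟩ := hx
      exact le_antisymm (hi ▸ minCoord_le x i) (minCoord_nonneg x)
    change 1 / ((p : ℝ) + 1) + (x i - 1 / ((p : ℝ) + 1)) /
      max (max (1 - (p + 1) * minCoord x) τ) (1 / 2) = x i
    rw [h0, mul_zero, sub_zero, max_eq_left hτ, max_eq_left (by norm_num)]
    ring
  push_mem x τ h1 h2 := by
    obtain ⟨i, hi⟩ := exists_eq_minCoord x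
    refine ⟨i, ?_⟩
    simp only [ContinuousMap.coe_mk] at h2
    change 1 / ((p : ℝ) + 1) + (x i - 1 / ((p : ℝ) + 1)) /
      max (max (1 - (p + 1) * minCoord x) τ) (1 / 2) = 0
    rw [max_eq_left h2, max_eq_left (h1.trans h2), hi]
    have hp : (p : ℝ) + 1 ≠ 0 := by positivity
    have hg : 1 - ((p : ℝ) + 1) * minCoord x ≠ 0 := by linarith
    field_simp
    ring

lemma chainMap_cross {X' : Type*} {Y' : Type*} [TopologicalSpace X'] [TopologicalSpace Y']
    (f : C(X, X')) (g : C(Y, Y')) (n p q : ℕ) (x : SingChain p X) (y : SingChain q Y) :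
    chainMap n (f.prodMap g) (cross n p q x y) =
      cross n p q (chainMap p f x) (chainMap q g y) := by
  suffices h : (cross n p q).compr₂ (chainMap n (f.prodMap g)) =
      (cross n p q).compl₁₂ (chainMap p f) (chainMap q g) from
    LinearMap.congr_fun (LinearMap.congr_fun h x) y
  ext1 σ
  ext1
  ext1 τ
  ext1
  simp only [LinearMap.comp_apply, Finsupp.lsingle_apply, LinearMap.compr₂_apply,
    LinearMap.compl₁₂_apply, chainMap_single, cross_single]
  generalize shuffleChain n p q = c
  suffices h : chainMap n (f.prodMap g) ∘ₗ realize σ τ n = realize (f.comp σ) (g.comp τ) n from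
    LinearMap.congr_fun h c
  ext1 φ
  ext1
  simp only [LinearMap.comp_apply, Finsupp.lsingle_apply, realize_single, chainMap_single]
  rfl

lemma shuffleChain_zero_self (n : ℕ) :
    shuffleChain n 0 n = Finsupp.single (fun i => (0, i)) 1 := by
  induction n with
  | zero =>
    simp only [shuffleChain, and_self, if_true]
    congr 1
    funext i
    rw [show i = 0 from Fin.fin_one_eq_zero i]
  | succ n ih =>
    rw [shuffleChain_succ, shuffleFstTail, shuffleSndTail, ih, TupleChain.map_single, pow_zero,
      one_smul, zero_add (Finsupp.single _ _), TupleChain.cone_single]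
    congr 1
    funext i
    refine Fin.cases ?_ (fun j => ?_) i <;> simp

lemma const_cross (n : ℕ) (x : X) (y : SingChain n Y) :
    cross n 0 n (Finsupp.single (ContinuousMap.const _ x) 1) y =
      chainMap n ((ContinuousMap.const Y x).prodMk (ContinuousMap.id Y)) y := by
  suffices h : cross n 0 n (Finsupp.single (ContinuousMap.const _ x) 1) =
      chainMap n ((ContinuousMap.const Y x).prodMk (ContinuousMap.id Y)) from
    LinearMap.congr_fun h y
  ext1 σ
  ext1
  simp only [LinearMap.comp_apply, Finsupp.lsingle_apply, cross_single,
    shuffleChain_zero_self, realize_single, chainMap_single]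
  congr 1
  have : (Prod.snd ∘ fun i : Fin (n + 1) => ((0 : Fin 1), i)) = id := rfl
  rw [this, simplexMap_id]
  rfl

lemma faceSum_faceSum (n : ℕ) (c : SingChain (n + 2) X) : faceSum n (faceSum (n + 1) c) = 0 := by
  suffices h : faceSum n ∘ₗ faceSum (X := X) (n + 1) = 0 from LinearMap.congr_fun h c
  ext1 σ
  ext1
  simp only [LinearMap.comp_apply, Finsupp.lsingle_apply, LinearMap.zero_apply]
  rw [single_eq_chainMap, faceSum_chainMap, faceSum_chainMap, faceSum_affineChain,
    faceSum_affineChain, TupleChain.boundary_boundary, map_zero, map_zero]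

lemma boundary_faceSum (n : ℕ) (c : SingChain (n + 1) X) : boundary n (faceSum n c) = 0 := by
  rcases n with _ | n
  · rfl
  · exact faceSum_faceSum n c

/-- The identity of the standard simplex as a chain. -/
def simplexChain (p : ℕ) : SingChain p (stdSimplex ℝ (Fin (p + 1))) :=
  Finsupp.single (ContinuousMap.id _) 1

lemma chainMap_simplexChain {p : ℕ} (σ : Sing p X) :
    chainMap p σ (simplexChain p) = Finsupp.single σ 1 := by
  rw [simplexChain, chainMap_single]
  rfl

lemma faceMap_apply_self {p : ℕ} (i : Fin (p + 2)) (x : stdSimplex ℝ (Fin (p + 1))) :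
    simplexMap i.succAbove x i = 0 := by
  rw [simplexMap_apply]
  refine Finset.sum_eq_zero fun j hj => ?_
  exact absurd (Finset.mem_filter.1 hj).2 (Fin.succAbove_ne i j)

lemma faceMap_apply_succAbove {p : ℕ} (i : Fin (p + 2)) (x : stdSimplex ℝ (Fin (p + 1)))
    (j : Fin (p + 1)) : simplexMap i.succAbove x (i.succAbove j) = x j := by
  rw [simplexMap_apply, Finset.sum_eq_single j]
  · intro k hk hkj
    exact absurd (Fin.succAbove_right_injective (Finset.mem_filter.1 hk).2) hkj
  · intro h
    simp at h

/-- The union of the facets of the simplex that contain the vertex `0`. -/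
def horn (p : ℕ) : Set (stdSimplex ℝ (Fin (p + 2))) := {b | ∃ i, i ≠ 0 ∧ b i = 0}

lemma horn_subset (p : ℕ) : horn p ⊆ simplexBoundary (p + 1) := fun _ ⟨i, _, hi⟩ => ⟨i, hi⟩

lemma pairProd_mono {X Y : Type*} {A A' : Set X} {B B' : Set Y} (hA : A ⊆ A') (hB : B ⊆ B') :
    pairProd A B ⊆ pairProd A' B' := fun _ hz => hz.imp (fun h => hA h) fun h => hB h

lemma isClosed_pairProd {A : Set X} {B : Set Y} (hA : IsClosed A) (hB : IsClosed B) :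
    IsClosed (pairProd A B) :=
  (hA.preimage continuous_fst).union (hB.preimage continuous_snd)

lemma isClosed_horn (p : ℕ) : IsClosed (horn p) := by
  have : horn p = ⋃ i : {i : Fin (p + 2) // i ≠ 0}, {b | b i = 0} := by
    ext b
    simp [horn]
  rw [this]
  exact isClosed_iUnion_of_finite fun i => isClosed_eq
    ((continuous_apply _).comp continuous_subtype_val) continuous_const

lemma Collar.isClosed {B : Set X} (b : Collar B) : IsClosed B := by
  have : B = {x | b.level x = 1} := Set.ext b.mem_iff
  rw [this]
  exact isClosed_eq b.level.continuous continuous_const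

/-- The straight-line contraction of a simplex to its vertex `0`. -/
def contractSimplex (p : ℕ) : C(stdSimplex ℝ (Fin (p + 1)) × unitInterval,
    stdSimplex ℝ (Fin (p + 1))) :=
  ⟨fun z => ⟨fun i => (1 - z.2) * z.1 i + z.2 * vertices p 0 i, fun i =>
    add_nonneg (mul_nonneg (by linarith [z.2.2.2]) (stdSimplex.zero_le _ _))
      (mul_nonneg z.2.2.1 (stdSimplex.zero_le _ _)), by
    rw [Finset.sum_add_distrib, ← Finset.mul_sum, ← Finset.mul_sum, stdSimplex.sum_eq_one,
      stdSimplex.sum_eq_one]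
    ring⟩, by
    refine Continuous.subtype_mk (continuous_pi fun i => ?_) _
    have h2 : Continuous fun z : stdSimplex ℝ (Fin (p + 1)) × unitInterval => z.1 i :=
      (continuous_apply i).comp (continuous_subtype_val.comp continuous_fst)
    fun_prop⟩

lemma contractSimplex_apply (p : ℕ) (x : stdSimplex ℝ (Fin (p + 1))) (t : unitInterval)
    (i : Fin (p + 1)) : contractSimplex p (x, t) i = (1 - t) * x i + t * vertices p 0 i := rfl

lemma vertices_zero_apply_of_ne {p : ℕ} {i : Fin (p + 1)} (hi : i ≠ 0) : vertices p 0 i = 0 := by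
  simp [vertices, hi]

/-- The contraction to the vertex `0` preserves each facet through that vertex, hence the horn, and
its end map has image in the horn. So the pair has no homology. -/
lemma relCycles_horn_le (p : ℕ) (B : Set Y) (n : ℕ) :
    relCycles (pairProd (horn p) B) n ≤ relBoundaries (pairProd (horn p) B) n := by
  intro z hz
  let F : C((stdSimplex ℝ (Fin (p + 2)) × Y) × unitInterval, stdSimplex ℝ (Fin (p + 2)) × Y) :=
    ⟨fun w => (contractSimplex (p + 1) (w.1.1, w.2), w.1.2), by fun_prop⟩
  let g : C(stdSimplex ℝ (Fin (p + 2)) × Y, stdSimplex ℝ (Fin (p + 2)) × Y) :=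
    F.comp ((ContinuousMap.id _).prodMk (ContinuousMap.const _ 1))
  have hF (a) (ha : a ∈ pairProd (horn p) B) (t) : F (a, t) ∈ pairProd (horn p) B := by
    rcases ha with ⟨i, hi, h⟩ | h
    · refine Or.inl ⟨i, hi, ?_⟩
      change contractSimplex (p + 1) (a.1, t) i = 0
      rw [contractSimplex_apply, h, vertices_zero_apply_of_ne hi]
      ring
    · exact Or.inr h
  have hg (a) : g a ∈ pairProd (horn p) B := by
    refine Or.inl ⟨1, one_ne_zero, ?_⟩
    change contractSimplex (p + 1) (a.1, 1) 1 = 0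
    rw [contractSimplex_apply, vertices_zero_apply_of_ne one_ne_zero]
    simp
  have h := sub_mem_relBoundaries_of_homotopy n (ContinuousMap.id _) g (Set.mapsTo_id _)
    (fun a _ => hg a) F hF (fun a => Prod.ext (by
      ext i
      change contractSimplex (p + 1) (a.1, 0) i = a.1 i
      rw [contractSimplex_apply]
      simp) rfl) (fun _ => rfl) hz
  rw [chainMap_id] at h
  have h2 := Submodule.add_mem _ h (chainsIn_le_relBoundaries (pairProd (horn p) B) n
    (chainMap_mem (A := Set.univ) n g (fun a _ => hg a) (mem_chainsIn_univ z)))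
  rwa [sub_add_cancel] at h2

lemma exists_cross_sub_mem_zero {B : Set Y} {n : ℕ}
    {z : SingChain n (stdSimplex ℝ (Fin 1) × Y)}
    (hz : z ∈ relCycles (pairProd (simplexBoundary 0) B) n) :
    ∃ y ∈ relCycles B n, z - cross n 0 n (simplexChain 0) y ∈
      relBoundaries (pairProd (simplexBoundary 0) B) n := by
  have hmem (a) (ha : a ∈ pairProd (simplexBoundary 0) B) : a.2 ∈ B := by
    rcases ha with ⟨i, hi⟩ | h
    · have := stdSimplex.eq_one_of_unique (X := Fin 1) a.1 i
      rw [hi] at this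
      exact absurd this zero_ne_one
    · exact h
  refine ⟨chainMap n ContinuousMap.snd z, chainMap_mem_relCycles n ContinuousMap.snd hmem z hz, ?_⟩
  have h1 : simplexChain 0 = Finsupp.single (ContinuousMap.const _ (vertices 0 0)) 1 := by
    rw [simplexChain]
    congr 1
    ext1 x
    exact Subsingleton.elim _ _
  rw [h1, const_cross, ← chainMap_comp]
  have h2 : ((ContinuousMap.const Y (vertices 0 0)).prodMk (ContinuousMap.id Y)).comp
      (ContinuousMap.snd : C(stdSimplex ℝ (Fin 1) × Y, Y)) = ContinuousMap.id _ := by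
    ext1 x
    exact Prod.ext (Subsingleton.elim _ _) rfl
  rw [h2, chainMap_id, sub_self]
  exact Submodule.zero_mem _

/-- The homology of `(Δᵖ, ∂Δᵖ) × (Y, B)` is generated by cross products with the fundamental class
of the simplex. -/
lemma exists_cross_sub_mem [CompactSpace Y] [T2Space Y] {B : Set Y} (col : Collar B) (p : ℕ) :
    ∀ {n : ℕ} {z : SingChain n (stdSimplex ℝ (Fin (p + 1)) × Y)},
      z ∈ relCycles (pairProd (simplexBoundary p) B) n →
      ∃ q, ∃ y ∈ relCycles B q, z - cross n p q (simplexChain p) y ∈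
        relBoundaries (pairProd (simplexBoundary p) B) n := by
  induction p with
  | zero => exact fun hz => ⟨_, exists_cross_sub_mem_zero hz⟩
  | succ p ih =>
    intro n z hz
    have hsub : pairProd (horn p) B ⊆ pairProd (simplexBoundary (p + 1)) B :=
      pairProd_mono (horn_subset p) le_rfl
    -- In degree zero every chain is a cycle relative to the horn, hence a boundary there, and `y =
    -- 0` works.
    rcases n with _ | n
    · refine ⟨0, 0, Submodule.zero_mem _, ?_⟩
      rw [map_zero, sub_zero]
      exact relBoundaries_mono hsub 0 (relCycles_horn_le p B 0
        (by simp [relCycles, boundary]))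
    · let d : C(stdSimplex ℝ (Fin (p + 1)), stdSimplex ℝ (Fin (p + 2))) :=
        simplexMap (Fin.succAbove 0)
      have hd0 (x) : d x 0 = 0 := faceMap_apply_self 0 x
      have hds (x) (j : Fin (p + 1)) : d x j.succ = x j := by
        have := faceMap_apply_succAbove 0 x j
        rwa [Fin.succAbove_zero] at this
      let Φ := d.prodMap (ContinuousMap.id Y)
      -- The boundary of the pair arises from the horn part by attaching the facet opposite the
      -- vertex `0`, times `Y`. Applied to the boundary of `z`, this yields a cycle on a simplex of
      -- one dimension less.
      obtain ⟨c, hc, w, hw, hcw⟩ := exists_relCycle_of_cell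
        (F := pairProd (horn p) B) (F' := pairProd (simplexBoundary (p + 1)) B)
        (isClosed_pairProd (isClosed_horn p) col.isClosed) ((simplexCollar p).prod col) Φ
        (by
          ext ⟨b, y⟩
          constructor
          · rintro (⟨i, hi⟩ | h)
            · by_cases hi0 : i = 0
              · subst hi0
                refine Or.inr ⟨(⟨fun j => b j.succ, fun j => stdSimplex.zero_le b _, ?_⟩, y), ?_⟩
                · have := stdSimplex.sum_eq_one b
                  rwa [Fin.sum_univ_succ, hi, zero_add] at this
                · refine Prod.ext ?_ rfl
                  ext k
                  induction k using Fin.cases with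
                  | zero => exact (hd0 _).trans hi.symm
                  | succ k => exact hds _ k
              · exact Or.inl (Or.inl ⟨i, hi0, hi⟩)
            · exact Or.inl (Or.inr h)
          · rintro (h | ⟨⟨x, y'⟩, h⟩)
            · exact hsub h
            · rw [← h]
              exact Or.inl ⟨0, hd0 x⟩)
        (by
          rintro ⟨x, y⟩
          refine or_congr ⟨?_, ?_⟩ Iff.rfl
          · rintro ⟨i, hi, h⟩
            obtain ⟨j, rfl⟩ := Fin.exists_succ_eq.2 hi
            exact ⟨j, (hds x j).symm.trans h⟩
          · rintro ⟨j, h⟩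
            exact ⟨j.succ, Fin.succ_ne_zero j, (hds x j).trans h⟩)
        (by
          rintro ⟨x, y⟩ ⟨x', y'⟩ - h
          obtain ⟨h1, h2⟩ := Prod.ext_iff.1 h
          refine Prod.ext ?_ h2
          ext j
          have : d x = d x' := h1
          change x j = x' j
          rw [← hds x j, ← hds x' j, this])
        (z := faceSum n z) hz (by rw [boundary_faceSum]; exact Submodule.zero_mem _)
      obtain ⟨q, y, hy, hcy⟩ := ih hc
      refine ⟨q, y, hy, ?_⟩
      have hΦ (a) : Φ a ∈ pairProd (simplexBoundary (p + 1)) B := Or.inl ⟨0, hd0 a.1⟩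
      obtain ⟨_, ⟨w', rfl⟩, a, ha, hwa⟩ := Submodule.mem_sup.1 hcy
      set w1 := w + chainMap (n + 1) Φ w'
      have hw1 : w1 ∈ chainsIn (pairProd (simplexBoundary (p + 1)) B) (n + 1) :=
        Submodule.add_mem _ hw (chainMap_mem (A := Set.univ) _ Φ (fun a _ => hΦ a)
          (mem_chainsIn_univ _))
      have hΦB : Set.MapsTo Φ (pairProd (simplexBoundary p) B) (pairProd (horn p) B) := by
        rintro ⟨x, y⟩ (⟨j, hj⟩ | h)
        · exact Or.inl ⟨j.succ, Fin.succ_ne_zero j, (hds x j).trans hj⟩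
        · exact Or.inr h
      -- By the Leibniz rule, the facet opposite `0` appears with sign `+1`. The other facets lie in
      -- the horn, and the boundary of `y` lies in `B`.
      have hcross : faceSum n (cross (n + 1) (p + 1) q (simplexChain (p + 1)) y) -
          chainMap n Φ (cross n p q (simplexChain p) y) ∈ chainsIn (pairProd (horn p) B) n := by
        rw [faceSum_cross]
        change cross n p q (faceSum p (simplexChain (p + 1))) y + _ - _ ∈ _
        have h0 : cross n p q (Finsupp.single d 1) y =
            chainMap n Φ (cross n p q (simplexChain p) y) := by
          rw [chainMap_cross, chainMap_simplexChain, chainMap_id]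
        rw [simplexChain, faceSum_single, Fin.sum_univ_succ, map_add, LinearMap.add_apply, ← h0]
        have h1 : face 0 (ContinuousMap.id (stdSimplex ℝ (Fin (p + 2)))) = d := rfl
        rw [h1, Fin.val_zero, pow_zero, one_smul, add_assoc (cross n p q (Finsupp.single d 1) y),
          add_sub_cancel_left]
        refine Submodule.add_mem _ (cross_mem_left B n p q y ?_) (Submodule.smul_mem _ _
          (cross_mem_right _ n _ _ _ hy))
        refine Submodule.sum_mem _ fun i _ => Submodule.smul_mem _ _ (single_mem_chainsIn ?_ 1)
        exact fun x => ⟨i.succ, Fin.succ_ne_zero i, faceMap_apply_self _ x⟩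
      -- After these corrections the boundary of `z` lies in the horn part, relative to which there
      -- is no homology. The chain `w1` is supported in the boundary and is discarded at the end.
      have hz' : z - w1 - cross (n + 1) (p + 1) q (simplexChain (p + 1)) y ∈
          relCycles (pairProd (horn p) B) (n + 1) := by
        rw [relCycles, Submodule.mem_comap]
        change faceSum n _ ∈ chainsIn _ n
        have e : faceSum n (z - w1 - cross (n + 1) (p + 1) q (simplexChain (p + 1)) y) =
            (faceSum n z - chainMap n Φ c - faceSum n w) + chainMap n Φ a -
            (faceSum n (cross (n + 1) (p + 1) q (simplexChain (p + 1)) y) -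
              chainMap n Φ (cross n p q (simplexChain p) y)) := by
          have e1 := congrArg (chainMap n Φ) hwa
          rw [map_add, map_sub, ← faceSum_chainMap] at e1
          rw [eq_sub_of_add_eq' e1, map_sub, map_sub, map_add]
          abel
        rw [e]
        exact Submodule.sub_mem _ (Submodule.add_mem _ hcw (chainMap_mem n Φ hΦB ha)) hcross
      have := Submodule.add_mem _ (relBoundaries_mono hsub _ (relCycles_horn_le p B _ hz'))
        (chainsIn_le_relBoundaries _ _ hw1)
      rwa [sub_right_comm, sub_add_cancel] at this

lemma cross_eq_zero {n p q : ℕ} (h : n ≠ p + q) (x : SingChain p X) (y : SingChain q Y) :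
    cross n p q x y = 0 := by
  suffices h : cross (X := X) (Y := Y) n p q = 0 by rw [h]; rfl
  ext1 σ
  ext1
  ext1 τ
  ext1
  simp only [LinearMap.comp_apply, Finsupp.lsingle_apply, cross_single, shuffleChain_eq_zero n p q h,
    map_zero, LinearMap.zero_apply]

/-- The homology of a simplex modulo its boundary vanishes below the dimension. -/
lemma relCycles_simplexBoundary_le {n m : ℕ} (h : n < m) :
    relCycles (simplexBoundary m) n ≤ relBoundaries (simplexBoundary m) n := by
  intro z hz
  -- Crossing with a point turns the statement into the case of an empty `B`, where the generating
  -- cross products vanish because their degree is at least `m`.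
  let f : C(stdSimplex ℝ (Fin (m + 1)), stdSimplex ℝ (Fin (m + 1)) × PUnit.{1}) :=
    (ContinuousMap.id _).prodMk (ContinuousMap.const _ PUnit.unit)
  have hf : Set.MapsTo f (simplexBoundary m) (pairProd (simplexBoundary m) ∅) :=
    fun _ hx => Or.inl hx
  obtain ⟨q, y, -, hy⟩ := exists_cross_sub_mem Collar.empty m (chainMap_mem_relCycles n f hf z hz)
  rw [cross_eq_zero (by omega), sub_zero] at hy
  have := chainMap_mem_relBoundaries n (ContinuousMap.fst : C(_ × PUnit.{1}, _))
    (B := simplexBoundary m) (fun a ha => ha.elim id fun h => h.elim) _ hy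
  rwa [← chainMap_comp, show ContinuousMap.fst.comp f = ContinuousMap.id _ from rfl,
    chainMap_id] at this

end Simplex

end ConfSpace

end


noncomputable section

namespace ConfSpace

/-! Concatenation of loops -/

section Concatenation

lemma cumulative_eq_sum {m : ℕ} (i : ℕ) (x : stdSimplex ℝ (Fin (m + 1))) :
    cumulative i x = ∑ k, x k * if k.val < i then 1 else 0 := by
  rw [cumulative, Finset.sum_filter]
  simp

lemma cumulative_simplexMap {m n : ℕ} (φ : Fin (m + 1) → Fin (n + 1)) (i : ℕ)
    (x : stdSimplex ℝ (Fin (m + 1))) :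
    cumulative i (simplexMap φ x) = ∑ j with (φ j).val < i, x j := by
  rw [cumulative_eq_sum, sum_simplexMap_mul φ x fun k => if k.val < i then 1 else 0,
    Finset.sum_filter]
  simp

lemma partialSum_eq_cumulative {n : ℕ} (i : Fin n) (b : stdSimplex ℝ (Fin (n + 1))) :
    (partialSum i b : ℝ) = cumulative (i + 1) b := by
  change ∑ j : Fin (n + 1) with j ≤ i.castSucc, b j = _
  rw [cumulative]
  congr 1
  ext j
  simp [Fin.le_def]

/-- The part of the simplex `0 ≤ s_1 ≤ ⋯ ≤ s_n ≤ 1` where the first `p` coordinates are at most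
`1/2` and the others at least `1/2`, as an image of the product of two simplices. -/
def splitMap (p q n : ℕ) : C(stdSimplex ℝ (Fin (p + 1)) × stdSimplex ℝ (Fin (q + 1)),
    stdSimplex ℝ (Fin (n + 1))) :=
  ⟨fun z => mid (simplexMap (fun i : Fin (p + 1) => Fin.ofNat (n + 1) i) z.1)
    (simplexMap (fun j : Fin (q + 1) => Fin.ofNat (n + 1) (p + j)) z.2), by
    refine Continuous.subtype_mk (continuous_pi fun i => ?_) _
    have h1 {m : ℕ} (f : C(stdSimplex ℝ (Fin (p + 1)) × stdSimplex ℝ (Fin (q + 1)),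
        stdSimplex ℝ (Fin (m + 1)))) (i) : Continuous fun z => f z i :=
      (continuous_apply i).comp (continuous_subtype_val.comp f.continuous)
    exact ((h1 ((simplexMap _).comp ContinuousMap.fst) i).add
      (h1 ((simplexMap _).comp ContinuousMap.snd) i)).div_const 2⟩

/-- The bijection of `Fin p ⊕ Fin q` with `Fin n` for `p + q = n`. -/
def sumEquiv {p q n : ℕ} (h : p + q = n) : Fin p ⊕ Fin q ≃ Fin n :=
  finSumFinEquiv.trans (finCongr h)

lemma partialSum_splitMap_inl {p q n : ℕ} (h : p + q = n)
    (z : stdSimplex ℝ (Fin (p + 1)) × stdSimplex ℝ (Fin (q + 1))) (i : Fin p) :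
    (partialSum (sumEquiv h (Sum.inl i)) (splitMap p q n z) : ℝ) = partialSum i z.1 / 2 := by
  have hi : (sumEquiv h (Sum.inl i) : ℕ) = i := by simp [sumEquiv]
  rw [partialSum_eq_cumulative, partialSum_eq_cumulative, hi]
  change cumulative _ (mid _ _) = _
  rw [cumulative_mid, cumulative_simplexMap, cumulative_simplexMap]
  congr 1
  have h2 : ∑ j : Fin (q + 1) with (Fin.ofNat (n + 1) (p + j.val)).val < i.val + 1, z.2 j = 0 := by
    refine Finset.sum_eq_zero fun j hj => ?_
    have := (Finset.mem_filter.1 hj).2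
    rw [Fin.val_ofNat, Nat.mod_eq_of_lt (by omega)] at this
    omega
  rw [h2, add_zero, cumulative]
  congr 1
  ext j
  rw [Finset.mem_filter, Finset.mem_filter, Fin.val_ofNat, Nat.mod_eq_of_lt (by omega)]

lemma partialSum_splitMap_inr {p q n : ℕ} (h : p + q = n)
    (z : stdSimplex ℝ (Fin (p + 1)) × stdSimplex ℝ (Fin (q + 1))) (i : Fin q) :
    (partialSum (sumEquiv h (Sum.inr i)) (splitMap p q n z) : ℝ) =
      (1 + partialSum i z.2) / 2 := by
  have hi : (sumEquiv h (Sum.inr i) : ℕ) = p + i := by simp [sumEquiv]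
  rw [partialSum_eq_cumulative, partialSum_eq_cumulative, hi]
  change cumulative _ (mid _ _) = _
  rw [cumulative_mid, cumulative_simplexMap, cumulative_simplexMap]
  congr 2
  · rw [← stdSimplex.sum_eq_one z.1]
    refine Finset.sum_congr (Finset.filter_true_of_mem fun j _ => ?_) fun _ _ => rfl
    rw [Fin.val_ofNat, Nat.mod_eq_of_lt (by omega)]
    omega
  · rw [cumulative]
    congr 1
    ext j
    rw [Finset.mem_filter, Finset.mem_filter, Fin.val_ofNat, Nat.mod_eq_of_lt (by omega)]
    have : p + j.val < p + i.val + 1 ↔ j.val < i.val + 1 := by omega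
    simp [this]

/-- The midpoints of a vertex `i ≤ p` and a vertex `j ≥ p` span the part of the simplex where
exactly the first `p` of the coordinates `s_i` are forced to be at most `1/2` and the others at
least `1/2`. The shuffle chain triangulates it as a product. -/
lemma subdiv_simplexChain (n : ℕ) :
    subdiv n (simplexChain n) = ∑ a ∈ Finset.HasAntidiagonal.antidiagonal n,
      chainMap n (splitMap a.1 a.2 n) (cross n a.1 a.2 (simplexChain a.1) (simplexChain a.2)) := by
  have h1 : simplexChain n = affineChain n (vertexChain n) := by
    rw [vertexChain, affineChain_single, affineSimplex_vertices]
    rfl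
  rw [h1, subdiv_affineChain, vertexChain, sd_single, diagonalChain, map_sum, map_sum]
  refine Finset.sum_congr rfl fun a _ => ?_
  rw [shiftShuffle, TupleChain.map_map, simplexChain, simplexChain, cross_single]
  generalize shuffleChain n a.1 a.2 = c
  suffices h : affineChain n ∘ₗ TupleChain.map n (midPair (vertices n) ∘
      fun x : Fin (a.1 + 1) × Fin (a.2 + 1) => ((x.1 : ℕ), a.1 + (x.2 : ℕ))) =
      chainMap n (splitMap a.1 a.2 n) ∘ₗ
        realize (ContinuousMap.id _) (ContinuousMap.id _) n from LinearMap.congr_fun h c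
  ext1 φ
  ext1
  simp only [LinearMap.comp_apply, Finsupp.lsingle_apply, TupleChain.map_single,
    affineChain_single, realize_single, chainMap_single]
  congr 1
  ext b k
  change ∑ t, b t * ((vertices n _ k + vertices n _ k) / 2) =
    (simplexMap _ (simplexMap (Prod.fst ∘ φ) b) k + simplexMap _ (simplexMap (Prod.snd ∘ φ) b) k) / 2
  rw [← ContinuousMap.comp_apply, ← ContinuousMap.comp_apply, simplexMap_comp, simplexMap_comp,
    simplexMap_eq_affineSimplex, simplexMap_eq_affineSimplex, affineSimplex_apply,
    affineSimplex_apply, ← Finset.sum_add_distrib, Finset.sum_div]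
  refine Finset.sum_congr rfl fun t _ => ?_
  rw [mul_div_assoc', mul_add]
  rfl

lemma trans_apply_of_eq_half {X : Type*} [TopologicalSpace X] {x y z : X} (γ : Path x y)
    (δ : Path y z) {s t : unitInterval} (h : (t : ℝ) = s / 2) : γ.trans δ t = γ s := by
  have hs := s.2.2
  rw [Path.trans_apply, dif_pos (by linarith)]
  congr 1
  apply Subtype.ext
  change 2 * (t : ℝ) = s
  linarith

lemma trans_apply_of_eq_half_add {X : Type*} [TopologicalSpace X] {x y z : X} (γ : Path x y)
    (δ : Path y z) {s t : unitInterval} (h : (t : ℝ) = (1 + s) / 2) : γ.trans δ t = δ s := by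
  rw [Path.trans_apply]
  split_ifs with ht
  -- At the midpoint, where the two halves of the concatenation meet, both loops are at the common
  -- endpoint.
  · have hs := s.2.1
    have h0 : s = 0 := Subtype.ext (by change (s : ℝ) = 0; linarith)
    subst h0
    have h1 : (⟨2 * t, (unitInterval.mul_pos_mem_iff zero_lt_two).2 ⟨t.2.1, ht⟩⟩ : unitInterval) =
        1 := by
      apply Subtype.ext
      change 2 * (t : ℝ) = 1
      rw [h]
      norm_num
    rw [h1, γ.target, δ.source]
  · congr 1
    apply Subtype.ext
    change 2 * (t : ℝ) - 1 = s
    linarith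

/-! ### The coproduct formula and vanishing on powers of the augmentation ideal. -/

variable {X : Type u} [TopologicalSpace X] {x₀ : X}

/-- The map `(s_i) ↦ (γ(s_i))` from the simplex `0 ≤ s_1 ≤ ⋯ ≤ s_n ≤ 1` to `X^n`. -/
def loopSimplex (n : ℕ) (γ : Path x₀ x₀) : C(stdSimplex ℝ (Fin (n + 1)), Fin n → X) :=
  ⟨fun b i => γ (partialSum i b), by fun_prop⟩

lemma loopSimplex_mapsTo (n : ℕ) (γ : Path x₀ x₀) :
    Set.MapsTo (loopSimplex n γ) (simplexBoundary n) (discriminant x₀ (Fin n)) :=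
  fun b hb => partialSum_mem_discriminant x₀ γ γ.source γ.target b hb

/-- The class of the simplex `0 ≤ s_1 ≤ ⋯ ≤ s_n ≤ 1` mapped to `X^n` by a loop. -/
def finTriangleOfLoop (n : ℕ) (γ : Path x₀ x₀) : ConfHomology x₀ (Fin n) n :=
  homologyMap n (loopSimplex n γ) (loopSimplex_mapsTo n γ) (fundamentalClass n)

lemma finTriangleOfLoop_eq (n : ℕ) (γ γ' : Path x₀ x₀) (h : γ.Homotopic γ') :
    finTriangleOfLoop n γ = finTriangleOfLoop n γ' := by
  obtain ⟨F⟩ := h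
  refine LinearMap.congr_fun (homologyMap_eq_of_homotopy _ _ _ _ _
    ⟨fun z i => F (z.2, partialSum i z.1), by fun_prop⟩ (fun b hb t => ?_) ?_ ?_) _
  · exact partialSum_mem_discriminant x₀ (fun s => F (t, s)) (F.source t) (F.target t) b hb
  · intro b; funext i; exact F.apply_zero _
  · intro b; funext i; exact F.apply_one _

lemma simplexChain_mem_relCycles (n : ℕ) : simplexChain n ∈ relCycles (simplexBoundary n) n := by
  rcases n with _ | n
  · simp [relCycles, boundary]
  · rw [relCycles, Submodule.mem_comap, boundary, simplexChain, faceSum_single]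
    exact Submodule.sum_mem _ fun i _ => Submodule.smul_mem _ _
      (single_mem_chainsIn (A := simplexBoundary (n + 1)) (σ := face i (ContinuousMap.id _))
        (fun x => ⟨i, faceMap_apply_self i x⟩) 1)

lemma fundamentalClass_eq (n : ℕ) :
    fundamentalClass n = homologyClass ⟨simplexChain n, simplexChain_mem_relCycles n⟩ := rfl

/-- The Künneth product `H_p(X^p, D_p) ⊗ H_q(X^q, D_q) → H_n(X^n, D_n)`. -/
def finProduct (x₀ : X) {p q n : ℕ} (h : p + q = n) :
    ConfHomology x₀ (Fin p) p →ₗ[ℤ] ConfHomology x₀ (Fin q) q →ₗ[ℤ] ConfHomology x₀ (Fin n) n :=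
  (kunneth₂ x₀ (Fin p) (Fin q) n p q).compr₂ (reindex x₀ (sumEquiv h) n)

/-- Replace the fundamental class by its subdivision. On the piece indexed by `(p, q)` the first `p`
points run along `γ` and the last `q` along `δ`, each reparametrized to full speed, so the piece
maps to a Künneth product. Each piece is separately a relative cycle, so the class of the sum is the
sum of the classes. -/
lemma finTriangleOfLoop_trans (n : ℕ) (γ δ : Path x₀ x₀) :
    finTriangleOfLoop n (γ.trans δ) = ∑ a ∈ (Finset.HasAntidiagonal.antidiagonal n).attach,
      finProduct x₀ (Finset.HasAntidiagonal.mem_antidiagonal.1 a.2)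
        (finTriangleOfLoop a.1.1 γ) (finTriangleOfLoop a.1.2 δ) := by
  have hterm (a : ℕ × ℕ) (ha : a.1 + a.2 = n) :
      chainMap n (loopSimplex n (γ.trans δ)) (chainMap n (splitMap a.1 a.2 n)
        (cross n a.1 a.2 (simplexChain a.1) (simplexChain a.2))) ∈
        relCycles (discriminant x₀ (Fin n)) n ∧
      ∀ h, finProduct x₀ ha (finTriangleOfLoop a.1 γ) (finTriangleOfLoop a.2 δ) =
        homologyClass ⟨chainMap n (loopSimplex n (γ.trans δ)) (chainMap n (splitMap a.1 a.2 n)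
          (cross n a.1 a.2 (simplexChain a.1) (simplexChain a.2))), h⟩ := by
    obtain ⟨p, q⟩ := a
    let r : C((Fin p ⊕ Fin q) → X, Fin n → X) := ⟨fun f => f ∘ (sumEquiv ha).symm, by fun_prop⟩
    have hmaps : (loopSimplex n (γ.trans δ)).comp (splitMap p q n) =
        (r.comp (sumElim (Fin p) (Fin q))).comp
          ((loopSimplex p γ).prodMap (loopSimplex q δ)) := by
      ext z i
      obtain ⟨j, rfl⟩ := (sumEquiv ha).surjective i
      change γ.trans δ (partialSum _ (splitMap p q n z)) =
        Sum.elim (fun i => γ (partialSum i z.1)) (fun i => δ (partialSum i z.2))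
          ((sumEquiv ha).symm (sumEquiv ha j))
      rw [Equiv.symm_apply_apply]
      rcases j with j | j
      · exact trans_apply_of_eq_half γ δ (partialSum_splitMap_inl ha z j)
      · exact trans_apply_of_eq_half_add γ δ (partialSum_splitMap_inr ha z j)
    have hchain : chainMap n (loopSimplex n (γ.trans δ)) (chainMap n (splitMap p q n)
        (cross n p q (simplexChain p) (simplexChain q))) =
        chainMap n r (chainMap n (sumElim (Fin p) (Fin q)) (cross n p q
          (chainMap p (loopSimplex p γ) (simplexChain p))
          (chainMap q (loopSimplex q δ) (simplexChain q)))) := by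
      rw [← chainMap_comp, hmaps, chainMap_comp, chainMap_comp, chainMap_cross]
    simp only [hchain]
    refine ⟨?_, fun h => rfl⟩
    have hr : Set.MapsTo r (discriminant x₀ (Fin p ⊕ Fin q)) (discriminant x₀ (Fin n)) := by
      rintro f (⟨i, hi⟩ | hf)
      · exact Or.inl ⟨sumEquiv ha i, by simpa [r] using hi⟩
      · refine Or.inr fun h => hf ?_
        have : f = (f ∘ (sumEquiv ha).symm) ∘ sumEquiv ha := by funext i; simp
        rw [this]
        exact h.comp (sumEquiv ha).injective
    exact chainMap_mem_relCycles n r hr _ (chainMap_mem_relCycles n _ (sumElim_mapsTo x₀ _ _) _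
      (cross_mem_relCycles n p q
        (chainMap_mem_relCycles p _ (loopSimplex_mapsTo p γ) _ (simplexChain_mem_relCycles p))
        (chainMap_mem_relCycles q _ (loopSimplex_mapsTo q δ) _ (simplexChain_mem_relCycles q))))
  have hsub : homologyClass ⟨simplexChain n, simplexChain_mem_relCycles n⟩ =
      homologyClass ⟨subdiv n (simplexChain n),
        subdiv_mem_relCycles (simplexChain_mem_relCycles n)⟩ :=
    (homologyClass_eq_iff _ _).2 (sub_subdiv_mem (simplexChain_mem_relCycles n))
  rw [finTriangleOfLoop, fundamentalClass_eq, hsub, homologyMap_homologyClass]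
  have hsum : ∀ a ∈ (Finset.HasAntidiagonal.antidiagonal n).attach,
      finProduct x₀ (Finset.HasAntidiagonal.mem_antidiagonal.1 a.2)
        (finTriangleOfLoop a.1.1 γ) (finTriangleOfLoop a.1.2 δ) = homologyClass
        ⟨chainMap n (loopSimplex n (γ.trans δ)) (chainMap n (splitMap a.1.1 a.1.2 n)
          (cross n a.1.1 a.1.2 (simplexChain a.1.1) (simplexChain a.1.2))),
          (hterm a.1 (Finset.HasAntidiagonal.mem_antidiagonal.1 a.2)).1⟩ := fun a _ =>
    (hterm a.1 (Finset.HasAntidiagonal.mem_antidiagonal.1 a.2)).2 _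
  rw [Finset.sum_congr rfl hsum, ← map_sum]
  congr 1
  apply Subtype.ext
  rw [Submodule.coe_sum]
  simp only
  rw [subdiv_simplexChain, map_sum]
  exact (Finset.sum_attach _ fun a : ℕ × ℕ => chainMap n (loopSimplex n (γ.trans δ))
    (chainMap n (splitMap a.1 a.2 n)
      (cross n a.1 a.2 (simplexChain a.1) (simplexChain a.2)))).symm

/-- The element `Δⁿ(γ)` for a class `γ` of loops. -/
def finTriangle (x₀ : X) (n : ℕ) (γ : FundamentalGroup X x₀) : ConfHomology x₀ (Fin n) n :=
  Quotient.lift (finTriangleOfLoop n) (finTriangleOfLoop_eq n) γ.toPath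

/-- The factors appear in reverse order because the product in `FundamentalGroup` traverses its
right factor first. -/
lemma finTriangle_mul (n : ℕ) (γ δ : FundamentalGroup X x₀) :
    finTriangle x₀ n (γ * δ) = ∑ a ∈ (Finset.HasAntidiagonal.antidiagonal n).attach,
      finProduct x₀ (Finset.HasAntidiagonal.mem_antidiagonal.1 a.2)
        (finTriangle x₀ a.1.1 δ) (finTriangle x₀ a.1.2 γ) := by
  obtain ⟨γ, rfl⟩ := Path.Homotopic.Quotient.mk_surjective γ
  obtain ⟨δ, rfl⟩ := Path.Homotopic.Quotient.mk_surjective δ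
  exact finTriangleOfLoop_trans n δ γ

/-- The linear extension of `Δⁿ` to the group ring. -/
def finTriangleLinear (x₀ : X) (n : ℕ) :
    MonoidAlgebra ℤ (FundamentalGroup X x₀) →ₗ[ℤ] ConfHomology x₀ (Fin n) n :=
  Finsupp.linearCombination ℤ (finTriangle x₀ n) ∘ₗ
    (MonoidAlgebra.coeffLinearEquiv ℤ).toLinearMap

lemma finTriangleLinear_of (n : ℕ) (γ : FundamentalGroup X x₀) :
    finTriangleLinear x₀ n (MonoidAlgebra.of ℤ _ γ) = finTriangle x₀ n γ := by
  simp [finTriangleLinear]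

lemma triangleLinear_of (N : Type v) [Fintype N] [LinearOrder N] (γ : FundamentalGroup X x₀) :
    triangleLinear x₀ N (MonoidAlgebra.of ℤ _ γ) = triangle x₀ N γ := by
  simp [triangleLinear]

lemma groupRing_hom_ext {G M : Type*} [Group G] [AddCommGroup M]
    {f g : MonoidAlgebra ℤ G →ₗ[ℤ] M}
    (h : ∀ x, f (MonoidAlgebra.of ℤ G x) = g (MonoidAlgebra.of ℤ G x)) : f = g := by
  refine LinearMap.ext fun a => ?_
  induction a using MonoidAlgebra.induction_on with
  | of x => exact h x
  | add a b ha hb => rw [map_add, map_add, ha, hb]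
  | smul r a ha => rw [map_smul, map_smul, ha]

lemma finTriangleLinear_mul (n : ℕ) (a b : MonoidAlgebra ℤ (FundamentalGroup X x₀)) :
    finTriangleLinear x₀ n (a * b) = ∑ k ∈ (Finset.HasAntidiagonal.antidiagonal n).attach,
      finProduct x₀ (Finset.HasAntidiagonal.mem_antidiagonal.1 k.2)
        (finTriangleLinear x₀ k.1.1 b) (finTriangleLinear x₀ k.1.2 a) := by
  suffices h : (LinearMap.mul ℤ (MonoidAlgebra ℤ (FundamentalGroup X x₀))).compr₂
      (finTriangleLinear x₀ n) = ∑ k ∈ (Finset.HasAntidiagonal.antidiagonal n).attach,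
      ((finProduct x₀ (Finset.HasAntidiagonal.mem_antidiagonal.1 k.2)).compl₁₂
        (finTriangleLinear x₀ k.1.1) (finTriangleLinear x₀ k.1.2)).flip by
    have := LinearMap.congr_fun (LinearMap.congr_fun h a) b
    simpa [LinearMap.sum_apply] using this
  refine groupRing_hom_ext fun γ => groupRing_hom_ext fun δ => ?_
  have h1 : (MonoidAlgebra.of ℤ (FundamentalGroup X x₀) γ * MonoidAlgebra.of ℤ _ δ) =
    MonoidAlgebra.of ℤ _ (γ * δ) := (map_mul _ _ _).symm
  simp only [LinearMap.compr₂_apply, LinearMap.mul_apply', h1, LinearMap.sum_apply,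
    LinearMap.flip_apply, LinearMap.compl₁₂_apply, finTriangleLinear_of]
  exact finTriangle_mul n γ δ

lemma finTriangle_zero (γ : FundamentalGroup X x₀) : finTriangle x₀ 0 γ = finTriangle x₀ 0 1 := by
  obtain ⟨γ, rfl⟩ := Path.Homotopic.Quotient.mk_surjective γ
  change finTriangleOfLoop 0 γ = finTriangleOfLoop 0 (Path.refl x₀)
  have : loopSimplex 0 γ = loopSimplex 0 (Path.refl x₀) := by
    ext b i
    exact i.elim0
  simp only [finTriangleOfLoop, this]

/-- The space `X^0` is a point, so all loops have the same class in degree zero and the linear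
extension factors through the augmentation. -/
lemma finTriangleLinear_zero (a : MonoidAlgebra ℤ (FundamentalGroup X x₀)) (ha : a ∈ augIdeal _) :
    finTriangleLinear x₀ 0 a = 0 := by
  have h : finTriangleLinear x₀ 0 =
      (LinearMap.toSpanSingleton ℤ _ (finTriangle x₀ 0 1)) ∘ₗ
        (augmentation (FundamentalGroup X x₀)).toLinearMap := by
    refine groupRing_hom_ext fun γ => ?_
    rw [finTriangleLinear_of, finTriangle_zero]
    simp [augmentation]
  rw [h, LinearMap.comp_apply]
  have : (augmentation (FundamentalGroup X x₀)).toLinearMap a = 0 := ha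
  rw [this, map_zero]

/-- In each term of the coproduct of `a * b` with `a ∈ I^k` and `b ∈ I`, either the degree on `b` is
zero and `b` dies by augmentation, or the degree on `a` is less than `n`, hence less than `k`, and
the induction applies. -/
lemma augIdeal_pow_le_ker (n k : ℕ) (h : n < k) :
    augIdeal (FundamentalGroup X x₀) ^ k ≤ LinearMap.ker (finTriangleLinear x₀ n) := by
  induction k generalizing n with
  | zero => omega
  | succ k ih =>
    rw [pow_succ, Submodule.mul_le]
    intro a ha b hb
    rw [LinearMap.mem_ker, finTriangleLinear_mul]
    refine Finset.sum_eq_zero fun l _ => ?_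
    have hl := Finset.HasAntidiagonal.mem_antidiagonal.1 l.2
    rcases Nat.eq_zero_or_pos l.1.1 with h0 | h0
    · have hb0 : finTriangleLinear x₀ l.1.1 b = 0 := by
        rw [h0]
        exact finTriangleLinear_zero b hb
      rw [hb0, map_zero, LinearMap.zero_apply]
    · have ha0 : finTriangleLinear x₀ l.1.2 a = 0 := ih l.1.2 (by omega) ha
      rw [ha0, map_zero]

lemma triangle_eq_reindex (N : Type v) [Fintype N] [LinearOrder N] (γ : FundamentalGroup X x₀) :
    triangle x₀ N γ = reindex x₀ (monoEquivOfFin N rfl).toEquiv (Fintype.card N)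
      (finTriangle x₀ (Fintype.card N) γ) := by
  obtain ⟨γ, rfl⟩ := Path.Homotopic.Quotient.mk_surjective γ
  change triangleOfLoop N γ = reindex x₀ _ _ (finTriangleOfLoop _ γ)
  exact homologyMap_comp _ ⟨fun f => f ∘ (monoEquivOfFin N rfl).toEquiv.symm, by fun_prop⟩
    (loopSimplex _ γ) _ (loopSimplex_mapsTo _ γ) (fundamentalClass _)

variable (x₀) in
/-- For every totally ordered finite set `S`, the map `Δ^S` vanishes on `I^{|S|+1}`. -/
theorem triangleVanishes : TriangleVanishes.{u, v} x₀ := by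
  intro S _ _ a ha
  have h : triangleLinear x₀ S = reindex x₀ (monoEquivOfFin S rfl).toEquiv (Fintype.card S) ∘ₗ
      finTriangleLinear x₀ (Fintype.card S) := by
    refine groupRing_hom_ext fun γ => ?_
    rw [triangleLinear_of, triangle_eq_reindex, LinearMap.comp_apply, finTriangleLinear_of]
  have h0 : finTriangleLinear x₀ (Fintype.card S) a = 0 :=
    augIdeal_pow_le_ker _ _ (Nat.lt_succ_self _) ha
  rw [LinearMap.mem_ker, h, LinearMap.comp_apply, h0, map_zero]

end Concatenation

end ConfSpace

end


noncomputable section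

namespace ConfSpace

/-! Products of simplices labelled by loops -/

section LoopCells

variable {X : Type u} [TopologicalSpace X] {x₀ : X}

lemma homologyClass_eq_zero_iff {A : Set X} {n : ℕ} (z : relCycles A n) :
    homologyClass z = 0 ↔ (z : SingChain n X) ∈ relBoundaries A n := by
  have := homologyClass_eq_iff z 0
  rwa [map_zero, ZeroMemClass.coe_zero, sub_zero] at this

/-- The product of the simplices `0 ≤ s_1 ≤ ⋯ ≤ s_n ≤ 1` labelled by finite sets. -/
abbrev SimplexProd {r : ℕ} (N : Fin r → Type v) [∀ i, Fintype (N i)] : Type :=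
  ∀ i, stdSimplex ℝ (Fin (Fintype.card (N i) + 1))

/-- The boundary of a product of simplices. -/
def simplexProdBoundary {r : ℕ} (N : Fin r → Type v) [∀ i, Fintype (N i)] :
    Set (SimplexProd N) := {x | ∃ i, x i ∈ simplexBoundary _}

/-- Splitting off the first factor. -/
def simplexProdSucc {r : ℕ} (N : Fin (r + 1) → Type v) [∀ i, Fintype (N i)] :
    SimplexProd N ≃ₜ stdSimplex ℝ (Fin (Fintype.card (N 0) + 1)) ×
      SimplexProd fun i : Fin r => N i.succ where
  toFun x := (x 0, fun i => x i.succ)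
  invFun z := Fin.cons z.1 z.2
  left_inv x := by
    funext i
    refine Fin.cases ?_ (fun j => ?_) i <;> simp
  right_inv z := by simp
  continuous_toFun := by fun_prop
  continuous_invFun := continuous_pi fun i => by
    refine Fin.cases ?_ (fun j => ?_) i
    · simpa using continuous_fst
    · simp only [Fin.cons_succ]
      exact (continuous_apply j).comp continuous_snd

lemma mem_simplexProdBoundary_succ {r : ℕ} (N : Fin (r + 1) → Type v) [∀ i, Fintype (N i)]
    (x : SimplexProd N) : x ∈ simplexProdBoundary N ↔ simplexProdSucc N x ∈
      pairProd (simplexBoundary _) (simplexProdBoundary fun i : Fin r => N i.succ) :=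
  Fin.exists_fin_succ

/-- The radial structure of a product of simplices. -/
def simplexProdCollar : {r : ℕ} → (N : Fin r → Type v) → [∀ i, Fintype (N i)] →
    Collar (simplexProdBoundary N)
  | 0, N, _ => Collar.empty.ofHomeomorph (Homeomorph.refl _) fun x => by
      simp [simplexProdBoundary]
  | _ + 1, N, _ => ((simplexCollar _).prod (simplexProdCollar fun i => N i.succ)).ofHomeomorph
      (simplexProdSucc N) (mem_simplexProdBoundary_succ N)

variable {r : ℕ} (N : Fin r → Type v) [∀ i, Fintype (N i)] [∀ i, LinearOrder (N i)]

/-- The map from a product of simplices to `X^N`, `N = N_1 ⊔ ⋯ ⊔ N_r`, given by loops. -/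
def loopCell (γ : Fin r → Path x₀ x₀) : C(SimplexProd N, (Σ i, N i) → X) :=
  ⟨fun x j => γ j.1 (orderCoord (N j.1) j.2 (x j.1)), by fun_prop⟩

lemma loopCell_mapsTo (γ : Fin r → Path x₀ x₀) :
    Set.MapsTo (loopCell N γ) (simplexProdBoundary N) (discriminant x₀ (Σ i, N i)) := by
  rintro x ⟨i, hi⟩
  rcases orderCoord_mem_discriminant x₀ (N i) (γ i) (γ i).source (γ i).target _ hi with ⟨j, h⟩ | h
  · exact Or.inl ⟨⟨i, j⟩, h⟩
  · exact Or.inr fun H => h (H.comp sigma_mk_injective)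

lemma simplexOfLoop_mapsTo (M : Type v) [Fintype M] [LinearOrder M] (γ : Path x₀ x₀) :
    Set.MapsTo (simplexOfLoop M γ) (simplexBoundary (Fintype.card M)) (discriminant x₀ M) :=
  fun b hb => orderCoord_mem_discriminant x₀ M γ γ.source γ.target b hb

/-- The homology of a product of simplices in the top degree is sent by loops to multiples of the
Künneth product of the classes of the loops. -/
lemma homologyMap_loopCell_mem_span (γ : Fin r → Path x₀ x₀) (n : ℕ)
    (hn : n = ∑ i, Fintype.card (N i)) (z : RelHomology (simplexProdBoundary N) n) :
    homologyMap n (loopCell N γ) (loopCell_mapsTo N γ) z ∈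
      Submodule.span ℤ {kunneth x₀ r N (fun i => Fintype.card (N i)) n
        fun i => triangleOfLoop (N i) (γ i)} := by
  induction r generalizing n with
  | zero =>
    obtain rfl : n = 0 := by simpa using hn
    obtain ⟨c, rfl⟩ := Submodule.mkQ_surjective _ z
    rw [Submodule.mem_span_singleton]
    -- The empty product is a point, so a 0-chain is a multiple of its only singular simplex.
    refine ⟨(c : SingChain 0 (SimplexProd N)) (ContinuousMap.const _ default), ?_⟩
    change _ • homologyClass _ = homologyClass _
    rw [← map_smul]
    refine congrArg homologyClass (Subtype.ext ?_)
    change _ • Finsupp.single _ 1 = chainMap 0 (loopCell N γ) c.1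
    have h : c.1 = Finsupp.single (ContinuousMap.const _ default)
        (c.1 (ContinuousMap.const _ default)) := by
      ext σ
      rw [Subsingleton.elim σ (ContinuousMap.const _ default)]
      simp
    rw [h, chainMap_single, Finsupp.single_eq_same, Finsupp.smul_single, smul_eq_mul, mul_one]
    congr 1
    ext x i
    exact isEmptyElim i
  | succ r ih =>
    obtain ⟨c, rfl⟩ := Submodule.mkQ_surjective _ z
    set N' : Fin r → Type v := fun i => N i.succ
    set γ' : Fin r → Path x₀ x₀ := fun i => γ i.succ
    set k := ∑ i, Fintype.card (N' i)
    let e : C(SimplexProd N, _) := ⟨simplexProdSucc N, (simplexProdSucc N).continuous⟩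
    have he : Set.MapsTo e (simplexProdBoundary N)
        (pairProd (simplexBoundary _) (simplexProdBoundary N')) :=
      fun x hx => (mem_simplexProdBoundary_succ N x).1 hx
    let s : C((N 0 ⊕ Σ i, N' i) → X, (Σ i, N i) → X) :=
      ⟨fun f => f ∘ (sigmaSuccEquiv N).symm, by fun_prop⟩
    let g : C(stdSimplex ℝ (Fin (Fintype.card (N 0) + 1)) × SimplexProd N', (Σ i, N i) → X) :=
      (s.comp (sumElim _ _)).comp ((simplexOfLoop (N 0) (γ 0)).prodMap (loopCell N' γ'))
    have hg : g.comp e = loopCell N γ := by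
      ext x ⟨i, j⟩
      refine Fin.cases (motive := fun i => ∀ j : N i, g (e x) ⟨i, j⟩ = loopCell N γ x ⟨i, j⟩)
        (fun j => rfl) (fun i j => rfl) i j
    have hgm : Set.MapsTo g (pairProd (simplexBoundary _) (simplexProdBoundary N'))
        (discriminant x₀ (Σ i, N i)) := by
      intro x hx
      obtain ⟨x, rfl⟩ := (simplexProdSucc N).surjective x
      have := loopCell_mapsTo N γ ((mem_simplexProdBoundary_succ N x).2 hx)
      rwa [← hg] at this
    -- Up to a relative boundary, the cycle is the fundamental class of the first simplex times a
    -- cycle `y` on the remaining ones, to which the induction applies when its degree is the top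
    -- one.
    obtain ⟨q, y, hy, hcy⟩ := exists_cross_sub_mem (simplexProdCollar N') _
      (chainMap_mem_relCycles n e he c.1 c.2)
    have hclass (h) : homologyMap n (loopCell N γ) (loopCell_mapsTo N γ) (Submodule.mkQ _ c) =
        homologyClass ⟨chainMap n g (cross n _ q (simplexChain _) y), h⟩ := by
      refine (homologyClass_eq_iff _ _).2 ?_
      change chainMap n (loopCell N γ) c.1 - _ ∈ _
      simp only
      rw [← hg, chainMap_comp, ← map_sub]
      exact chainMap_mem_relBoundaries n g hgm _ hcy
    rw [hclass (chainMap_mem_relCycles n g hgm _ (cross_mem_relCycles n _ q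
      (simplexChain_mem_relCycles _) hy))]
    by_cases hq : q = k
    · subst hq
      obtain ⟨a, ha⟩ := Submodule.mem_span_singleton.1 (ih N' γ' k rfl (homologyClass ⟨y, hy⟩))
      refine Submodule.mem_span_singleton.2 ⟨a, ?_⟩
      have h1 : kunneth x₀ (r + 1) N (fun i => Fintype.card (N i)) n
          (fun i => triangleOfLoop (N i) (γ i)) = reindex x₀ (sigmaSuccEquiv N) n
          (kunneth₂ x₀ (N 0) (Σ i, N' i) n _ k (triangleOfLoop (N 0) (γ 0))
            (kunneth x₀ r N' (fun i => Fintype.card (N' i)) k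
              fun i => triangleOfLoop (N' i) (γ' i))) := rfl
      rw [h1, ← map_smul, ← map_smul, ha]
      refine congrArg homologyClass (Subtype.ext ?_)
      change chainMap n s (chainMap n (sumElim _ _) (cross n _ k
        (chainMap _ (simplexOfLoop (N 0) (γ 0)) (simplexChain _))
        (chainMap k (loopCell N' γ') y))) = chainMap n g _
      rw [← chainMap_cross, ← chainMap_comp, ← chainMap_comp]
    -- For any other degree of `y` the cross product is zero by its degree.
    · have h0 : cross n (Fintype.card (N 0)) q (simplexChain (Fintype.card (N 0))) y = 0 := by
        refine cross_eq_zero ?_ _ _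
        rw [hn, Fin.sum_univ_succ]
        intro h
        exact hq (Nat.add_left_cancel h).symm
      rw [(homologyClass_eq_zero_iff _).2 (by simp only [h0, map_zero]; exact Submodule.zero_mem _)]
      exact Submodule.zero_mem _

end LoopCells

end ConfSpace

end


noncomputable section

namespace ConfSpace

/-! The classes of tensors of loops -/

section Tensors

variable {X : Type u} [TopologicalSpace X] {x₀ : X}

/-- All points are at the base point and there is at least one, so the simplex lies in the
discriminant. -/
lemma triangleOfLoop_refl (N : Type v) [Fintype N] [LinearOrder N] [Nonempty N] :
    triangleOfLoop N (Path.refl x₀) = 0 := by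
  refine (homologyClass_eq_zero_iff _).2 (chainsIn_le_relBoundaries _ _ ?_)
  exact chainMap_mem (A := Set.univ) (B := discriminant x₀ N) _ (simplexOfLoop N (Path.refl x₀))
    (fun _ _ => Or.inl ⟨Classical.arbitrary N, rfl⟩) (mem_chainsIn_univ _)

/-- Since the constant loop contributes zero, subtracting `1` in the group ring does not change the
class. This matches the generators with geometric simplices. -/
lemma truncTriangle_truncSubOne (hv : TriangleVanishes.{u, v} x₀) (N : Type v) [Fintype N]
    [LinearOrder N] [Nonempty N] (γ : Path x₀ x₀) :
    truncTriangle hv N (truncSubOne (Fintype.card N)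
      (FundamentalGroup.fromPath (Path.Homotopic.Quotient.mk γ))) = triangleOfLoop N γ := by
  have h1 (g : FundamentalGroup X x₀) : truncTriangle hv N (truncSubOne (Fintype.card N) g) =
      triangle x₀ N g - triangle x₀ N 1 := by
    rw [truncTriangle, truncSubOne, ← triangleLinear_of, ← triangleLinear_of, ← map_sub, map_one]
    exact Submodule.liftQ_apply _ _ _
  have h2 : triangle x₀ N 1 = triangleOfLoop N (Path.refl x₀) := rfl
  rw [h1, h2, triangleOfLoop_refl, sub_zero]
  rfl

namespace OrderedPartition

variable {N : Type v} (P : OrderedPartition N)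

instance (i : Fin P.r) : Nonempty (P.Part i) :=
  let ⟨x, hx⟩ := P.surjective i
  ⟨⟨x, hx⟩⟩

lemma sum_card [Fintype N] : Fintype.card N = ∑ i, Fintype.card (P.Part i) := by
  rw [← Fintype.card_sigma, Fintype.card_congr P.equiv]

/-- The map from a product of simplices to `X^N` given by a loop for each part. -/
def cellMap [Fintype N] (γ : Fin P.r → Path x₀ x₀) : C(SimplexProd P.Part, N → X) :=
  (⟨fun f => f ∘ P.equiv.symm, by fun_prop⟩ : C((Σ i, P.Part i) → X, N → X)).comp
    (loopCell P.Part γ)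

lemma cellMap_apply [Fintype N] (γ : Fin P.r → Path x₀ x₀) (x : SimplexProd P.Part) (j : N) :
    P.cellMap γ x j =
      γ (P.part j) (orderCoord (P.Part (P.part j)) ⟨j, rfl⟩ (x (P.part j))) := rfl

lemma cellMap_mapsTo [Fintype N] (γ : Fin P.r → Path x₀ x₀) :
    Set.MapsTo (P.cellMap γ) (simplexProdBoundary P.Part) (discriminant x₀ N) := by
  intro x hx
  have heq (i) : P.cellMap γ x (P.equiv i) = loopCell P.Part γ x i :=
    congrArg (loopCell P.Part γ x) (P.equiv.symm_apply_apply i)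
  rcases loopCell_mapsTo P.Part γ hx with ⟨i, hi⟩ | hm
  · exact Or.inl ⟨P.equiv i, (heq i).trans hi⟩
  · refine Or.inr fun h => hm ?_
    rw [← funext heq]
    exact h.comp P.equiv.injective

lemma cellMap_mem_span [Fintype N] (hv : TriangleVanishes.{u, v} x₀) (γ : Fin P.r → Path x₀ x₀)
    (z : RelHomology (simplexProdBoundary P.Part) (Fintype.card N))
    (h : Set.MapsTo (P.cellMap γ) (simplexProdBoundary P.Part) (discriminant x₀ N)) :
    homologyMap (Fintype.card N) (P.cellMap γ) h z ∈ Submodule.span ℤ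
      {tensorTriangle hv P (PiTensorProduct.tprod ℤ fun i =>
        truncSubOne (Fintype.card (P.Part i))
          (FundamentalGroup.fromPath (Path.Homotopic.Quotient.mk (γ i))))} := by
  have h1 : tensorTriangle hv P (PiTensorProduct.tprod ℤ fun i =>
        truncSubOne (Fintype.card (P.Part i))
          (FundamentalGroup.fromPath (Path.Homotopic.Quotient.mk (γ i)))) =
      reindex x₀ P.equiv (Fintype.card N) (kunneth x₀ P.r P.Part
        (fun i => Fintype.card (P.Part i)) (Fintype.card N)
        fun i => triangleOfLoop (P.Part i) (γ i)) := by
    rw [tensorTriangle, LinearMap.comp_apply, PiTensorProduct.lift.tprod,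
      MultilinearMap.compLinearMap_apply]
    simp only [truncTriangle_truncSubOne]
  have h2 : homologyMap (Fintype.card N) (P.cellMap γ) h z = reindex x₀ P.equiv (Fintype.card N)
      (homologyMap (Fintype.card N) (loopCell P.Part γ) (loopCell_mapsTo P.Part γ) z) :=
    homologyMap_comp _ _ _ _ _ _
  obtain ⟨a, ha⟩ := Submodule.mem_span_singleton.1
    (homologyMap_loopCell_mem_span P.Part γ _ P.sum_card z)
  rw [h1, h2, ← ha, map_smul]
  exact Submodule.smul_mem _ _ (Submodule.mem_span_singleton_self _)

end OrderedPartition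

end Tensors

/-! Monotone sequences and barycentric coordinates -/

section Monotone

lemma cumulative_eq_partialSum {n : ℕ} (i : Fin n) (b : stdSimplex ℝ (Fin (n + 1))) :
    cumulative (i.val + 1) b = partialSum i b := (partialSum_eq_cumulative i b).symm

/-- The increasing sequence `0 ≤ s_1 ≤ ⋯ ≤ s_n ≤ 1` extended by `0` and `1`. -/
def extendSeq {n : ℕ} (s : Fin n → ℝ) (k : ℕ) : ℝ :=
  if k = 0 then 0 else if h : k - 1 < n then s ⟨k - 1, h⟩ else 1

lemma extendSeq_zero {n : ℕ} (s : Fin n → ℝ) : extendSeq s 0 = 0 := if_pos rfl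

lemma extendSeq_succ {n : ℕ} (s : Fin n → ℝ) (i : Fin n) : extendSeq s (i.val + 1) = s i := by
  simp [extendSeq]

lemma extendSeq_last {n : ℕ} (s : Fin n → ℝ) : extendSeq s (n + 1) = 1 := by
  simp [extendSeq]

lemma extendSeq_le {n : ℕ} {s : Fin n → ℝ} (h0 : ∀ i, 0 ≤ s i) (h1 : ∀ i, s i ≤ 1)
    (hs : Monotone s) (k : ℕ) (hk : k ≤ n) : extendSeq s k ≤ extendSeq s (k + 1) := by
  rcases k with _ | k
  · rw [extendSeq_zero, extendSeq]
    simp only [zero_add, one_ne_zero, if_false]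
    split_ifs with h
    · exact h0 _
    · exact zero_le_one
  · rw [show k + 1 = (⟨k, hk⟩ : Fin n).val + 1 from rfl, extendSeq_succ, extendSeq]
    rw [if_neg (Nat.succ_ne_zero _)]
    split_ifs with h
    · exact hs (Fin.mk_le_mk.2 (by simp))
    · exact h1 _

lemma cumulative_eq_extendSeq {n : ℕ} (b : stdSimplex ℝ (Fin (n + 1))) (k : ℕ) (hk : k ≤ n + 1) :
    cumulative k b = extendSeq (fun i => (partialSum i b : ℝ)) k := by
  rcases k with _ | k
  · simp [extendSeq_zero, cumulative]
  · rcases Nat.lt_or_ge k n with h | h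
    · rw [show k + 1 = (⟨k, h⟩ : Fin n).val + 1 from rfl, extendSeq_succ,
        cumulative_eq_partialSum]
    · obtain rfl : k = n := by omega
      rw [extendSeq_last, cumulative, Finset.filter_true_of_mem fun i _ => i.2,
        stdSimplex.sum_eq_one]

/-- Barycentric coordinates are the gaps of the sequence `0 ≤ s_1 ≤ ⋯ ≤ s_n ≤ 1`. This translates
between the two descriptions of the simplex. -/
lemma apply_eq_extendSeq_sub {n : ℕ} (b : stdSimplex ℝ (Fin (n + 1))) (k : Fin (n + 1)) :
    b k = extendSeq (fun i => (partialSum i b : ℝ)) (k.val + 1) -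
      extendSeq (fun i => (partialSum i b : ℝ)) k.val := by
  rw [← cumulative_eq_extendSeq b _ (by omega), ← cumulative_eq_extendSeq b _ (by omega),
    cumulative_succ]
  ring

lemma partialSum_injective {n : ℕ} {b b' : stdSimplex ℝ (Fin (n + 1))}
    (h : ∀ i : Fin n, partialSum i b = partialSum i b') : b = b' := by
  ext k
  rw [apply_eq_extendSeq_sub b, apply_eq_extendSeq_sub b']
  simp only [h]

lemma exists_partialSum_eq {n : ℕ} (s : Fin n → unitInterval) (hs : Monotone s) :
    ∃ b : stdSimplex ℝ (Fin (n + 1)), ∀ i, partialSum i b = s i := by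
  set s' : Fin n → ℝ := fun i => s i
  have hle := extendSeq_le (s := s') (fun i => (s i).2.1) (fun i => (s i).2.2) fun i j h => hs h
  have hsum (m : ℕ) : ∑ j ∈ Finset.range m, (extendSeq s' (j + 1) - extendSeq s' j) =
      extendSeq s' m := by rw [Finset.sum_range_sub, extendSeq_zero, sub_zero]
  refine ⟨⟨fun k => extendSeq s' (k.val + 1) - extendSeq s' k.val, fun k => ?_, ?_⟩, fun i => ?_⟩
  · exact sub_nonneg.2 (hle _ (by omega))
  · rw [Fin.sum_univ_eq_sum_range fun k => extendSeq s' (k + 1) - extendSeq s' k, hsum,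
      extendSeq_last]
  · apply Subtype.ext
    rw [partialSum_eq_cumulative, cumulative]
    change ∑ j : Fin (n + 1) with j.val < i.val + 1,
      (extendSeq s' (j.val + 1) - extendSeq s' j.val) = s' i
    rw [← extendSeq_succ s' i, ← hsum (i.val + 1), Finset.sum_filter,
      Fin.sum_univ_eq_sum_range fun k => if k < i.val + 1 then
        extendSeq s' (k + 1) - extendSeq s' k else 0, ← Finset.sum_filter]
    congr 1
    ext k
    simp only [Finset.mem_filter, Finset.mem_range]
    omega

lemma partialSum_mono {n : ℕ} (b : stdSimplex ℝ (Fin (n + 1))) :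
    Monotone fun i : Fin n => partialSum i b := by
  intro i j hij
  change (partialSum i b : ℝ) ≤ partialSum j b
  rw [partialSum_eq_cumulative, partialSum_eq_cumulative, cumulative, cumulative]
  refine Finset.sum_le_sum_of_subset_of_nonneg (fun k hk => ?_) fun k _ _ => stdSimplex.zero_le b k
  rw [Finset.mem_filter] at hk ⊢
  have : i.val ≤ j.val := hij
  exact ⟨hk.1, by omega⟩

lemma cumulative_lt {n : ℕ} {b : stdSimplex ℝ (Fin (n + 1))} (hp : ∀ k, 0 < b k) {i j : ℕ}
    (hij : i < j) (hj : j ≤ n + 1) : cumulative i b < cumulative j b := by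
  refine Finset.sum_lt_sum_of_subset (i := ⟨i, by omega⟩) (fun k hk => ?_) (by simpa) (by simp)
    (hp _) fun k _ _ => (hp k).le
  rw [Finset.mem_filter] at hk ⊢
  exact ⟨hk.1, by omega⟩

/-- All gaps are positive exactly when the sequence is strictly increasing inside the open interval;
the first and last gaps account for the bounds `0` and `1`. -/
lemma notMem_simplexBoundary_iff {n : ℕ} (b : stdSimplex ℝ (Fin (n + 1))) :
    b ∉ simplexBoundary n ↔ StrictMono (fun i : Fin n => partialSum i b) ∧
      ∀ i : Fin n, 0 < (partialSum i b : ℝ) ∧ (partialSum i b : ℝ) < 1 := by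
  constructor
  · intro h
    have hp (k : Fin (n + 1)) : 0 < b k :=
      (stdSimplex.zero_le b k).lt_of_ne fun hk => h ⟨k, hk.symm⟩
    refine ⟨fun i j hij => ?_, fun i => ⟨?_, ?_⟩⟩
    · change (partialSum i b : ℝ) < partialSum j b
      rw [partialSum_eq_cumulative, partialSum_eq_cumulative]
      exact cumulative_lt hp (Nat.succ_lt_succ hij) (by omega)
    · have := cumulative_lt hp (Nat.succ_pos i.val) (by omega)
      rw [cumulative_eq_extendSeq b 0 (by omega), extendSeq_zero] at this
      rwa [partialSum_eq_cumulative]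
    · have := cumulative_lt hp (Nat.succ_lt_succ i.2) le_rfl
      rw [cumulative_eq_extendSeq b (n + 1) le_rfl, extendSeq_last] at this
      rwa [partialSum_eq_cumulative]
  · rintro ⟨h1, h2⟩ ⟨⟨k, hkn⟩, hk⟩
    rw [apply_eq_extendSeq_sub, sub_eq_zero] at hk
    revert hk
    refine (?_ : _ < _).ne'
    have hnext (k : ℕ) (hk : k ≤ n) (a : ℝ) (ha : a < 1)
        (ha' : ∀ h : k < n, a < partialSum ⟨k, h⟩ b) :
        a < extendSeq (fun i => (partialSum i b : ℝ)) (k + 1) := by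
      rcases Nat.lt_or_ge k n with h | h
      · rw [show k + 1 = (⟨k, h⟩ : Fin n).val + 1 from rfl, extendSeq_succ]
        exact ha' h
      · obtain rfl : k = n := by omega
        rwa [extendSeq_last]
    rcases k with _ | k
    · exact hnext 0 (by omega) _ (by rw [extendSeq_zero]; exact zero_lt_one)
        fun h => by rw [extendSeq_zero]; exact (h2 _).1
    · have hk : k < n := by omega
      simp only
      rw [show extendSeq (fun i => (partialSum i b : ℝ)) (k + 1) = partialSum ⟨k, hk⟩ b from
        extendSeq_succ _ (⟨k, hk⟩ : Fin n)]
      exact hnext (k + 1) (by omega) _ (h2 _).2 fun h => h1 (Fin.mk_lt_mk.2 (Nat.lt_succ_self k))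

end Monotone

end ConfSpace

end


noncomputable section

namespace ConfSpace

/-! Convex bodies -/

section Convex

variable {L : Type u} [NormedAddCommGroup L] [NormedSpace ℝ L]

lemma exists_pos_add_smul_mem {P : Set L} {x : L} (hx : x ∈ interior P) (v : L) :
    ∃ ε : ℝ, 0 < ε ∧ x + ε • v ∈ P := by
  have hc : Continuous fun ε : ℝ => x + ε • v := by fun_prop
  have h : ∀ᶠ ε in nhds (0 : ℝ), x + ε • v ∈ interior P :=
    hc.continuousAt.eventually_mem (isOpen_interior.mem_nhds (by simpa using hx))
  obtain ⟨ε, h1, h2⟩ := ((h.filter_mono nhdsWithin_le_nhds).and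
    (self_mem_nhdsWithin : Set.Ioi (0 : ℝ) ∈ nhdsWithin 0 (Set.Ioi 0))).exists
  exact ⟨ε, h2, interior_subset h1⟩

/-- If some `l j` vanished at an interior point `x`, then moving slightly beyond `x` on the ray from
`y` would make it negative. The hypothesis `hl` is the affineness needed on this ray. -/
lemma interior_setOf_nonneg {J : Type*} [Finite J] (l : J → L → ℝ) (hc : ∀ j, Continuous (l j))
    {y : L} (hy : ∀ j, 0 < l j y)
    (hl : ∀ j x (ε : ℝ), l j (x + ε • (x - y)) = l j x + ε * (l j x - l j y)) :
    interior {x | ∀ j, 0 ≤ l j x} = {x | ∀ j, 0 < l j x} := by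
  apply Set.Subset.antisymm
  · intro x hx j
    refine (interior_subset hx j).lt_of_ne fun h => ?_
    obtain ⟨ε, hε, hm⟩ := exists_pos_add_smul_mem hx (x - y)
    have := hm j
    rw [hl, ← h, zero_add, zero_sub] at this
    nlinarith [mul_pos hε (hy j)]
  · refine interior_maximal (fun x hx j => (hx j).le) ?_
    rw [Set.ofPred_forall]
    exact isOpen_iInter_of_finite fun j => isOpen_lt continuous_const (hc j)

/-- The coordinates of the simplex `0 ≤ x_i`, `∑ x_i ≤ 1`. -/
def cornerCoord (m : ℕ) (j : Fin (m + 1)) (x : Fin m → ℝ) : ℝ :=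
  (Fin.cons (1 - ∑ i, x i) x : Fin (m + 1) → ℝ) j

/-- The simplex `0 ≤ x_i`, `∑ x_i ≤ 1`. -/
def corner (m : ℕ) : Set (Fin m → ℝ) := {x | ∀ j, 0 ≤ cornerCoord m j x}

lemma continuous_cornerCoord (m : ℕ) (j : Fin (m + 1)) : Continuous (cornerCoord m j) := by
  refine Fin.cases ?_ (fun i => ?_) j
  · change Continuous fun x : Fin m → ℝ => 1 - ∑ i, x i
    fun_prop
  · exact continuous_apply i

lemma isClosed_corner (m : ℕ) : IsClosed (corner m) := by
  rw [corner, Set.ofPred_forall]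
  exact isClosed_iInter fun j => isClosed_le continuous_const (continuous_cornerCoord m j)

lemma cornerCoord_barycenter (m : ℕ) (j : Fin (m + 1)) :
    cornerCoord m j (fun _ => 1 / ((m : ℝ) + 1)) = 1 / ((m : ℝ) + 1) := by
  refine Fin.cases ?_ (fun i => ?_) j
  · simp only [cornerCoord, Fin.cons_zero, Finset.sum_const, Finset.card_univ, Fintype.card_fin,
      nsmul_eq_mul]
    field_simp
    ring
  · simp only [cornerCoord, Fin.cons_succ]

lemma cornerCoord_combination (m : ℕ) (j : Fin (m + 1)) (x y : Fin m → ℝ) (a b : ℝ)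
    (h : a + b = 1) :
    cornerCoord m j (a • x + b • y) = a * cornerCoord m j x + b * cornerCoord m j y := by
  refine Fin.cases ?_ (fun i => ?_) j
  · simp only [cornerCoord, Fin.cons_zero, Pi.add_apply, Pi.smul_apply, smul_eq_mul,
      Finset.sum_add_distrib, ← Finset.mul_sum]
    linear_combination -h
  · simp [cornerCoord, Fin.cons_succ]

lemma interior_corner (m : ℕ) : interior (corner m) = {x | ∀ j, 0 < cornerCoord m j x} := by
  refine interior_setOf_nonneg (cornerCoord m) (continuous_cornerCoord m)
    (y := fun _ => 1 / ((m : ℝ) + 1)) (fun j => ?_) fun j x ε => ?_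
  · rw [cornerCoord_barycenter]
    positivity
  · rw [show x + ε • (x - fun _ => 1 / ((m : ℝ) + 1)) =
      (1 + ε) • x + (-ε) • fun _ => 1 / ((m : ℝ) + 1) by module,
      cornerCoord_combination m j _ _ _ _ (by ring)]
    ring

lemma frontier_corner (m : ℕ) :
    frontier (corner m) = {x ∈ corner m | ∃ j, cornerCoord m j x = 0} := by
  ext x
  rw [(isClosed_corner m).frontier_eq, interior_corner]
  refine and_congr_right fun hx => ?_
  simp only [Set.mem_ofPred_eq, not_forall, not_lt]
  exact exists_congr fun j => ⟨fun h => le_antisymm h (hx j), fun h => h.le⟩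

lemma convex_corner (m : ℕ) : Convex ℝ (corner m) := by
  intro x hx y hy a b ha hb hab j
  rw [cornerCoord_combination m j x y a b hab]
  exact add_nonneg (mul_nonneg ha (hx j)) (mul_nonneg hb (hy j))

lemma isBounded_corner (m : ℕ) : Bornology.IsBounded (corner m) := by
  refine (Metric.isBounded_closedBall (x := (0 : Fin m → ℝ)) (r := 1)).subset fun x hx => ?_
  rw [mem_closedBall_zero_iff, pi_norm_le_iff_of_nonneg zero_le_one]
  have h0 (i) : 0 ≤ x i := by simpa [cornerCoord] using hx (Fin.succ i)
  intro i
  have h1 : 0 ≤ 1 - ∑ i, x i := by simpa [cornerCoord] using hx 0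
  have h2 : x i ≤ ∑ i, x i := Finset.single_le_sum (fun j _ => h0 j) (Finset.mem_univ i)
  rw [Real.norm_eq_abs, abs_le]
  constructor <;> linarith [h0 i]

/-- The simplex `0 ≤ x_i`, `∑ x_i ≤ 1` in barycentric coordinates. -/
def cornerHomeomorph (m : ℕ) : corner m ≃ₜ stdSimplex ℝ (Fin (m + 1)) where
  toFun x := ⟨fun j => cornerCoord m j x, x.2, by
    rw [Fin.sum_univ_succ]
    simp [cornerCoord]⟩
  invFun b := ⟨fun i => b i.succ, fun j => by
    have h := stdSimplex.sum_eq_one b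
    rw [Fin.sum_univ_succ] at h
    refine Fin.cases ?_ (fun i => ?_) j
    · simp only [cornerCoord, Fin.cons_zero]
      linarith [stdSimplex.zero_le b 0]
    · simp only [cornerCoord, Fin.cons_succ]
      exact stdSimplex.zero_le b _⟩
  left_inv x := by
    ext i
    change cornerCoord m i.succ x = _
    simp [cornerCoord]
  right_inv b := by
    have h := stdSimplex.sum_eq_one b
    rw [Fin.sum_univ_succ] at h
    ext j
    change cornerCoord m j (fun i => b i.succ) = b j
    refine Fin.cases ?_ (fun i => ?_) j
    · simp only [cornerCoord, Fin.cons_zero]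
      linarith
    · simp only [cornerCoord, Fin.cons_succ]
  continuous_toFun := Continuous.subtype_mk (continuous_pi fun j =>
    (continuous_cornerCoord m j).comp continuous_subtype_val) _
  continuous_invFun := Continuous.subtype_mk (continuous_pi fun i =>
    (continuous_apply i.succ).comp continuous_subtype_val) _

/-- A convex body modulo its boundary is homeomorphic to a simplex modulo its boundary. -/
lemma exists_homeomorph_simplex [FiniteDimensional ℝ L] {P : Set L} (hc : Convex ℝ P)
    (hcl : IsClosed P) (hb : Bornology.IsBounded P) (hi : (interior P).Nonempty) :
    ∃ e : P ≃ₜ stdSimplex ℝ (Fin (Module.finrank ℝ L + 1)),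
      ∀ x : P, (x : L) ∈ frontier P ↔ e x ∈ simplexBoundary (Module.finrank ℝ L) := by
  set m := Module.finrank ℝ L with hm
  let f : L ≃L[ℝ] (Fin m → ℝ) := ContinuousLinearEquiv.ofFinrankEq (by simp [hm])
  have hfi : (interior (f '' P)).Nonempty := by
    have := f.toHomeomorph.image_interior P
    change f '' interior P = interior (f '' P) at this
    rw [← this]
    exact hi.image f
  -- Two bounded convex bodies with interior points in the same space are matched, frontiers
  -- included, by a homeomorphism of the ambient space. It is restricted to `P` below.
  obtain ⟨g, -, hg2, hg3⟩ := exists_homeomorph_image_eq (s := f '' P) (t := corner m)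
    (hc.linear_image f.toLinearMap) hfi
    (NormedSpace.isVonNBounded_of_isBounded _ (f.lipschitz.isBounded_image hb)) (convex_corner m)
    (by
      rw [interior_corner]
      exact ⟨fun _ => 1 / ((m : ℝ) + 1), fun j => by
        rw [cornerCoord_barycenter]; positivity⟩)
    (NormedSpace.isVonNBounded_of_isBounded _ (isBounded_corner m))
  let H : L ≃ₜ (Fin m → ℝ) := f.toHomeomorph.trans g
  have hH (s : Set L) : H '' s = g '' (f '' s) := by rw [Set.image_image]; rfl
  have hfcl : closure (f '' P) = f '' P := by
    have := f.toHomeomorph.isClosedMap P hcl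
    exact this.closure_eq
  have hfr : f '' frontier P = frontier (f '' P) := f.toHomeomorph.image_frontier P
  rw [hfcl, (isClosed_corner m).closure_eq] at hg2
  have hHP : H '' P = corner m := by rw [hH, hg2]
  have hHF : H '' frontier P = frontier (corner m) := by rw [hH, hfr, hg3]
  have hmem (x : L) : x ∈ P ↔ H x ∈ corner m := by
    rw [← hHP, H.injective.mem_set_image]
  refine ⟨(H.subtype hmem).trans (cornerHomeomorph m), fun x => ?_⟩
  rw [← H.injective.mem_set_image, hHF, frontier_corner]
  exact and_iff_right ((hmem _).1 x.2)

/-- A convex body modulo its boundary has no homology below its dimension. -/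
lemma relCycles_frontier_le [FiniteDimensional ℝ L] {P : Set L} (hc : Convex ℝ P)
    (hcl : IsClosed P) (hb : Bornology.IsBounded P) (hi : (interior P).Nonempty) {n : ℕ}
    (hn : n < Module.finrank ℝ L) :
    relCycles {x : P | (x : L) ∈ frontier P} n ≤ relBoundaries {x : P | (x : L) ∈ frontier P} n := by
  obtain ⟨e, he⟩ := exists_homeomorph_simplex hc hcl hb hi
  intro z hz
  let f : C(P, stdSimplex ℝ (Fin (Module.finrank ℝ L + 1))) := ⟨e, e.continuous⟩
  let g : C(stdSimplex ℝ (Fin (Module.finrank ℝ L + 1)), P) := ⟨e.symm, e.symm.continuous⟩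
  have h1 := relCycles_simplexBoundary_le hn
    (chainMap_mem_relCycles n f (fun x hx => (he x).1 hx) z hz)
  have h2 := chainMap_mem_relBoundaries n g (B := {x : P | (x : L) ∈ frontier P})
    (fun x hx => (he _).2 (by simpa [g] using hx)) _ h1
  rwa [← chainMap_comp, show g.comp f = ContinuousMap.id P by ext1 x; simp [f, g],
    chainMap_id] at h2

/-- The radial structure of a convex body. -/
lemma nonempty_collar_frontier [FiniteDimensional ℝ L] {P : Set L} (hc : Convex ℝ P)
    (hcl : IsClosed P) (hb : Bornology.IsBounded P) (hi : (interior P).Nonempty) :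
    Nonempty (Collar {x : P | (x : L) ∈ frontier P}) := by
  obtain ⟨e, he⟩ := exists_homeomorph_simplex hc hcl hb hi
  exact ⟨(simplexCollar _).ofHomeomorph e he⟩

end Convex

end ConfSpace

end


noncomputable section

namespace ConfSpace

/-! Cells of configuration spaces -/

/-- The open cube of dimension `k`, in the first `k` coordinates. -/
def openCube (m k : ℕ) : Set (Fin (m + 1) → ℝ) :=
  {v | ∀ l, (l.val < k → 0 < v l ∧ v l < 1) ∧ (k ≤ l.val → v l = 0)}

/-- The closed cube of dimension `k`, in the first `k` coordinates. -/
def closedCube (m k : ℕ) : Set (Fin (m + 1) → ℝ) :=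
  {v | ∀ l, (l.val < k → 0 ≤ v l ∧ v l ≤ 1) ∧ (k ≤ l.val → v l = 0)}

/-- A decomposition of `X ∖ {x₀}` into finitely many open cubes of positive dimension, the boundary
of each of which is sent to `x₀` and to cubes of smaller dimension. -/
structure CellData (X : Type u) [TopologicalSpace X] (x₀ : X) where
  /-- The set of cells. -/
  E : Type u
  finite : Finite E
  /-- The dimensions of the cells are at most `m + 1`. -/
  m : ℕ
  /-- The dimension of a cell. -/
  dim : E → ℕ
  dim_pos : ∀ e, 0 < dim e
  dim_le : ∀ e, dim e ≤ m + 1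
  /-- The characteristic map of a cell. -/
  χ : E → C(Fin (m + 1) → ℝ, X)
  inj : ∀ {e e' a a'}, a ∈ openCube m (dim e) → a' ∈ openCube m (dim e') → χ e a = χ e' a' →
    e = e' ∧ a = a'
  ne : ∀ {e a}, a ∈ openCube m (dim e) → χ e a ≠ x₀
  cover : ∀ x, x ≠ x₀ → ∃ e, ∃ a ∈ openCube m (dim e), χ e a = x
  attach : ∀ {e a}, a ∈ closedCube m (dim e) → a ∉ openCube m (dim e) → χ e a ≠ x₀ →
    ∃ e', dim e' < dim e ∧ ∃ a' ∈ openCube m (dim e'), χ e' a' = χ e a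

namespace CellData

variable {X : Type u} [TopologicalSpace X] {x₀ : X} (C : CellData X x₀) (N : Type v)

instance : Finite C.E := C.finite

/-- Parameters of an injective configuration. -/
structure Param where
  /-- The cells of the points. -/
  cell : N → C.E
  /-- The coordinates of the points. -/
  pos : N → Fin (C.m + 1) → ℝ
  mem : ∀ i, pos i ∈ openCube C.m (C.dim (cell i))
  injective : Function.Injective fun i => C.χ (cell i) (pos i)

variable {C N}

namespace Param

variable (p : C.Param N)

/-- The configuration with given parameters. -/
def conf (i : N) : X := C.χ (p.cell i) (p.pos i)

lemma conf_notMem : p.conf ∉ discriminant x₀ N := by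
  rintro (⟨i, hi⟩ | h)
  · exact C.ne (p.mem i) hi
  · exact h p.injective

lemma exists_conf_eq {z : N → X} (hz : z ∉ discriminant x₀ N) : ∃ p : C.Param N, p.conf = z := by
  rw [discriminant, Set.mem_ofPred_eq, not_or, not_not, not_exists] at hz
  choose e a ha h using fun i => C.cover (z i) (hz.1 i)
  exact ⟨⟨e, a, ha, by simpa only [h] using hz.2⟩, funext h⟩

lemma ext_of_conf_eq {p q : C.Param N} (h : p.conf = q.conf) : p.cell = q.cell ∧ p.pos = q.pos :=
  ⟨funext fun i => (C.inj (p.mem i) (q.mem i) (congrFun h i)).1,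
    funext fun i => (C.inj (p.mem i) (q.mem i) (congrFun h i)).2⟩

/-- The points `i` and `j` lie in the same cell and agree in the coordinates up to the given one. -/
def Agree (t : N × N × Fin (C.m + 1)) : Prop :=
  p.cell t.1 = p.cell t.2.1 ∧ ∀ l ≤ t.2.2, p.pos t.1 l = p.pos t.2.1 l

/-- The points `i` and `j` lie in the same cell and the given coordinate is the first one in which
they differ, the one of `i` being smaller. -/
def Less (t : N × N × Fin (C.m + 1)) : Prop :=
  p.cell t.1 = p.cell t.2.1 ∧ (∀ l < t.2.2, p.pos t.1 l = p.pos t.2.1 l) ∧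
    p.pos t.1 t.2.2 < p.pos t.2.1 t.2.2

variable (C N) in
/-- The types of configurations. -/
abbrev Shape := (N → C.E) × Set (N × N × Fin (C.m + 1)) × Set (N × N × Fin (C.m + 1))

/-- The type of a configuration. -/
def shape : Shape C N := (p.cell, {t | p.Agree t}, {t | p.Less t})

variable {p}

lemma eq_of_pos_eq {i j : N} (h : p.cell i = p.cell j) (h' : p.pos i = p.pos j) : i = j :=
  p.injective (by simp only [h, h'])

lemma Less.lt_dim {t : N × N × Fin (C.m + 1)} (h : p.Less t) : t.2.2.val < C.dim (p.cell t.1) := by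
  by_contra! hl
  have h1 := ((p.mem t.1) t.2.2).2 hl
  have h2 := ((p.mem t.2.1) t.2.2).2 (h.1 ▸ hl)
  have := h.2.2
  rw [h1, h2] at this
  exact lt_irrefl _ this

/-- The minimal coordinate at which two points of one cell differ decides their lexicographic order.
This is how failure of an equation is converted into a strict inequality. -/
lemma exists_less {i j : N} {l : Fin (C.m + 1)} (h : p.cell i = p.cell j)
    (hl : ¬ p.Agree (i, j, l)) : ∃ l' ≤ l, p.Less (i, j, l') ∨ p.Less (j, i, l') := by
  have hex : ∃ l', l' ≤ l ∧ p.pos i l' ≠ p.pos j l' := by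
    by_contra! h'
    exact hl ⟨h, h'⟩
  classical
  have hne : (Finset.univ.filter fun l' => l' ≤ l ∧ p.pos i l' ≠ p.pos j l').Nonempty := by
    obtain ⟨l', h'⟩ := hex
    exact ⟨l', by simpa using h'⟩
  obtain ⟨l', hl', hmin⟩ := Finset.exists_min_image _ id hne
  rw [Finset.mem_filter] at hl'
  have hlt : ∀ k < l', p.pos i k = p.pos j k := by
    intro k hk
    by_contra hk'
    exact absurd (hmin k (by simpa using ⟨hk.le.trans hl'.2.1, hk'⟩)) (not_le.2 hk)
  refine ⟨l', hl'.2.1, ?_⟩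
  rcases lt_or_gt_of_ne hl'.2.2 with h' | h'
  · exact Or.inl ⟨h, hlt, h'⟩
  · exact Or.inr ⟨h.symm, fun k hk => (hlt k hk).symm, h'⟩

variable (p)

/-- The linear space of the cell of a configuration. -/
def space : Submodule ℝ (N → Fin (C.m + 1) → ℝ) where
  carrier := {y | (∀ i l, C.dim (p.cell i) ≤ l.val → y i l = 0) ∧
    ∀ t, p.Agree t → y t.1 t.2.2 = y t.2.1 t.2.2}
  zero_mem' := ⟨fun _ _ _ => rfl, fun _ _ => rfl⟩
  add_mem' h h' := ⟨fun i l hl => by simp [h.1 i l hl, h'.1 i l hl],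
    fun t ht => by simp [h.2 t ht, h'.2 t ht]⟩
  smul_mem' c y h := ⟨fun i l hl => by simp [h.1 i l hl], fun t ht => by simp [h.2 t ht]⟩

/-- The labels of the inequalities that define the cell of a configuration. -/
abbrev Ineq := {t : N × Fin (C.m + 1) // t.2.val < C.dim (p.cell t.1)} ⊕
  {t : N × Fin (C.m + 1) // t.2.val < C.dim (p.cell t.1)} ⊕ {t // p.Less t}

/-- The inequalities that define the cell of a configuration. -/
def ineq (j : p.Ineq) (y : p.space) : ℝ :=
  match j with
  | .inl t => y.1 t.1.1 t.1.2
  | .inr (.inl t) => 1 - y.1 t.1.1 t.1.2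
  | .inr (.inr t) => y.1 t.1.2.1 t.1.2.2 - y.1 t.1.1 t.1.2.2

/-- The closed cell of a configuration. -/
def poly : Set p.space := {y | ∀ j, 0 ≤ p.ineq j y}

/-- The configuration as a point of its cell. -/
def center : p.space := ⟨p.pos, fun i l => ((p.mem i) l).2, fun _ ht => ht.2 _ le_rfl⟩

lemma ineq_center (j : p.Ineq) : 0 < p.ineq j p.center := by
  rcases j with t | t | t
  · exact ((p.mem _ _).1 t.2).1
  · exact sub_pos.2 ((p.mem _ _).1 t.2).2
  · exact sub_pos.2 t.2.2.2

lemma continuous_coord (i : N) (l : Fin (C.m + 1)) : Continuous fun y : p.space => y.1 i l :=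
  (continuous_apply l).comp ((continuous_apply i).comp continuous_subtype_val)

lemma continuous_ineq (j : p.Ineq) : Continuous (p.ineq j) := by
  have := p.continuous_coord
  rcases j with t | t | t
  · exact this _ _
  · exact continuous_const.sub (this _ _)
  · exact (this _ _).sub (this _ _)

lemma ineq_combination (j : p.Ineq) (x y : p.space) (a b : ℝ) (h : a + b = 1) :
    p.ineq j (a • x + b • y) = a * p.ineq j x + b * p.ineq j y := by
  rcases j with t | t | t <;>
    simp only [ineq, Submodule.coe_add, Submodule.coe_smul, Pi.add_apply, Pi.smul_apply,
      smul_eq_mul]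
  · linear_combination -h
  · ring

lemma isClosed_poly : IsClosed p.poly := by
  rw [poly, Set.ofPred_forall]
  exact isClosed_iInter fun j => isClosed_le continuous_const (p.continuous_ineq j)

lemma convex_poly : Convex ℝ p.poly := by
  intro x hx y hy a b ha hb hab j
  rw [p.ineq_combination j x y a b hab]
  exact add_nonneg (mul_nonneg ha (hx j)) (mul_nonneg hb (hy j))

variable {p}

lemma mem_closedCube {y : p.space} (hy : y ∈ p.poly) (i : N) :
    y.1 i ∈ closedCube C.m (C.dim (p.cell i)) := fun l =>
  ⟨fun hl => ⟨hy (.inl ⟨(i, l), hl⟩), sub_nonneg.1 (hy (.inr (.inl ⟨(i, l), hl⟩)))⟩, y.2.1 i l⟩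

lemma mem_openCube {y : p.space} (hy : ∀ j, 0 < p.ineq j y) (i : N) :
    y.1 i ∈ openCube C.m (C.dim (p.cell i)) := fun l =>
  ⟨fun hl => ⟨hy (.inl ⟨(i, l), hl⟩), sub_pos.1 (hy (.inr (.inl ⟨(i, l), hl⟩)))⟩, y.2.1 i l⟩

lemma agree_pos {y : p.space} {t : N × N × Fin (C.m + 1)} (h : p.Agree t) :
    ∀ l ≤ t.2.2, y.1 t.1 l = y.1 t.2.1 l :=
  fun l hl => y.2.2 (t.1, t.2.1, l) ⟨h.1, fun k hk => h.2 k (hk.trans hl)⟩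

lemma less_pos {y : p.space} {t : N × N × Fin (C.m + 1)} (h : p.Less t) :
    ∀ l < t.2.2, y.1 t.1 l = y.1 t.2.1 l :=
  fun l hl => y.2.2 (t.1, t.2.1, l) ⟨h.1, fun k hk => h.2.1 k (lt_of_le_of_lt hk hl)⟩

variable (p)

/-- The configuration given by an interior point of a cell. -/
def ofInterior {y : p.space} (hy : ∀ j, 0 < p.ineq j y) : C.Param N where
  cell := p.cell
  pos := y.1
  mem := mem_openCube hy
  injective i j hij := by
    obtain ⟨h1, h2⟩ := C.inj (mem_openCube hy i) (mem_openCube hy j) hij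
    -- Distinct points of `p` in the same cell are separated by a strict inequality, which persists
    -- at `y`.
    by_contra hne
    have : ¬ p.Agree (i, j, Fin.last _) := fun h =>
      hne (eq_of_pos_eq h1 (funext fun l => h.2 l (Fin.le_last l)))
    obtain ⟨l, -, h | h⟩ := exists_less h1 this
    · have := hy (.inr (.inr ⟨_, h⟩))
      simp [ineq, h2] at this
    · have := hy (.inr (.inr ⟨_, h⟩))
      simp [ineq, h2] at this

/-- Coincidences persist because they are linear equations of `p.space`. No new one appears, since
two coordinate sequences that do not agree are separated by a strict inequality at some earlier or
equal coordinate. The signs are then determined as well. -/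
lemma shape_ofInterior {y : p.space} (hy : ∀ j, 0 < p.ineq j y) :
    (p.ofInterior hy).shape = p.shape := by
  have hlt {t} (h : p.Less t) : y.1 t.1 t.2.2 < y.1 t.2.1 t.2.2 :=
    sub_pos.1 (hy (.inr (.inr ⟨t, h⟩)))
  have hA (t) : (p.ofInterior hy).Agree t ↔ p.Agree t := by
    refine ⟨fun h => ?_, fun h => ⟨h.1, agree_pos h⟩⟩
    by_contra hn
    obtain ⟨l, hl, h' | h'⟩ := exists_less (p := p) (i := t.1) (j := t.2.1) h.1 hn
    · exact (hlt h').ne (h.2 l hl)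
    · exact (hlt h').ne (h.2 l hl).symm
  have hL (t) : (p.ofInterior hy).Less t ↔ p.Less t := by
    refine ⟨fun h => ?_, fun h => ⟨h.1, less_pos h, hlt h⟩⟩
    have h1 : ¬ p.Agree t := fun h' => h.2.2.ne (agree_pos h' _ le_rfl)
    obtain ⟨l, hl, h'⟩ := exists_less (p := p) (i := t.1) (j := t.2.1) h.1 h1
    have hlt' : l = t.2.2 := by
      refine hl.eq_of_not_lt fun hl => ?_
      rcases h' with h' | h'
      · exact (hlt h').ne (h.2.1 l hl)
      · exact (hlt h').ne (h.2.1 l hl).symm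
    subst hlt'
    rcases h' with h' | h'
    · exact h'
    · exact absurd (hlt h') (not_lt.2 h.2.2.le)
  simp only [shape, hA, hL]
  rfl

/-- The map from the closed cell to `X^N`. -/
def cellMap : C(p.poly, N → X) :=
  ⟨fun y i => C.χ (p.cell i) (y.1.1 i), continuous_pi fun i =>
    (C.χ (p.cell i)).continuous.comp ((continuous_apply i).comp
      (continuous_subtype_val.comp continuous_subtype_val))⟩

lemma cellMap_apply (y : p.poly) (i : N) : p.cellMap y i = C.χ (p.cell i) (y.1.1 i) := rfl

/-- Configurations of the same type as `p` lie in the cell of `p`. -/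
lemma exists_of_shape_eq {q : C.Param N} (h : q.shape = p.shape) :
    ∃ y : p.poly, (∀ j, 0 < p.ineq j y) ∧ p.cellMap y = q.conf := by
  obtain ⟨h1, h2⟩ := Prod.ext_iff.1 h
  obtain ⟨h2, h3⟩ := Prod.ext_iff.1 h2
  have hA (t) : q.Agree t ↔ p.Agree t := Set.ext_iff.1 h2 t
  have hL (t) : q.Less t ↔ p.Less t := Set.ext_iff.1 h3 t
  change q.cell = p.cell at h1
  have hm (i) : q.pos i ∈ openCube C.m (C.dim (p.cell i)) := h1 ▸ q.mem i
  let y : p.space := ⟨q.pos, fun i l => ((hm i) l).2, fun t ht => ((hA t).2 ht).2 _ le_rfl⟩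
  have hy (j) : 0 < p.ineq j y := by
    rcases j with t | t | t
    · exact ((hm _ _).1 t.2).1
    · exact sub_pos.2 ((hm _ _).1 t.2).2
    · exact sub_pos.2 ((hL _).2 t.2).2.2
  exact ⟨⟨y, fun j => (hy j).le⟩, hy, funext fun i => by rw [cellMap_apply, conf, h1]⟩

/-! ### Interior, boundary and rank of the polytopes. -/

section Rank

variable [Fintype N]

lemma interior_poly : interior p.poly = {y | ∀ j, 0 < p.ineq j y} := by
  refine interior_setOf_nonneg p.ineq p.continuous_ineq (y := p.center) p.ineq_center
    fun j x ε => ?_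
  rw [show x + ε • (x - p.center) = (1 + ε) • x + (-ε) • p.center by module,
    p.ineq_combination j _ _ _ _ (by ring)]
  ring

lemma interior_poly_nonempty : (interior p.poly).Nonempty := by
  rw [interior_poly]
  exact ⟨p.center, p.ineq_center⟩

lemma isBounded_poly : Bornology.IsBounded p.poly := by
  refine (Metric.isBounded_closedBall (x := (0 : p.space)) (r := 1)).subset fun y hy => ?_
  rw [mem_closedBall_zero_iff]
  change ‖y.1‖ ≤ 1
  rw [pi_norm_le_iff_of_nonneg zero_le_one]
  intro i
  rw [pi_norm_le_iff_of_nonneg zero_le_one]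
  intro l
  rw [Real.norm_eq_abs, abs_le]
  rcases Nat.lt_or_ge l.val (C.dim (p.cell i)) with hl | hl
  · have := (mem_closedCube hy i l).1 hl
    constructor <;> linarith
  · rw [(mem_closedCube hy i l).2 hl]
    constructor <;> linarith

lemma mem_frontier_poly {y : p.space} (hy : y ∈ p.poly) :
    y ∈ frontier p.poly ↔ ¬ ∀ j, 0 < p.ineq j y := by
  rw [p.isClosed_poly.frontier_eq, Set.mem_sdiff, interior_poly]
  exact and_iff_right hy

variable (C N) in
/-- The number of triples of two points and a coordinate. -/
def tripleCount : ℕ := Fintype.card (N × N × Fin (C.m + 1))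

/-- The rank of a type of configurations. -/
def rank (s : Shape C N) : ℕ :=
  (tripleCount C N + 1) * ∑ i, C.dim (s.1 i) + (tripleCount C N - s.2.1.ncard)

lemma ncard_le_tripleCount (s : Set (N × N × Fin (C.m + 1))) : s.ncard ≤ tripleCount C N := by
  rw [tripleCount, ← Nat.card_eq_fintype_card, ← Set.ncard_univ]
  exact Set.ncard_le_ncard (Set.subset_univ s)

/-- The factor `tripleCount C N + 1` exceeds every value of the second summand of the rank, so the
total dimension of the cells takes precedence. -/
lemma rank_lt_of_sum_lt {s t : Shape C N} (h : ∑ i, C.dim (s.1 i) < ∑ i, C.dim (t.1 i)) :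
    rank s < rank t := by
  have h1 : (tripleCount C N + 1) * (∑ i, C.dim (s.1 i) + 1) ≤
      (tripleCount C N + 1) * ∑ i, C.dim (t.1 i) := Nat.mul_le_mul_left _ h
  rw [Nat.mul_add] at h1
  simp only [rank]
  omega

/-- For fixed cells, more coincidences mean a smaller rank. -/
lemma rank_lt_of_ssubset {s t : Shape C N} (h : s.1 = t.1) (h' : t.2.1 ⊂ s.2.1) :
    rank s < rank t := by
  have h1 := Set.ncard_lt_ncard h'
  have h2 := ncard_le_tripleCount s.2.1
  simp only [rank, h]
  omega

/-- The boundary of a cell is sent to the discriminant and to cells of smaller rank. -/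
lemma cellMap_frontier {y : p.poly} (hy : (y : p.space) ∈ frontier p.poly)
    (hD : p.cellMap y ∉ discriminant x₀ N) :
    ∃ q : C.Param N, q.conf = p.cellMap y ∧ rank q.shape < rank p.shape := by
  rw [mem_frontier_poly p y.2] at hy
  obtain ⟨q, hq⟩ := exists_conf_eq (C := C) hD
  refine ⟨q, hq, ?_⟩
  have hle (i) : C.dim (q.cell i) ≤ C.dim (p.cell i) ∧
      (y.1.1 i ∉ openCube C.m (C.dim (p.cell i)) → C.dim (q.cell i) < C.dim (p.cell i)) := by
    by_cases ho : y.1.1 i ∈ openCube C.m (C.dim (p.cell i))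
    · exact ⟨((C.inj (q.mem i) ho (congrFun hq i)).1 ▸ le_rfl), fun h => absurd ho h⟩
    · obtain ⟨e, he, a, ha, hea⟩ := C.attach (mem_closedCube y.2 i) ho
        fun h => hD (Or.inl ⟨i, h⟩)
      have := (C.inj (q.mem i) ha ((congrFun hq i).trans hea.symm)).1
      rw [this]
      exact ⟨he.le, fun _ => he⟩
  -- If all points stay in their open cubes, some inequality between two points becomes tight and
  -- creates a new coincidence. Otherwise a point drops to a cell of smaller dimension while none
  -- rises.
  by_cases ho : ∀ i, y.1.1 i ∈ openCube C.m (C.dim (p.cell i))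
  · have hinj := fun i => C.inj (q.mem i) (ho i) (congrFun hq i)
    have hc : q.cell = p.cell := funext fun i => (hinj i).1
    have hp : q.pos = y.1.1 := funext fun i => (hinj i).2
    refine rank_lt_of_ssubset hc ⟨fun t ht => ?_, fun hsub => ?_⟩
    · exact ⟨by rw [hc]; exact ht.1, by rw [hp]; exact agree_pos ht⟩
    · push Not at hy
      obtain ⟨j, hj⟩ := hy
      have hj0 : p.ineq j y = 0 := le_antisymm hj (y.2 j)
      rcases j with t | t | t
      · exact ((ho _ _).1 t.2).1.ne' hj0
      · exact ((ho _ _).1 t.2).2.ne' (sub_eq_zero.1 hj0)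
      -- The tight triple agrees for `q` but was a strict inequality for `p`, so the inclusion of
      -- coincidence sets is proper.
      · have hq : q.Agree t.1 := ?_
        · exact t.2.2.2.ne ((show p.Agree t.1 from hsub hq).2 _ le_rfl)
        refine ⟨by rw [hc]; exact t.2.1, fun l hl => ?_⟩
        rw [hp]
        rcases hl.lt_or_eq with hl | rfl
        · exact less_pos t.2 l hl
        · exact (sub_eq_zero.1 hj0).symm
  · push Not at ho
    obtain ⟨i, hi⟩ := ho
    exact rank_lt_of_sum_lt (Finset.sum_lt_sum (fun i _ => (hle i).1)
      ⟨i, Finset.mem_univ i, (hle i).2 hi⟩)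

end Rank

end Param

end CellData

end ConfSpace

end


noncomputable section

namespace ConfSpace

/-! ### Attaching the polytopes in order of rank, and the loops of the cells of dimension one. -/

lemma isClosed_discriminant {X : Type u} [TopologicalSpace X] [T2Space X] (x₀ : X) (N : Type v)
    [Finite N] : IsClosed (discriminant x₀ N) := by
  have h : discriminant x₀ N = (⋃ i, {f | f i = x₀}) ∪
      ⋃ t : {t : N × N // t.1 ≠ t.2}, {f | f t.1.1 = f t.1.2} := by
    ext f
    simp only [discriminant, Function.Injective, Set.mem_ofPred_eq, Set.mem_union, Set.mem_iUnion]
    refine or_congr Iff.rfl ?_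
    push Not
    exact ⟨fun ⟨a, b, h, h'⟩ => ⟨⟨(a, b), h'⟩, h⟩, fun ⟨t, h⟩ => ⟨_, _, h, t.2⟩⟩
  rw [h]
  exact (isClosed_iUnion_of_finite fun i => isClosed_eq (continuous_apply i) continuous_const).union
    (isClosed_iUnion_of_finite fun t => isClosed_eq (continuous_apply _) (continuous_apply _))

namespace CellData

variable {X : Type u} [TopologicalSpace X] {x₀ : X} (C : CellData X x₀) {N : Type v}

namespace Param

variable {C} (p : C.Param N)

/-- Coordinates beyond the dimension of the cell vanish, so agreement up to the last relevant
coordinate is equality. Hence every point has its last coordinate to itself. -/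
lemma eq_of_agree_last {t : N × N × Fin (C.m + 1)} (h : p.Agree t)
    (hl : t.2.2.val + 1 = C.dim (p.cell t.1)) : t.1 = t.2.1 := by
  refine eq_of_pos_eq h.1 (funext fun l => ?_)
  rcases Nat.lt_or_ge l.val (C.dim (p.cell t.1)) with h' | h'
  · exact h.2 l (by rw [Fin.le_def]; omega)
  · rw [((p.mem t.1) l).2 h', ((p.mem t.2.1) l).2 (h.1 ▸ h')]

lemma shape_eq_of_conf_eq {p q : C.Param N} (h : p.conf = q.conf) : p.shape = q.shape := by
  obtain ⟨h1, h2⟩ := ext_of_conf_eq h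
  cases p
  cases q
  simp only at h1 h2
  subst h1 h2
  rfl

variable [Fintype N]

/-- The last coordinates of the points give `|N|` independent directions. If the cell of `i₀` has
dimension at least two, moving the first coordinate of all points in that cell simultaneously gives
one more. -/
lemma card_lt_finrank_space {i₀ : N} (h : 1 < C.dim (p.cell i₀)) :
    Fintype.card N < Module.finrank ℝ p.space := by
  classical
  -- The parameter `some i` moves the last coordinate of `i`; `none` moves the common first
  -- coordinate in the cell of `i₀`.
  let φ : (Option N → ℝ) →ₗ[ℝ] p.space :=
    { toFun c := ⟨fun i l => if l.val + 1 = C.dim (p.cell i) then c (some i) else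
        if l.val = 0 ∧ p.cell i = p.cell i₀ then c none else 0, by
        refine ⟨fun i l hl => ?_, fun t ht => ?_⟩
        · have := C.dim_pos (p.cell i)
          simp only
          rw [if_neg (by omega), if_neg (by omega)]
        · simp only
          by_cases hl : t.2.2.val + 1 = C.dim (p.cell t.1)
          · rw [eq_of_agree_last p ht hl]
          · rw [ht.1] at hl ⊢
            rw [if_neg hl, if_neg hl]⟩
      map_add' c c' := by
        ext i l
        simp only [Submodule.coe_add, Pi.add_apply]
        split_ifs <;> simp
      map_smul' a c := by
        ext i l
        simp only [Submodule.coe_smul, Pi.smul_apply, smul_eq_mul, RingHom.id_apply]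
        split_ifs <;> simp }
  have hφ : Function.Injective φ := by
    rw [injective_iff_map_eq_zero]
    intro c hc
    have hv (i l) : (φ c).1 i l = 0 := by rw [hc]; rfl
    funext o
    rcases o with _ | i
    · have := hv i₀ 0
      change (if _ then _ else _) = (0 : ℝ) at this
      rwa [if_neg (by rw [Fin.val_zero]; omega), if_pos ⟨rfl, rfl⟩] at this
    · have hd := C.dim_pos (p.cell i)
      have hd' := C.dim_le (p.cell i)
      have := hv i ⟨C.dim (p.cell i) - 1, by omega⟩
      change (if _ then _ else _) = (0 : ℝ) at this
      rwa [if_pos (by simp only; omega)] at this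
  have := LinearMap.finrank_le_finrank_of_injective hφ
  rw [Module.finrank_fintype_fun_eq_card, Fintype.card_option] at this
  omega

/-- A frontier point with the same image as an interior one would have both the rank of `p` and a
smaller one. So both points are interior, and there the parameters of a configuration are unique. -/
lemma cellMap_injective {y y' : p.poly} (hy : (y : p.space) ∉ frontier p.poly)
    (h : p.cellMap y = p.cellMap y') : y = y' := by
  have hi {y : p.poly} (hy : (y : p.space) ∉ frontier p.poly) (j) : 0 < p.ineq j y := by
    have := (mem_frontier_poly p y.2).not.1 hy
    rw [not_not] at this
    exact this j
  have hconf {y : p.poly} (hy : ∀ j, 0 < p.ineq j y) : (p.ofInterior hy).conf = p.cellMap y := rfl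
  have hy' : (y' : p.space) ∉ frontier p.poly := by
    intro hy'
    have hD : p.cellMap y' ∉ discriminant x₀ N := by
      rw [← h, ← hconf (hi hy)]
      exact conf_notMem _
    obtain ⟨q, hq, hr⟩ := cellMap_frontier p hy' hD
    rw [← h, ← hconf (hi hy)] at hq
    obtain ⟨h1, h2⟩ := ext_of_conf_eq hq
    have : q = p.ofInterior (hi hy) := by
      cases q
      simp only at h1 h2
      subst h1 h2
      rfl
    rw [this, shape_ofInterior] at hr
    exact lt_irrefl _ hr
  rw [← hconf (hi hy), ← hconf (hi hy')] at h
  exact Subtype.ext (Subtype.ext (ext_of_conf_eq h).2)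

/-- The union of the discriminant and of the configurations of given types. -/
def stratum (S : Finset (Shape C N)) : Set (N → X) :=
  discriminant x₀ N ∪ {z | ∃ p : C.Param N, p.shape ∈ S ∧ p.conf = z}

/-- Induction over the cells of the configuration space. -/
lemma stratum_induction [T2Space X] (Q : Set (N → X) → Prop) (h0 : Q (discriminant x₀ N))
    (hstep : ∀ (p : C.Param N) (F : Set (N → X)), IsClosed F → discriminant x₀ N ⊆ F →
      (∀ y : p.poly, p.cellMap y ∈ F ↔ (y : p.space) ∈ frontier p.poly) → Q F →
      Q (F ∪ Set.range p.cellMap)) : Q Set.univ := by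
  classical
  have key (S : Finset (Shape C N)) : (∀ s ∈ S, ∀ t, rank t < rank s → t ∈ S) →
      IsClosed (stratum S) ∧ Q (stratum S) := by
    induction S using Finset.strongInduction with
    | H S ih =>
      intro hS
      rcases S.eq_empty_or_nonempty with rfl | hne
      · have : stratum (C := C) ∅ = discriminant x₀ N := by simp [stratum]
        rw [this]
        exact ⟨isClosed_discriminant x₀ N, h0⟩
      -- Removing a shape of maximal rank leaves a set closed under passing to smaller rank, which
      -- contains all shapes met by the boundary of the removed cell.
      · obtain ⟨s, hs, hmax⟩ := S.exists_max_image rank hne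
        obtain ⟨hcl, hQ⟩ := ih (S.erase s) (Finset.erase_ssubset hs) fun a ha t ht =>
          Finset.mem_erase.2 ⟨by
            rintro rfl
            exact absurd (hmax a (Finset.mem_of_mem_erase ha)) (not_le.2 ht),
            hS a (Finset.mem_of_mem_erase ha) t ht⟩
        have hsub : stratum (S.erase s) ⊆ stratum S :=
          Set.union_subset_union_right _ fun z ⟨p, hp, hz⟩ => ⟨p, Finset.mem_of_mem_erase hp, hz⟩
        by_cases hp : ∃ p : C.Param N, p.shape = s
        · obtain ⟨p, rfl⟩ := hp
          have hfr (y : p.poly) (hy : (y : p.space) ∈ frontier p.poly) :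
              p.cellMap y ∈ stratum (S.erase p.shape) := by
            by_cases hD : p.cellMap y ∈ discriminant x₀ N
            · exact Or.inl hD
            · obtain ⟨q, hq, hr⟩ := cellMap_frontier p hy hD
              exact Or.inr ⟨q, Finset.mem_erase.2 ⟨fun h => by simp [h] at hr, hS _ hs _ hr⟩, hq⟩
          have hin (y : p.poly) (hy : (y : p.space) ∉ frontier p.poly) :
              ∃ q : C.Param N, q.shape = p.shape ∧ q.conf = p.cellMap y := by
            rw [mem_frontier_poly p y.2, not_not] at hy
            exact ⟨p.ofInterior hy, p.shape_ofInterior hy, rfl⟩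
          have heq : stratum S = stratum (S.erase p.shape) ∪ Set.range p.cellMap := by
            apply Set.Subset.antisymm
            · rintro z (hz | ⟨q, hq, rfl⟩)
              · exact Or.inl (Or.inl hz)
              · by_cases h : q.shape = p.shape
                · obtain ⟨y, -, hy⟩ := p.exists_of_shape_eq h
                  exact Or.inr ⟨y, hy⟩
                · exact Or.inl (Or.inr ⟨q, Finset.mem_erase.2 ⟨h, hq⟩, rfl⟩)
            · rintro z (hz | ⟨y, rfl⟩)
              · exact hsub hz
              · by_cases hy : (y : p.space) ∈ frontier p.poly
                · exact hsub (hfr y hy)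
                · obtain ⟨q, hq, hqy⟩ := hin y hy
                  exact Or.inr ⟨q, hq ▸ hs, hqy⟩
          rw [heq]
          have := isCompact_iff_compactSpace.1
            (Metric.isCompact_of_isClosed_isBounded p.isClosed_poly p.isBounded_poly)
          refine ⟨hcl.union (isCompact_range p.cellMap.continuous).isClosed,
            hstep p _ hcl Set.subset_union_left (fun y => ⟨fun h => ?_, hfr y⟩) hQ⟩
          by_contra hy
          obtain ⟨q, hq, hqy⟩ := hin y hy
          rw [← hqy] at h
          rcases h with h | ⟨q', hq', h⟩
          · exact q.conf_notMem h
          · rw [shape_eq_of_conf_eq h, hq] at hq'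
            exact Finset.notMem_erase _ _ hq'
        -- A formal shape need not be realized by a configuration; then it adds nothing.
        · have heq : stratum S = stratum (S.erase s) := by
            refine Set.Subset.antisymm ?_ hsub
            rintro z (hz | ⟨q, hq, rfl⟩)
            · exact Or.inl hz
            · exact Or.inr ⟨q, Finset.mem_erase.2 ⟨fun h => hp ⟨q, h⟩, hq⟩, rfl⟩
          rw [heq]
          exact ⟨hcl, hQ⟩
  have := Fintype.ofFinite (Shape C N)
  have huniv : stratum (C := C) (N := N) Finset.univ = Set.univ := by
    refine Set.eq_univ_of_forall fun z => ?_
    by_cases hz : z ∈ discriminant x₀ N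
    · exact Or.inl hz
    · obtain ⟨p, hp⟩ := exists_conf_eq (C := C) hz
      exact Or.inr ⟨p, Finset.mem_univ _, hp⟩
  rw [← huniv]
  exact (key Finset.univ fun _ _ _ _ => Finset.mem_univ _).2

end Param

/-- All cells have positive dimension, so the ends of a 1-cell have nowhere to go but the base
point. -/
lemma map_eq_of_notMem {e : C.E} (he : C.dim e = 1) {a : Fin (C.m + 1) → ℝ}
    (ha : a ∈ closedCube C.m (C.dim e)) (ha' : a ∉ openCube C.m (C.dim e)) : C.χ e a = x₀ := by
  by_contra h
  obtain ⟨e', h', -⟩ := C.attach ha ha' h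
  have := C.dim_pos e'
  omega

lemma single_mem_closedCube {m : ℕ} (t : unitInterval) :
    Pi.single 0 (t : ℝ) ∈ closedCube m 1 := by
  intro l
  refine ⟨fun hl => ?_, fun hl => ?_⟩
  · obtain rfl : l = 0 := Fin.ext (by simpa using hl)
    rw [Pi.single_eq_same]
    exact t.2
  · exact Pi.single_eq_of_ne (by rintro rfl; simp at hl) _

/-- The loop given by a cell of dimension one. -/
def loop (e : {e : C.E // C.dim e = 1}) : Path x₀ x₀ where
  toFun t := C.χ e (Pi.single 0 (t : ℝ))
  continuous_toFun := (C.χ e.1).continuous.comp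
    ((continuous_single (A := fun _ => ℝ) 0).comp continuous_subtype_val)
  source' := C.map_eq_of_notMem e.2 (by rw [e.2]; exact single_mem_closedCube 0) fun h => by
    have := ((h 0).1 (C.dim_pos _)).1
    simp at this
  target' := C.map_eq_of_notMem e.2 (by rw [e.2]; exact single_mem_closedCube 1) fun h => by
    have := ((h 0).1 (C.dim_pos _)).2
    simp at this

end CellData

end ConfSpace

end


noncomputable section

namespace ConfSpace

/-! ### Products of simplices as cells, and generation by loops of the cells of dimension one. -/

namespace CellData

variable {X : Type u} [TopologicalSpace X] {x₀ : X} {C : CellData X x₀} {N : Type v}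

lemma loop_apply (e : {e : C.E // C.dim e = 1}) (t : unitInterval) :
    C.loop e t = C.χ e (Pi.single 0 (t : ℝ)) := rfl

namespace Param

variable (p : C.Param N)

/-- The ordered partition of a configuration of points in cells of dimension one. -/
lemma exists_partition [Finite N] (h : ∀ i, C.dim (p.cell i) = 1) :
    ∃ (P : OrderedPartition N) (c : Fin P.r → {e : C.E // C.dim e = 1}),
      (∀ i, (c (P.part i) : C.E) = p.cell i) ∧ (∀ i j, P.part i = P.part j ↔ p.cell i = p.cell j) ∧
      ∀ k (i j : P.Part k), i < j ↔ p.pos i.1 0 < p.pos j.1 0 := by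
  let e := Finite.equivFin (Set.range p.cell)
  have hpart (i j : N) : e ⟨p.cell i, Set.mem_range_self i⟩ = e ⟨p.cell j, Set.mem_range_self j⟩ ↔ p.cell i = p.cell j :=
    e.injective.eq_iff.trans Subtype.ext_iff
  refine ⟨⟨Nat.card (Set.range p.cell), fun i => e ⟨p.cell i, Set.mem_range_self i⟩, fun k => ?_, fun k =>
    LinearOrder.lift' (fun i => p.pos i.1 0) fun i j hij => ?_⟩,
    fun k => ⟨(e.symm k).1, ?_⟩, fun i => ?_, hpart, fun k i j => Iff.rfl⟩
  · obtain ⟨⟨_, i, rfl⟩, rfl⟩ := e.surjective k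
    exact ⟨i, rfl⟩
  · have hc : p.cell i.1 = p.cell j.1 := (hpart _ _).1 (i.2.trans j.2.symm)
    refine Subtype.ext (eq_of_agree_last p (t := (i.1, j.1, 0)) ⟨hc, fun l hl => ?_⟩ ?_)
    · obtain rfl : l = 0 := le_antisymm hl (Fin.zero_le l)
      exact hij
    · simp [h]
  · obtain ⟨⟨_, i, rfl⟩, rfl⟩ := e.surjective k
    rw [Equiv.symm_apply_apply]
    exact h i
  · exact congrArg Subtype.val (e.symm_apply_apply _)

variable [Fintype N]

variable {p} in
/-- A cell of configurations of points in cells of dimension one as a product of simplices. -/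
lemma exists_simplexProd_map (h : ∀ i, C.dim (p.cell i) = 1) (P : OrderedPartition N)
    (c : Fin P.r → {e : C.E // C.dim e = 1}) (hc : ∀ i, (c (P.part i) : C.E) = p.cell i)
    (hP : ∀ i j, P.part i = P.part j ↔ p.cell i = p.cell j)
    (hlt : ∀ k (i j : P.Part k), i < j ↔ p.pos i.1 0 < p.pos j.1 0) :
    ∃ Y : SimplexProd P.Part → p.poly, Function.Bijective Y ∧
      (∀ x, (Y x : p.space) ∈ frontier p.poly ↔ x ∈ simplexProdBoundary P.Part) ∧
      ∀ x, P.cellMap (fun k => C.loop (c k)) x = p.cellMap (Y x) := by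
  -- The position of the point `j` on its 1-cell. As `Y x` one takes the configuration with these
  -- first coordinates and all others zero.
  let s (x : SimplexProd P.Part) (j : N) : unitInterval :=
    orderCoord (P.Part (P.part j)) ⟨j, rfl⟩ (x (P.part j))
  have hs (x : SimplexProd P.Part) (k) (j : P.Part k) : s x j.1 = orderCoord (P.Part k) j (x k) := by
    obtain ⟨j, rfl⟩ := j
    rfl
  have hl0 {i : N} {l : Fin (C.m + 1)} (hl : l.val < C.dim (p.cell i)) : l = 0 :=
    Fin.ext (by rw [h] at hl; simpa using hl)
  have hless {t} (ht : p.Less t) : ∃ k, ∃ i j : P.Part k, i.1 = t.1 ∧ j.1 = t.2.1 ∧ i < j ∧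
      t.2.2 = 0 := by
    have h0 := hl0 ht.lt_dim
    refine ⟨P.part t.1, ⟨t.1, rfl⟩, ⟨t.2.1, ((hP _ _).2 ht.1).symm⟩, rfl, rfl, (hlt _ _ _).2 ?_, h0⟩
    have := ht.2.2
    rwa [h0] at this
  have hless' {k} {i j : P.Part k} (hij : i < j) : p.Less (i.1, j.1, 0) :=
    ⟨(hP _ _).1 (i.2.trans j.2.symm), fun l hl => absurd hl (not_lt.2 (Fin.zero_le l)),
      (hlt k i j).1 hij⟩
  have hsingle (x : SimplexProd P.Part) : (fun j => Pi.single 0 (s x j : ℝ)) ∈ p.space := by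
    refine ⟨fun i l hl => ?_, fun t ht => ?_⟩
    · refine Pi.single_eq_of_ne ?_ _
      rintro rfl
      rw [h] at hl
      simp at hl
    · simp only
      by_cases hl : t.2.2 = 0
      · rw [eq_of_agree_last p ht (by rw [h, hl]; simp)]
      · rw [Pi.single_eq_of_ne hl, Pi.single_eq_of_ne hl]
  have hmono (x : SimplexProd P.Part) (k) : Monotone fun j : P.Part k => s x j.1 := by
    intro i j hij
    simp only [hs]
    exact partialSum_mono _ ((monoEquivOfFin _ rfl).symm.monotone hij)
  let y (x : SimplexProd P.Part) : p.space := ⟨fun j => Pi.single 0 (s x j : ℝ), hsingle x⟩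
  have hy0 (x : SimplexProd P.Part) (j : N) : (y x).1 j 0 = s x j :=
    Pi.single_eq_same (M := fun _ => ℝ) (0 : Fin (C.m + 1)) (s x j : ℝ)
  have hpoly (x : SimplexProd P.Part) : y x ∈ p.poly := by
    rintro (⟨⟨i, l⟩, hl⟩ | ⟨⟨i, l⟩, hl⟩ | ⟨t, ht⟩)
    · obtain rfl := hl0 hl
      simp only [ineq, hy0]
      exact (s x i).2.1
    · obtain rfl := hl0 hl
      simp only [ineq, hy0]
      exact sub_nonneg.2 (s x i).2.2
    · obtain ⟨k, i, j, h1, h2, h3, h4⟩ := hless ht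
      simp only [ineq, h4, hy0, ← h1, ← h2]
      exact sub_nonneg.2 (hmono x k h3.le)
  have hpos (x : SimplexProd P.Part) :
      (∀ j, 0 < p.ineq j (y x)) ↔ x ∉ simplexProdBoundary P.Part := by
    have hnot : x ∉ simplexProdBoundary P.Part ↔ ∀ k, x k ∉ simplexBoundary _ := by
      simp [simplexProdBoundary]
    simp only [hnot, notMem_simplexBoundary_iff]
    constructor
    · intro hj k
      refine ⟨fun a b hab => ?_, fun a => ?_⟩
      · have := hj (.inr (.inr ⟨_, hless' ((monoEquivOfFin (P.Part k) rfl).strictMono hab)⟩))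
        simp only [ineq, hy0, hs, orderCoord, OrderIso.symm_apply_apply] at this
        change (partialSum a (x k) : ℝ) < partialSum b (x k)
        exact sub_pos.1 this
      · have hd : (0 : Fin (C.m + 1)).val < C.dim (p.cell (monoEquivOfFin (P.Part k) rfl a).1) := by
          rw [h]; simp
        have h1 := hj (.inl ⟨(_, 0), hd⟩)
        have h2 := hj (.inr (.inl ⟨(_, 0), hd⟩))
        simp only [ineq, hy0, hs, orderCoord, OrderIso.symm_apply_apply] at h1 h2
        exact ⟨h1, sub_pos.1 h2⟩
    · rintro hk (⟨⟨i, l⟩, hl⟩ | ⟨⟨i, l⟩, hl⟩ | ⟨t, ht⟩)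
      · obtain rfl := hl0 hl
        simp only [ineq, hy0]
        exact ((hk _).2 _).1
      · obtain rfl := hl0 hl
        simp only [ineq, hy0]
        exact sub_pos.2 ((hk _).2 _).2
      · obtain ⟨k, i, j, h1, h2, h3, h4⟩ := hless ht
        simp only [ineq, h4, hy0, ← h1, ← h2, hs]
        exact sub_pos.2 ((hk k).1 ((monoEquivOfFin _ rfl).symm.strictMono h3))
  refine ⟨fun x => ⟨y x, hpoly x⟩, ⟨fun x x' hxx => ?_, fun z => ?_⟩, fun x => ?_, fun x => ?_⟩
  · funext k
    refine partialSum_injective fun a => Subtype.ext ?_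
    have := congrFun (congrFun (congrArg (fun z : p.poly => z.1.1) hxx)
      (monoEquivOfFin (P.Part k) rfl a).1) 0
    simpa only [hy0, hs, orderCoord, OrderIso.symm_apply_apply] using this
  -- Surjectivity: the defining inequalities say that the positions on each 1-cell are weakly
  -- increasing in the order of its part, so they come from a point of the simplex.
  · have hz (i : N) : z.1.1 i 0 ∈ unitInterval :=
      (mem_closedCube z.2 i 0).1 (by rw [h]; simp)
    have hex (k) := exists_partialSum_eq (n := Fintype.card (P.Part k))
      (fun a => ⟨_, hz (monoEquivOfFin (P.Part k) rfl a).1⟩) (by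
        intro a b hab
        rcases hab.lt_or_eq with hab | rfl
        · have := z.2 (.inr (.inr ⟨_, hless' ((monoEquivOfFin (P.Part k) rfl).strictMono hab)⟩))
          exact Subtype.mk_le_mk.2 (sub_nonneg.1 this)
        · exact le_rfl)
    choose x hx using hex
    refine ⟨x, Subtype.ext (Subtype.ext (funext fun i => funext fun l => ?_))⟩
    rcases Nat.lt_or_ge l.val (C.dim (p.cell i)) with hl | hl
    · obtain rfl := hl0 hl
      let i' : P.Part (P.part i) := ⟨i, rfl⟩
      have h1 := congrArg Subtype.val (hx (P.part i) ((monoEquivOfFin _ rfl).symm i'))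
      have h2 := (monoEquivOfFin (P.Part (P.part i)) rfl).apply_symm_apply i'
      exact (hy0 x i).trans (h1.trans (by simp only [h2]; rfl))
    · rw [z.1.2.1 i l hl]
      exact (y x).2.1 i l hl
  · rw [mem_frontier_poly p (hpoly x), hpos, not_not]
  · funext i
    rw [OrderedPartition.cellMap_apply, cellMap_apply, loop_apply, hc]

end Param

/-- The group `H_n(X^N, D_N)`, `n = |N|`, is generated by the classes of products of loops given by
the cells of dimension one. -/
theorem span_tensorTriangle_eq_top [CompactSpace X] [T2Space X] (C : CellData X x₀)
    (hv : TriangleVanishes.{u, v} x₀) (N : Type v) [Fintype N] :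
    Submodule.span ℤ {z : TopHomology x₀ N |
      ∃ (P : OrderedPartition N) (c : Fin P.r → {e : C.E // C.dim e = 1}),
        z = tensorTriangle hv P (PiTensorProduct.tprod ℤ fun i =>
          truncSubOne (Fintype.card (P.Part i))
            (FundamentalGroup.fromPath (Path.Homotopic.Quotient.mk (C.loop (c i)))))} = ⊤ := by
  set V := Submodule.span ℤ {z : TopHomology x₀ N |
      ∃ (P : OrderedPartition N) (c : Fin P.r → {e : C.E // C.dim e = 1}),
        z = tensorTriangle hv P (PiTensorProduct.tprod ℤ fun i =>
          truncSubOne (Fintype.card (P.Part i))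
            (FundamentalGroup.fromPath (Path.Homotopic.Quotient.mk (C.loop (c i)))))} with hV
  set n := Fintype.card N with hn
  have key : ∀ z : relCycles (discriminant x₀ N) n, (z : SingChain n (N → X)) ∈
      chainsIn Set.univ n → homologyClass z ∈ V := by
    -- The property carried through the induction is that all cycles relative to the discriminant
    -- with support in `F` have class in `V`; cycles modulo `F` are not considered.
    refine Param.stratum_induction (C := C) (fun F => ∀ z : relCycles (discriminant x₀ N) n,
      (z : SingChain n (N → X)) ∈ chainsIn F n → homologyClass z ∈ V) (fun z hz => ?_)
      fun p F hF hDF hB hQ z hz => ?_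
    · rw [(homologyClass_eq_zero_iff z).2 (chainsIn_le_relBoundaries _ _ hz)]
      exact Submodule.zero_mem _
    · have hcompact : CompactSpace p.poly := isCompact_iff_compactSpace.1
        (Metric.isCompact_of_isClosed_isBounded p.isClosed_poly p.isBounded_poly)
      have hdz : boundary n z.1 ∈ chainsIn F (n - 1) := chainsIn_mono hDF _ z.2
      -- If `z` is, up to a boundary, a relative cycle `y` with class in `V` plus a chain `w` in
      -- `F`, then `w` is automatically a cycle relative to the discriminant, so the induction
      -- hypothesis applies to it.
      have hsub {y w : SingChain n (N → X)} {w' : SingChain (n + 1) (N → X)}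
          (hy : y ∈ relCycles (discriminant x₀ N) n) (hyV : homologyClass ⟨y, hy⟩ ∈ V)
          (hw : z.1 - y - faceSum n w' = w) (hwF : w ∈ chainsIn F n) : homologyClass z ∈ V := by
        have hwc : w ∈ relCycles (discriminant x₀ N) n := by
          rw [← hw]
          refine Submodule.sub_mem _ (Submodule.sub_mem _ z.2 hy) ?_
          rw [relCycles, Submodule.mem_comap, boundary_faceSum]
          exact Submodule.zero_mem _
        have h1 := Submodule.add_mem _ hyV (hQ ⟨w, hwc⟩ hwF)
        rw [← map_add] at h1
        rwa [(homologyClass_eq_iff z (⟨y, hy⟩ + ⟨w, hwc⟩)).2 ?_]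
        refine Submodule.mem_sup_left ⟨w', ?_⟩
        change _ = z.1 - (y + w)
        rw [← hw]
        abel
      by_cases h1 : ∀ i, C.dim (p.cell i) = 1
      · obtain ⟨P, c, hc, hP, hlt⟩ := p.exists_partition h1
        obtain ⟨Y, hY, hYB, hYΨ⟩ := Param.exists_simplexProd_map h1 P c hc hP hlt
        set Ψ := P.cellMap fun k => C.loop (c k)
        -- For products of loops the boundary goes to the discriminant itself, not merely to `F`, so
        -- the image of `b` defines a class in the group under study.
        have hΨ := P.cellMap_mapsTo fun k => C.loop (c k)
        obtain ⟨b, hb, w, -, hw⟩ := exists_relCycle_of_cell hF (simplexProdCollar P.Part) Ψ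
          (F' := F ∪ Set.range p.cellMap)
          (by
            congr 1
            have : (Ψ : SimplexProd P.Part → N → X) = p.cellMap ∘ Y := funext hYΨ
            rw [this, hY.2.range_comp])
          (fun x => by rw [hYΨ, hB, hYB])
          (fun x x' hx hxx => hY.1 (p.cellMap_injective ((hYB x).not.2 hx)
            (by rw [← hYΨ, ← hYΨ, hxx]))) hz hdz
        refine hsub (chainMap_mem_relCycles n Ψ hΨ b hb) ?_ rfl hw
        have h2 := P.cellMap_mem_span hv (fun k => C.loop (c k)) (homologyClass ⟨b, hb⟩) hΨ
        refine Submodule.span_mono ?_ h2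
        rintro _ rfl
        exact ⟨P, c, rfl⟩
      · push Not at h1
        obtain ⟨i, hi⟩ := h1
        obtain ⟨col⟩ := nonempty_collar_frontier p.convex_poly p.isClosed_poly p.isBounded_poly
          p.interior_poly_nonempty
        obtain ⟨b, hb, w, -, hw⟩ := exists_relCycle_of_cell hF col p.cellMap rfl hB
          (fun y y' hy h => p.cellMap_injective hy h) hz hdz
        -- The polytope has dimension greater than `n`, so `b` is a relative boundary and `z` can be
        -- moved into `F` with `y = 0`.
        have hdim := p.card_lt_finrank_space (i₀ := i) (by have := C.dim_pos (p.cell i); omega)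
        obtain ⟨_, ⟨w', rfl⟩, a, ha, hab⟩ := Submodule.mem_sup.1
          (relCycles_frontier_le p.convex_poly p.isClosed_poly p.isBounded_poly
            p.interior_poly_nonempty hdim hb)
        refine hsub (y := 0) (w' := w + chainMap (n + 1) p.cellMap w') (Submodule.zero_mem _)
          ?_ rfl ?_
        · have h0 : (⟨0, Submodule.zero_mem _⟩ : relCycles (discriminant x₀ N) n) = 0 := rfl
          rw [h0, map_zero]
          exact Submodule.zero_mem _
        · have h2 := Submodule.add_mem _ hw (chainMap_mem n p.cellMap
            (fun y hy => (hB y).2 hy) ha)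
          rw [← hab, map_add, ← faceSum_chainMap] at h2
          rw [map_add]
          convert h2 using 1
          abel
  refine (Submodule.eq_top_iff'.2 fun z => ?_)
  obtain ⟨z, rfl⟩ := Submodule.mkQ_surjective _ z
  exact key z (mem_chainsIn_univ _)

end CellData

end ConfSpace

end


noncomputable section

namespace ConfSpace

/-! The cells of a CW complex as cubes -/

/-- The map of the unit cube to the ball of the maximum norm, with a sign. -/
def cubeMap (m n : ℕ) (s : ℝ) : C(Fin (m + 1) → ℝ, Fin n → ℝ) :=
  ⟨fun v l => s * (2 * max 0 (min 1 (v (Fin.ofNat (m + 1) l))) - 1), by fun_prop⟩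

section Cube

variable {m n : ℕ} {s : ℝ}

lemma cubeMap_apply (v : Fin (m + 1) → ℝ) (l : Fin n) (h0 : 0 ≤ v (Fin.ofNat (m + 1) l))
    (h1 : v (Fin.ofNat (m + 1) l) ≤ 1) :
    cubeMap m n s v l = s * (2 * v (Fin.ofNat (m + 1) l) - 1) := by
  change s * (2 * max 0 (min 1 (v (Fin.ofNat (m + 1) l))) - 1) = _
  rw [min_eq_right h1, max_eq_right h0]

/-- The balls that carry CW cells are cubes, being taken in the maximum norm. Clamping the
coordinates defines the map on all of Euclidean space while keeping its values in the closed ball,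
where characteristic maps are continuous. -/
lemma cubeMap_mem_closedBall (hs : |s| = 1) (v : Fin (m + 1) → ℝ) :
    cubeMap m n s v ∈ Metric.closedBall (0 : Fin n → ℝ) 1 := by
  rw [mem_closedBall_zero_iff, pi_norm_le_iff_of_nonneg zero_le_one]
  intro l
  change ‖s * (2 * max 0 (min 1 (v (Fin.ofNat (m + 1) l))) - 1)‖ ≤ 1
  have h1 : (0 : ℝ) ≤ max 0 (min 1 (v (Fin.ofNat (m + 1) l))) := le_max_left _ _
  have h2 : max 0 (min 1 (v (Fin.ofNat (m + 1) l))) ≤ 1 := max_le zero_le_one (min_le_left _ _)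
  rw [norm_mul, Real.norm_eq_abs, hs, one_mul, Real.norm_eq_abs, abs_le]
  constructor <;> linarith

lemma val_ofNat_of_le (hn : n ≤ m + 1) (l : Fin n) : (Fin.ofNat (m + 1) l.val).val = l.val := by
  rw [Fin.val_ofNat, Nat.mod_eq_of_lt (by omega)]

lemma cubeMap_mem_ball (hs : |s| = 1) (hn : n ≤ m + 1) {v : Fin (m + 1) → ℝ}
    (hv : v ∈ openCube m n) : cubeMap m n s v ∈ Metric.ball (0 : Fin n → ℝ) 1 := by
  rw [mem_ball_zero_iff, pi_norm_lt_iff zero_lt_one]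
  intro l
  have h := (hv (Fin.ofNat (m + 1) l)).1 (by rw [val_ofNat_of_le hn]; exact l.2)
  rw [cubeMap_apply v l h.1.le h.2.le, norm_mul, Real.norm_eq_abs, hs, one_mul, Real.norm_eq_abs,
    abs_lt]
  constructor <;> linarith

lemma cubeMap_mem_sphere (hs : |s| = 1) {v : Fin (m + 1) → ℝ} (hv : v ∈ closedCube m n)
    (hv' : v ∉ openCube m n) : cubeMap m n s v ∈ Metric.sphere (0 : Fin n → ℝ) 1 := by
  rw [mem_sphere_zero_iff_norm]
  refine le_antisymm (mem_closedBall_zero_iff.1 (cubeMap_mem_closedBall hs v)) ?_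
  have hex : ∃ l : Fin (m + 1), ∃ h : l.val < n, v l = 0 ∨ v l = 1 := by
    by_contra! h
    refine hv' fun l => ⟨fun hl => ?_, (hv l).2⟩
    have h1 := (hv l).1 hl
    exact ⟨h1.1.lt_of_ne (h l hl).1.symm, h1.2.lt_of_ne (h l hl).2⟩
  obtain ⟨l, hl, h⟩ := hex
  have hl' : Fin.ofNat (m + 1) (⟨l.val, hl⟩ : Fin n).val = l := Fin.ext (by simp)
  refine le_trans ?_ (norm_le_pi_norm _ (⟨l.val, hl⟩ : Fin n))
  rw [cubeMap_apply v, hl', norm_mul, Real.norm_eq_abs, hs, one_mul]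
  · rcases h with h | h <;> rw [h] <;> norm_num
  · rw [hl']; exact ((hv l).1 hl).1
  · rw [hl']; exact ((hv l).1 hl).2

lemma cubeMap_injOn (hs : |s| = 1) :
    Set.InjOn (cubeMap m n s) (openCube m n) := by
  intro v hv v' hv' h
  have hs0 : s ≠ 0 := by rintro rfl; simp at hs
  funext l
  rcases Nat.lt_or_ge l.val n with hl | hl
  · have hl' : Fin.ofNat (m + 1) (⟨l.val, hl⟩ : Fin n).val = l := Fin.ext (by simp)
    have h1 := congrFun h ⟨l.val, hl⟩
    have h2 := (hv l).1 hl
    have h3 := (hv' l).1 hl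
    rw [cubeMap_apply v _ (by rw [hl']; exact h2.1.le) (by rw [hl']; exact h2.2.le),
      cubeMap_apply v' _ (by rw [hl']; exact h3.1.le) (by rw [hl']; exact h3.2.le), hl'] at h1
    have := mul_left_cancel₀ hs0 h1
    linarith
  · rw [(hv l).2 hl, (hv' l).2 hl]

lemma exists_cubeMap_eq (hs : |s| = 1) (hn : n ≤ m + 1) {w : Fin n → ℝ}
    (hw : w ∈ Metric.ball (0 : Fin n → ℝ) 1) : ∃ v ∈ openCube m n, cubeMap m n s v = w := by
  rw [mem_ball_zero_iff, pi_norm_lt_iff zero_lt_one] at hw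
  have hss : s * s = 1 := by rw [← abs_mul_abs_self, hs, one_mul]
  have hb (l : Fin n) : 0 < (s * w l + 1) / 2 ∧ (s * w l + 1) / 2 < 1 := by
    have h1 : |s * w l| < 1 := by rw [abs_mul, hs, one_mul]; exact hw l
    rw [abs_lt] at h1
    constructor <;> linarith
  have hl' (l : Fin n) : (Fin.ofNat (m + 1) l.val).val < n := by
    rw [val_ofNat_of_le hn]; exact l.2
  let v : Fin (m + 1) → ℝ := fun l => if h : l.val < n then (s * w ⟨l.val, h⟩ + 1) / 2 else 0
  have hv (l : Fin n) : v (Fin.ofNat (m + 1) l) = (s * w l + 1) / 2 := by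
    have : (⟨(Fin.ofNat (m + 1) l.val).val, hl' l⟩ : Fin n) = l := Fin.ext (val_ofNat_of_le hn l)
    simp only [v, dif_pos (hl' l), this]
  refine ⟨v, fun l => ⟨fun hl => ?_, fun hl => dif_neg (not_lt.2 hl)⟩, funext fun l => ?_⟩
  · simp only [v, dif_pos hl]
    exact hb _
  · rw [cubeMap_apply v l (by rw [hv]; exact (hb l).1.le) (by rw [hv]; exact (hb l).2.le), hv]
    linear_combination w l * hss

end Cube

section CW

open Topology

variable {X : Type u} [TopologicalSpace X] [CWComplex (Set.univ : Set X)] {x₀ : X}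

/-- The sign of the orientation of a cell of dimension one, and `1` in other dimensions. -/
def cellSign (o : RelCWComplex.cell (Set.univ : Set X) 1 → Bool) :
    (n : ℕ) → RelCWComplex.cell (Set.univ : Set X) n → ℝ
  | 1, c => if o c then 1 else -1
  | _, _ => 1

lemma abs_cellSign (o : RelCWComplex.cell (Set.univ : Set X) 1 → Bool) (n : ℕ)
    (c : RelCWComplex.cell (Set.univ : Set X) n) : |cellSign o n c| = 1 := by
  rcases n with _ | _ | n
  · exact abs_one
  · change |if o c then (1 : ℝ) else -1| = 1
    split_ifs <;> simp
  · exact abs_one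

lemma exists_cell_of_ne (h : IsOnlyVertex x₀) {x : X} (hx : x ≠ x₀) {n : ℕ}
    {c : RelCWComplex.cell (Set.univ : Set X) n} (hc : x ∈ RelCWComplex.openCell n c) : 0 < n := by
  rcases n with _ | n
  · obtain ⟨e₀, he, hx₀⟩ := h
    obtain ⟨w, -, rfl⟩ := hc
    rw [he c, Subsingleton.elim w 0] at hx
    exact absurd hx₀ hx
  · exact Nat.succ_pos n

/-- A finite CW complex with one vertex as a space decomposed into cubes, with given orientations
of the cells of dimension one. -/
lemma exists_cellData [RelCWComplex.Finite (Set.univ : Set X)] (h : IsOnlyVertex x₀)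
    (o : RelCWComplex.cell (Set.univ : Set X) 1 → Bool) :
    ∃ C : CellData X x₀, ∀ e : {e : C.E // C.dim e = 1},
      ∃ c, FundamentalGroup.fromPath (Path.Homotopic.Quotient.mk (C.loop e)) =
        cellClass h (o c) c := by
  have hfin := RelCWComplex.finite_cells_of_finite (C := (Set.univ : Set X))
  -- All cells are to be parametrized in one Euclidean space, so their dimensions need a common
  -- bound; it exists by finiteness.
  have hbound : ∃ m, ∀ e : Σ n, RelCWComplex.cell (Set.univ : Set X) n, e.1 ≤ m + 1 := by
    obtain ⟨m, hm⟩ := (Set.finite_range fun e : Σ n, RelCWComplex.cell (Set.univ : Set X) n =>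
      e.1).bddAbove
    exact ⟨m, fun e => (hm ⟨e, rfl⟩).trans (Nat.le_succ m)⟩
  obtain ⟨m, hm⟩ := hbound
  have hs := abs_cellSign o
  have hcover (x : X) (hx : x ≠ x₀) {n} {c : RelCWComplex.cell (Set.univ : Set X) n}
      (hc : x ∈ RelCWComplex.openCell n c) : ∃ hn : 0 < n, ∃ a ∈ openCube m n,
        RelCWComplex.map n c (cubeMap m n (cellSign o n c) a) = x := by
    obtain ⟨w, hw, hwx⟩ := hc
    obtain ⟨a, ha, rfl⟩ := exists_cubeMap_eq (hs n c) (hm ⟨n, c⟩) hw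
    exact ⟨exists_cell_of_ne h hx ⟨_, hw, hwx⟩, a, ha, hwx⟩
  have hopen {n} {c : RelCWComplex.cell (Set.univ : Set X) n} {a} (ha : a ∈ openCube m n) :
      RelCWComplex.map n c (cubeMap m n (cellSign o n c) a) ∈ RelCWComplex.openCell n c :=
    ⟨_, cubeMap_mem_ball (hs n c) (hm ⟨n, c⟩) ha, rfl⟩
  let C : CellData X x₀ :=
    -- The vertex is left out: it is the base point, which is not to be covered by a cube.
    { E := {e : Σ n, RelCWComplex.cell (Set.univ : Set X) n // 0 < e.1}
      finite := inferInstance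
      m := m
      dim e := e.1.1
      dim_pos e := e.2
      dim_le e := hm e.1
      χ e := ⟨fun v => RelCWComplex.map e.1.1 e.1.2 (cubeMap m e.1.1 (cellSign o _ e.1.2) v),
        (RelCWComplex.continuousOn e.1.1 e.1.2).comp_continuous (ContinuousMap.continuous _)
          fun v => cubeMap_mem_closedBall (hs _ _) v⟩
      inj := by
        rintro ⟨⟨n, c⟩, hn⟩ ⟨⟨n', c'⟩, hn'⟩ a a' ha ha' haa
        change RelCWComplex.map n c (cubeMap m n (cellSign o n c) a) =
          RelCWComplex.map n' c' (cubeMap m n' (cellSign o n' c') a') at haa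
        have h1 : (⟨n, c⟩ : Σ n, RelCWComplex.cell (Set.univ : Set X) n) = ⟨n', c'⟩ :=
          RelCWComplex.eq_of_not_disjoint_openCell (Set.not_disjoint_iff.2
            ⟨_, hopen ha, by rw [haa]; exact hopen ha'⟩)
        obtain ⟨rfl, h2⟩ := Sigma.mk.inj_iff.1 h1
        obtain rfl := eq_of_heq h2
        refine ⟨rfl, cubeMap_injOn (hs n c) ha ha'
          ((RelCWComplex.map n c).injOn ?_ ?_ haa)⟩
        · rw [RelCWComplex.source_eq]
          exact cubeMap_mem_ball (hs n c) (hm ⟨n, c⟩) ha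
        · rw [RelCWComplex.source_eq]
          exact cubeMap_mem_ball (hs n c) (hm ⟨n, c⟩) ha'
      ne := by
        rintro ⟨⟨n, c⟩, hn⟩ a ha hax
        change RelCWComplex.map n c (cubeMap m n (cellSign o n c) a) = x₀ at hax
        obtain ⟨e₀, he, hx₀⟩ := h
        have h1 : (⟨n, c⟩ : Σ n, RelCWComplex.cell (Set.univ : Set X) n) = ⟨0, e₀⟩ :=
          RelCWComplex.eq_of_not_disjoint_openCell (Set.not_disjoint_iff.2
            ⟨x₀, by rw [← hax]; exact hopen ha, by
              rw [← hx₀]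
              exact RelCWComplex.map_zero_mem_openCell 0 e₀⟩)
        have : n = 0 := congrArg Sigma.fst h1
        exact hn.ne' this
      cover := by
        intro x hx
        have h1 : x ∈ ⋃ (n : ℕ) (j : RelCWComplex.cell (Set.univ : Set X) n),
            RelCWComplex.openCell n j := by
          rw [CWComplex.iUnion_openCell_eq_complex]
          trivial
        simp only [Set.mem_iUnion] at h1
        obtain ⟨n, c, hc⟩ := h1
        obtain ⟨hn, a, ha, hax⟩ := hcover x hx hc
        exact ⟨⟨⟨n, c⟩, hn⟩, a, ha, hax⟩
      attach := by
        rintro ⟨⟨n, c⟩, hn⟩ a ha ha' hax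
        -- The frontier of a cell lies in open cells of smaller dimension; away from the base point
        -- these have positive dimension.
        obtain ⟨I, hI⟩ := CWComplex.cellFrontier_subset_finite_openCell n c
        have h1 := hI ⟨_, cubeMap_mem_sphere (hs n c) ha ha', rfl⟩
        simp only [Set.mem_iUnion] at h1
        obtain ⟨n', hn', c', -, hc'⟩ := h1
        obtain ⟨hpos, b, hb, hbx⟩ := hcover _ hax hc'
        exact ⟨⟨⟨n', c'⟩, hpos⟩, hn', b, hb, hbx⟩ }
  refine ⟨C, ?_⟩
  rintro ⟨⟨⟨n, c⟩, hn⟩, h1⟩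
  change n = 1 at h1
  subst h1
  refine ⟨c, congrArg (fun γ => FundamentalGroup.fromPath (Path.Homotopic.Quotient.mk γ)) ?_⟩
  ext t
  have h0 : C.loop ⟨⟨⟨1, c⟩, hn⟩, rfl⟩ t = RelCWComplex.map 1 c
      (cubeMap m 1 (cellSign o 1 c) (Pi.single 0 (t : ℝ))) := rfl
  have h2 : cubeMap m 1 (cellSign o 1 c) (Pi.single 0 (t : ℝ)) =
      fun _ => cellSign o 1 c * (2 * t - 1) := by
    funext l
    have hl : Fin.ofNat (m + 1) l.val = 0 := Fin.ext (by simp)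
    have hv : (Pi.single 0 (t : ℝ) : Fin (m + 1) → ℝ) (Fin.ofNat (m + 1) l.val) = t := by
      rw [hl, Pi.single_eq_same]
    rw [cubeMap_apply _ l (by rw [hv]; exact t.2.1) (by rw [hv]; exact t.2.2), hv]
  rw [h0, h2]
  -- The sign in the cube map reverses the loop exactly when the orientation is the opposite one.
  change RelCWComplex.map 1 c (fun _ => (if o c then (1 : ℝ) else -1) * (2 * t - 1)) = _
  cases o c
  · change _ = RelCWComplex.map 1 c (fun _ => 2 * (1 - (t : ℝ)) - 1)
    congr 1
    funext _
    simp only [Bool.false_eq_true, if_false]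
    ring
  · change _ = RelCWComplex.map 1 c (fun _ => 2 * (t : ℝ) - 1)
    simp

end CW

end ConfSpace

end


noncomputable section

namespace ConfSpace

/-! Naturality in the pointed space -/

section Naturality

variable {X : Type u} [TopologicalSpace X] {x₀ : X}

lemma confHomologyMap_reindex {M : Type v} {N : Type w} (e : M ≃ N) (k : ℕ) (g : PointedMap x₀)
    (z : ConfHomology x₀ M k) :
    confHomologyMap N k g (reindex x₀ e k z) = reindex x₀ e k (confHomologyMap M k g z) := by
  obtain ⟨z, rfl⟩ := Submodule.mkQ_surjective _ z
  refine congrArg homologyClass (Subtype.ext ?_)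
  change chainMap k (postcomp N g.toMap) (chainMap k ⟨fun f => f ∘ e.symm, _⟩ z.1) =
    chainMap k ⟨fun f => f ∘ e.symm, _⟩ (chainMap k (postcomp M g.toMap) z.1)
  rw [← chainMap_comp, ← chainMap_comp]
  rfl

lemma confHomologyMap_kunneth₂ (M : Type v) (N : Type w) (n k l : ℕ) (g : PointedMap x₀)
    (y : ConfHomology x₀ M k) (z : ConfHomology x₀ N l) :
    confHomologyMap (M ⊕ N) n g (kunneth₂ x₀ M N n k l y z) =
      kunneth₂ x₀ M N n k l (confHomologyMap M k g y) (confHomologyMap N l g z) := by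
  obtain ⟨y, rfl⟩ := Submodule.mkQ_surjective _ y
  obtain ⟨z, rfl⟩ := Submodule.mkQ_surjective _ z
  refine congrArg homologyClass (Subtype.ext ?_)
  change chainMap n (postcomp (M ⊕ N) g.toMap) (chainMap n (sumElim M N) (cross n k l y.1 z.1)) =
    chainMap n (sumElim M N) (cross n k l (chainMap k (postcomp M g.toMap) y.1)
      (chainMap l (postcomp N g.toMap) z.1))
  rw [← chainMap_cross, ← chainMap_comp, ← chainMap_comp]
  congr 2
  ext f i
  rcases i with i | i <;> rfl

lemma confHomologyMap_unitClass (M : Type v) [IsEmpty M] (n : ℕ) (g : PointedMap x₀) :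
    confHomologyMap M n g (unitClass x₀ M n) = unitClass x₀ M n := by
  rcases n with _ | n
  · refine congrArg homologyClass (Subtype.ext ?_)
    change chainMap 0 (postcomp M g.toMap) (Finsupp.single _ 1) = Finsupp.single _ 1
    rw [chainMap_single]
    congr 1
    ext x i
    exact isEmptyElim i
  · exact map_zero _

/-- Applying `g` pointwise respects the splitting of `X^N` into factors, so naturality follows by
induction from that of the binary cross product. -/
lemma confHomologyMap_kunneth (r : ℕ) (N : Fin r → Type v) (k : Fin r → ℕ) (n : ℕ)
    (g : PointedMap x₀) (z : ∀ i, ConfHomology x₀ (N i) (k i)) :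
    confHomologyMap (Σ i, N i) n g (kunneth x₀ r N k n z) =
      kunneth x₀ r N k n fun i => confHomologyMap (N i) (k i) g (z i) := by
  induction r generalizing n with
  | zero => exact confHomologyMap_unitClass _ n g
  | succ r ih =>
    have h (z : ∀ i, ConfHomology x₀ (N i) (k i)) : kunneth x₀ (r + 1) N k n z =
        reindex x₀ (sigmaSuccEquiv N) n (kunneth₂ x₀ (N 0) (Σ i : Fin r, N i.succ) n (k 0)
          (∑ i : Fin r, k i.succ) (z 0) (kunneth x₀ r (fun i => N i.succ) (fun i => k i.succ)
            (∑ i : Fin r, k i.succ) fun i => z i.succ)) := rfl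
    rw [h, h, confHomologyMap_reindex, confHomologyMap_kunneth₂, ih]

/-- The endomorphism of the fundamental group induced by a pointed map. -/
abbrev PointedMap.fundamentalGroupMap (g : PointedMap x₀) :
    FundamentalGroup X x₀ →* FundamentalGroup X x₀ :=
  FundamentalGroup.mapOfEq g.toMap g.map_pt

lemma confHomologyMap_triangle (N : Type v) [Fintype N] [LinearOrder N] (g : PointedMap x₀)
    (γ : FundamentalGroup X x₀) :
    confHomologyMap N (Fintype.card N) g (triangle x₀ N γ) =
      triangle x₀ N (g.fundamentalGroupMap γ) := by
  obtain ⟨γ, rfl⟩ := Path.Homotopic.Quotient.mk_surjective γ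
  rw [PointedMap.fundamentalGroupMap, mapOfEq_mk]
  exact (homologyMap_comp _ (postcomp N g.toMap) (simplexOfLoop N γ)
    (fun _ h => postcomp_mem g.map_pt h) (simplexOfLoop_mapsTo N γ) (fundamentalClass _)).symm

lemma confHomologyMap_truncTriangle (hv : TriangleVanishes.{u, v} x₀) (N : Type v) [Fintype N]
    [LinearOrder N] (g : PointedMap x₀)
    (a : TruncAug (FundamentalGroup X x₀) (Fintype.card N)) :
    confHomologyMap N (Fintype.card N) g (truncTriangle hv N a) =
      truncTriangle hv N (truncMap g.fundamentalGroupMap _ a) := by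
  obtain ⟨a, rfl⟩ := Submodule.mkQ_surjective _ a
  have h : confHomologyMap N (Fintype.card N) g ∘ₗ triangleLinear x₀ N = triangleLinear x₀ N ∘ₗ
      (MonoidAlgebra.mapDomainAlgHom ℤ ℤ g.fundamentalGroupMap).toLinearMap := by
    refine groupRing_hom_ext fun γ => ?_
    rw [LinearMap.comp_apply, triangleLinear_of, confHomologyMap_triangle, LinearMap.comp_apply,
      ← triangleLinear_of]
    congr 1
    simp
  exact LinearMap.congr_fun h a.1

/-- A pointed map acts on the classes of loops through the fundamental group, hence on each tensor
factor through the truncated augmentation ideal. -/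
lemma confHomologyMap_tensorTriangle (hv : TriangleVanishes.{u, v} x₀) {N : Type v} [Fintype N]
    (P : OrderedPartition N) (g : PointedMap x₀) :
    confHomologyMap N (Fintype.card N) g ∘ₗ tensorTriangle hv P = tensorTriangle hv P ∘ₗ
      PiTensorProduct.map fun i => truncMap g.fundamentalGroupMap (Fintype.card (P.Part i)) := by
  refine PiTensorProduct.ext (MultilinearMap.ext fun a => ?_)
  simp only [tensorTriangle, LinearMap.compMultilinearMap_apply, LinearMap.comp_apply,
    PiTensorProduct.map_tprod, PiTensorProduct.lift.tprod, MultilinearMap.compLinearMap_apply,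
    confHomologyMap_reindex, confHomologyMap_kunneth, confHomologyMap_truncTriangle]

/-! ### Factorization of the action through the truncated augmentation ideal. -/

lemma truncMap_eq_of_le {G : Type u} {H : Type v} [Group G] [Group H] {φ ψ : G →* H} {k n : ℕ}
    (hkn : k ≤ n) (h : truncMap φ n = truncMap ψ n) : truncMap φ k = truncMap ψ k := by
  have hmul : augIdeal H * augIdeal H ≤ augIdeal H := by
    rw [Submodule.mul_le]
    intro a ha b _
    change augmentation H (a * b) = 0
    rw [map_mul, show augmentation H a = 0 from ha, zero_mul]
  -- The powers of the augmentation ideal decrease, so congruence modulo `I^{n+1}` implies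
  -- congruence modulo `I^{k+1}`. This brings all parts of a partition under the control of the
  -- single quotient for `n`.
  have hle : augIdeal H ^ (n + 1) ≤ augIdeal H ^ (k + 1) := by
    refine antitone_nat_of_succ_le (f := fun j => augIdeal H ^ (j + 1)) (fun j => ?_) hkn
    rw [pow_succ _ (j + 1), pow_succ _ j, mul_assoc]
    exact mul_le_mul_right hmul _
  ext a
  have := LinearMap.congr_fun h (Submodule.Quotient.mk a)
  have h2 := (Submodule.Quotient.eq _).1 this
  exact (Submodule.Quotient.eq _).2 (hle h2)

/-- The action on `𝓗_N` is determined by the one on `I / I^{n+1}`. -/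
lemma confHomologyMap_eq_of_truncMap_eq (hv : TriangleVanishes.{u, v} x₀) {N : Type v} [Fintype N]
    (htop : (⨆ P : OrderedPartition N, LinearMap.range (tensorTriangle hv P)) = ⊤)
    {f g : PointedMap x₀}
    (h : truncMap f.fundamentalGroupMap (Fintype.card N) =
      truncMap g.fundamentalGroupMap (Fintype.card N)) :
    confHomologyMap N (Fintype.card N) f = confHomologyMap N (Fintype.card N) g := by
  rw [← LinearMap.eqLocus_eq_top, eq_top_iff, ← htop, iSup_le_iff]
  rintro P _ ⟨a, rfl⟩
  have hP (i) : truncMap f.fundamentalGroupMap (Fintype.card (P.Part i)) =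
      truncMap g.fundamentalGroupMap (Fintype.card (P.Part i)) :=
    truncMap_eq_of_le (Fintype.card_le_of_injective Subtype.val Subtype.val_injective) h
  have h1 := LinearMap.congr_fun (confHomologyMap_tensorTriangle hv P f) a
  have h2 := LinearMap.congr_fun (confHomologyMap_tensorTriangle hv P g) a
  simp only [hP] at h1
  exact h1.trans h2.symm

/-- A homomorphism factors through the image of another as soon as its kernel contains the kernel of
the other. -/
lemma exists_htpTopHomology_eq (hv : TriangleVanishes.{u, v} x₀) (N : Type v) [Fintype N]
    (htop : (⨆ P : OrderedPartition N, LinearMap.range (tensorTriangle hv P)) = ⊤) :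
    ∃ ρ : (htpTruncAug x₀ (Fintype.card N)).range →* (Module.End ℤ (TopHomology x₀ N))ˣ,
      htpTopHomology x₀ N = ρ.comp (htpTruncAug x₀ (Fintype.card N)).rangeRestrict := by
  have hsurj := (htpTruncAug x₀ (Fintype.card N)).rangeRestrict_surjective
  have hker : (htpTruncAug x₀ (Fintype.card N)).rangeRestrict.ker ≤ (htpTopHomology x₀ N).ker := by
    intro g hg
    rw [MonoidHom.ker_rangeRestrict, MonoidHom.mem_ker] at hg
    rw [MonoidHom.mem_ker]
    -- A representing pointed map of an element of the kernel is compared with the identity map;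
    -- only its action matters, not its invertibility.
    obtain ⟨f, hf⟩ := Con.mk'_surjective (g : (pointedHomotopy x₀).Quotient)
    have h1 : truncMap f.fundamentalGroupMap (Fintype.card N) =
        truncMap (1 : PointedMap x₀).fundamentalGroupMap (Fintype.card N) := by
      have h1 : (truncEnd (FundamentalGroup X x₀) (Fintype.card N)).comp (fundamentalGroupHom x₀)
          (g : (pointedHomotopy x₀).Quotient) = 1 := congrArg Units.val hg
      rw [← hf] at h1
      exact h1.trans (map_one ((truncEnd (FundamentalGroup X x₀) (Fintype.card N)).comp
        (fundamentalGroupHom x₀))).symm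
    refine Units.ext ?_
    change confHomologyHom x₀ N (Fintype.card N) g = 1
    rw [← hf]
    exact (confHomologyMap_eq_of_truncMap_eq hv htop h1).trans
      (map_one (confHomologyHom x₀ N (Fintype.card N)))
  exact ⟨MonoidHom.liftOfSurjective _ hsurj ⟨_, hker⟩,
    (MonoidHom.liftOfRightInverse_comp _ _ _ ⟨_, hker⟩).symm⟩

end Naturality


end ConfSpace

end


/-! ### The main theorem. -/

theorem mainTheorem6 {U : Type u} [TopologicalSpace U] [T2Space (OnePoint U)]
    [Topology.CWComplex (Set.univ : Set (OnePoint U))]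
    [Topology.RelCWComplex.Finite (Set.univ : Set (OnePoint U))]
    (h₀ : ConfSpace.IsOnlyVertex (OnePoint.infty : OnePoint U))
    (N : Type v) [Fintype N] (hN : 0 < Fintype.card N) :
    ∃ hv : ConfSpace.TriangleVanishes.{u, v} (OnePoint.infty : OnePoint U),
      (⨆ P : ConfSpace.OrderedPartition N, LinearMap.range (ConfSpace.tensorTriangle hv P)) = ⊤ ∧
      (∀ o : Topology.RelCWComplex.cell (Set.univ : Set (OnePoint U)) 1 → Bool,
        Submodule.span ℤ {z : ConfSpace.TopHomology (OnePoint.infty : OnePoint U) N |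
          ∃ (P : ConfSpace.OrderedPartition N)
            (c : Fin P.r → Topology.RelCWComplex.cell (Set.univ : Set (OnePoint U)) 1),
            z = ConfSpace.tensorTriangle hv P (PiTensorProduct.tprod ℤ fun i =>
              ConfSpace.truncSubOne (Fintype.card (P.Part i))
                (ConfSpace.cellClass h₀ (o (c i)) (c i)))} = ⊤) ∧
      ∃ ρ : (ConfSpace.htpTruncAug (OnePoint.infty : OnePoint U) (Fintype.card N)).range →*
          (Module.End ℤ (ConfSpace.TopHomology (OnePoint.infty : OnePoint U) N))ˣ,
        ConfSpace.htpTopHomology (OnePoint.infty : OnePoint U) N =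
          ρ.comp (ConfSpace.htpTruncAug (OnePoint.infty : OnePoint U)
            (Fintype.card N)).rangeRestrict := by
  have hv := ConfSpace.triangleVanishes.{u, v} (OnePoint.infty : OnePoint U)
  have h2 (o : Topology.RelCWComplex.cell (Set.univ : Set (OnePoint U)) 1 → Bool) :
      Submodule.span ℤ {z : ConfSpace.TopHomology (OnePoint.infty : OnePoint U) N |
        ∃ (P : ConfSpace.OrderedPartition N)
          (c : Fin P.r → Topology.RelCWComplex.cell (Set.univ : Set (OnePoint U)) 1),
          z = ConfSpace.tensorTriangle hv P (PiTensorProduct.tprod ℤ fun i =>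
            ConfSpace.truncSubOne (Fintype.card (P.Part i))
              (ConfSpace.cellClass h₀ (o (c i)) (c i)))} = ⊤ := by
    -- The cube decomposition is chosen to fit the orientations `o`, so that its loops are the given
    -- classes on the nose.
    obtain ⟨C, hC⟩ := ConfSpace.exists_cellData h₀ o
    choose c hc using hC
    rw [eq_top_iff, ← C.span_tensorTriangle_eq_top hv N]
    refine Submodule.span_mono ?_
    rintro _ ⟨P, e, rfl⟩
    exact ⟨P, fun i => c (e i), by simp only [hc]⟩
  have h1 : (⨆ P : ConfSpace.OrderedPartition N,
      LinearMap.range (ConfSpace.tensorTriangle hv P)) = ⊤ := by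
    -- The generators for any one choice of orientations already lie in the images of the maps.
    rw [eq_top_iff, ← h2 fun _ => true, Submodule.span_le]
    rintro _ ⟨P, c, rfl⟩
    exact le_iSup (fun P : ConfSpace.OrderedPartition N =>
      LinearMap.range (ConfSpace.tensorTriangle hv P)) P ⟨_, rfl⟩
  exact ⟨hv, h1, h2, ConfSpace.exists_htpTopHomology_eq hv N h1⟩
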